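/- **Setting.** Let $d,p\ge 1$ be integers and $\langle k\rangle=(1+|k|^2)^{1/2}$ for $k\in\mathbb Z^d$. For $u=(u_k)_{k\in\mathbb Z^d}\in\mathbb C^{\mathbb Z^d}$ let $\|u\|_{\ell^1}=\sum_k|u_k|$ and $\|u\|_{H^s}^2=\sum_k\langle k\rangle^{2s}|u_k|^2$; $\ell^1$ and $H^s$ are the corresponding spaces, regarded as real vector spaces, $\ell^1\cap H^s$ carries the norm $\|\cdot\|_{\ell^1}+\|\cdot\|_{H^s}$, and $B_{\ell^1}(0,\rho)$ is the open ball of radius $\rho$ in $\ell^1$. Set $(u,v)_{L^2}=\mathrm{Re}\sum_k u_k\overline{v_k}$. The gradient $\nabla F(u)\in\ell^\infty$ of a smooth function $F$, real-valued on an open subset of $\ell^1$, is defined by $(\nabla F(u),v)_{L^2}=\mathrm dF(u)(v)$ for all $v\in\ell^1$. A smooth map $\tau:U\to\ell^1$ on an open set $U\subset\ell^1$ is symplectic if $(iv,w)_{L^2}=(i\,\mathrm d\tau(u)(v),\mathrm d\tau(u)(w))_{L^2}$ for all $u\in U$ and $v,w\in\ell^1$. For $q\ge2$ let $\mathscr H_{2q}$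 be the set of formal polynomials $$P(u)=\sum_{\boldsymbol k,\boldsymbol\ell\in(\mathbb Z^d)^q}P_{\boldsymbol k,\boldsymbol\ell}\,u_{\boldsymbol k_1}\cdots u_{\boldsymbol k_q}\overline{u_{\boldsymbol\ell_1}}\cdots\overline{u_{\boldsymbol\ell_q}},\qquad P_{\boldsymbol k,\boldsymbol\ell}\in\mathbb C,$$ such that $P_{\boldsymbol\ell,\boldsymbol k}=\overline{P_{\boldsymbol k,\boldsymbol\ell}}$, $P_{\boldsymbol k,\boldsymbol\ell}$ is invariant under permutations of the entries of $\boldsymbol k$ and of $\boldsymbol\ell$ separately, $P_{\boldsymbol k,\boldsymbol\ell}\ne0$ only if $\boldsymbol k_1+\cdots+\boldsymbol k_q=\boldsymbol\ell_1+\cdots+\boldsymbol\ell_q$, and $\|P\|_{\ell^\infty}:=\sup_{\boldsymbol k,\boldsymbol\ell}|P_{\boldsymbol k,\boldsymbol\ell}|<\infty$. Each such $P$ defines a real-valued function on $\ell^1$. Let $P\in\mathscr H_{2p+2}$, let $\omega_k\in\mathbb R$ $(k\in\mathbb Z^d)$ satisfy $|\omega_k|\lesssim\langle k\rangle^2$,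 and let $$H=Z_2+P,\qquad Z_2(u)=\sum_{k}\omega_k|u_k|^2 .$$ For $\nu>0$, $L\in\mathscr H_{2q}$ is called $\nu$-resonant if $L_{\boldsymbol k,\boldsymbol\ell}=0$ whenever $|\Omega(\boldsymbol k,\boldsymbol\ell)|\ge\nu$, where $\Omega(\boldsymbol k,\boldsymbol\ell)=2i(\omega_{\boldsymbol k_1}+\cdots+\omega_{\boldsymbol k_q}-\omega_{\boldsymbol\ell_1}-\cdots-\omega_{\boldsymbol\ell_q})$. **Theorem (Birkhoff normal form).** There is a constant $C>1$, depending only on $P$, such that for all such $\omega$, all $\nu\in(0,1)$ and all integers $r\ge2$, setting $\rho=\frac{\sqrt\nu}{Cr}$, there exist two $C^\infty$ symplectic maps $\tau^{(0)}:B_{\ell^1}(0,\rho)\to B_{\ell^1}(0,2\rho)$ and $\tau^{(1)}:B_{\ell^1}(0,2\rho)\to\ell^1$ with $\tau^{(1)}\circ\tau^{(0)}=\mathrm{id}$ on $B_{\ell^1}(0,\rho)$, polynomials $L^{(2q)}\in\mathscr H_{2q}$ $(2\le q\le r)$ and a $C^\infty$ function $R:B_{\ell^1}(0,2\rho)\to\mathbb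 R$ with the following properties, where the constants implied by $\lesssim_s$ depend only on $s$, $d$ and $p$. 1. For all $u\in B_{\ell^1}(0,2\rho)\cap H^1$ (so that $Z_2(u)$ and $Z_2(\tau^{(1)}(u))$ converge), $$H\circ\tau^{(1)}(u)=Z_2(u)+\sum_{q=2}^rL^{(2q)}(u)+R(u).$$ 2. For $2\le q\le r$, $L^{(2q)}$ is $\nu$-resonant and $\|L^{(2q)}\|_{\ell^\infty}\le C^{2q}\big(\tfrac{q^2}{\nu}\big)^{q-2}$. 3. For all $s\ge0$ and $u\in B_{\ell^1}(0,2\rho)\cap H^s$, $\nabla R(u)\in H^s$ and $$\|\nabla R(u)\|_{H^s}\lesssim_s C^{2r}\Big(\frac{r^3}{\nu}\Big)^{r-1}\|u\|_{\ell^1}^{2r}\,\|u\|_{H^s}.$$ 4. For all $\sigma\in\{0,1\}$, $s\ge0$ and $u\in B_{\ell^1}(0,2^\sigma\rho)\cap H^s$, $\tau^{(\sigma)}(u)\in H^s$ and $\|\tau^{(\sigma)}(u)\|_{H^s}\lesssim_s\|u\|_{H^s}$; moreover $\tau^{(\sigma)}:B_{\ell^1}(0,2^\sigma\rho)\cap H^s\to\ell^1\cap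 H^s$ is $C^\infty$. -/

import Mathlib

open scoped ContDiff ComplexConjugate

noncomputable section

/-- The lattice `ℤ^d` of Fourier modes. -/
abbrev FreqLattice (d : ℕ) : Type := Fin d → ℤ

/-- The Japanese bracket `⟨k⟩ = (1 + |k|²)^{1/2}`, with `|k|` the Euclidean norm. -/
def bracket {d : ℕ} (k : FreqLattice d) : ℝ :=
  Real.sqrt (1 + ∑ i, (k i : ℝ) ^ 2)

/-- The Banach space `ℓ¹(ℤ^d; ℂ)`; it is used as a real normed space below. -/
abbrev EllOne (d : ℕ) : Type := lp (fun _ : FreqLattice d => ℂ) 1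

/-- The Hilbert space `ℓ²(ℤ^d; ℂ)`. -/
abbrev EllTwo (d : ℕ) : Type := lp (fun _ : FreqLattice d => ℂ) 2

/-- The sequence `u` belongs to `H^s`: the series `∑ ⟨k⟩^{2s} |u_k|²` converges. -/
def MemHs {d : ℕ} (s : ℝ) (u : FreqLattice d → ℂ) : Prop :=
  Summable fun k => bracket k ^ (2 * s) * ‖u k‖ ^ 2

/-- The `H^s` norm `(∑ ⟨k⟩^{2s} |u_k|²)^{1/2}` (meaningful when `MemHs s u`). -/
def hsNorm {d : ℕ} (s : ℝ) (u : FreqLattice d → ℂ) : ℝ :=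
  Real.sqrt (∑' k, bracket k ^ (2 * s) * ‖u k‖ ^ 2)

/-- The real scalar product `(u, v)_{L²} = Re ∑ u_k conj(v_k)`, also used as the duality
pairing between `ℓ^∞` and `ℓ¹`. -/
def realPairing {d : ℕ} (u v : FreqLattice d → ℂ) : ℝ :=
  (∑' k, u k * conj (v k)).re

/-- The space `ℓ¹ ∩ H^s`, realized as the space of pairs `(u, (⟨k⟩^s u_k)_k)` in `ℓ¹ × ℓ²`.
The norm inherited from the product is `max (‖u‖_{ℓ¹}) (‖u‖_{H^s})`, which is equivalent to
the usual norm `‖u‖_{ℓ¹} + ‖u‖_{H^s}`. -/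
def EllOneHs (d : ℕ) (s : ℝ) : Submodule ℝ (EllOne d × EllTwo d) where
  carrier := {x | ∀ k, x.2 k = ((bracket k ^ s : ℝ) : ℂ) * x.1 k}
  zero_mem' := by intro k; simp
  add_mem' := by
    intro x y hx hy k
    have h1 := hx k
    have h2 := hy k
    simp only [Prod.snd_add, Prod.fst_add, lp.coeFn_add, Pi.add_apply]
    rw [h1, h2]
    ring
  smul_mem' := by
    intro c x hx k
    have h1 := hx k
    simp only [Prod.smul_snd, Prod.smul_fst, lp.coeFn_smul, Pi.smul_apply, Complex.real_smul]
    rw [h1]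
    ring

/-- The inclusion `ℓ¹ ∩ H^s → ℓ¹`. -/
def EllOneHs.toEllOne {d : ℕ} {s : ℝ} (u : EllOneHs d s) : EllOne d := u.1.1

/-- `g ∈ ℓ^∞` is the gradient at `u ∈ ℓ¹` of the real-valued function `F` on `ℓ¹`:
`(g, v)_{L²} = dF(u)(v)` for all `v ∈ ℓ¹`. There is at most one such `g`. -/
def IsGradient {d : ℕ} (F : EllOne d → ℝ) (u : EllOne d) (g : FreqLattice d → ℂ) : Prop :=
  DifferentiableAt ℝ F u ∧ Memℓp g ⊤ ∧ ∀ v : EllOne d, realPairing g v = fderiv ℝ F u v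

/-- A differentiable map `τ : U → ℓ¹` on an open set `U` is symplectic if it preserves the form
`(i ·, ·)_{L²}`. -/
def IsSymplecticOn {d : ℕ} (τ : EllOne d → EllOne d) (U : Set (EllOne d)) : Prop :=
  ∀ u ∈ U, ∀ v w : EllOne d,
    realPairing (Complex.I • (v : FreqLattice d → ℂ)) w =
      realPairing (Complex.I • (fderiv ℝ τ u v : FreqLattice d → ℂ)) (fderiv ℝ τ u w)

/-- The homogeneous formal polynomials of degree `2q`, given by their coefficients `P_{k,ℓ}`:
reality, symmetry, zero momentum and boundedness. -/
structure HomPoly (d q : ℕ) where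
  coeff : (Fin q → FreqLattice d) → (Fin q → FreqLattice d) → ℂ
  reality : ∀ k l, coeff l k = conj (coeff k l)
  symmetry : ∀ (φ σ : Equiv.Perm (Fin q)) (k l : Fin q → FreqLattice d),
    coeff (fun j => k (φ j)) (fun j => l (σ j)) = coeff k l
  zero_momentum : ∀ k l, coeff k l ≠ 0 → ∑ j, k j = ∑ j, l j
  bounded : ∃ B : ℝ, ∀ k l, ‖coeff k l‖ ≤ B

/-- The norm `‖P‖_{ℓ^∞} = sup_{k,ℓ} |P_{k,ℓ}|`. -/
def HomPoly.supNorm {d q : ℕ} (P : HomPoly d q) : ℝ :=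
  ⨆ x : (Fin q → FreqLattice d) × (Fin q → FreqLattice d), ‖P.coeff x.1 x.2‖

/-- The value `P(u) = ∑_{k,ℓ} P_{k,ℓ} u_{k₁} ⋯ u_{k_q} conj(u_{ℓ₁}) ⋯ conj(u_{ℓ_q})`. On `ℓ¹` the
series converges absolutely and, by the reality condition, its sum is a real number. -/
def HomPoly.eval {d q : ℕ} (P : HomPoly d q) (u : FreqLattice d → ℂ) : ℝ :=
  (∑' x : (Fin q → FreqLattice d) × (Fin q → FreqLattice d),
    P.coeff x.1 x.2 * (∏ j, u (x.1 j)) * ∏ j, conj (u (x.2 j))).re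

/-- The quadratic Hamiltonian `Z₂(u) = ∑ freq_k |u_k|²`. -/
def quadHam {d : ℕ} (freq : FreqLattice d → ℝ) (u : FreqLattice d → ℂ) : ℝ :=
  ∑' k, freq k * ‖u k‖ ^ 2

/-- The Hamiltonian `H = Z₂ + P`. -/
def hamiltonian {d q : ℕ} (freq : FreqLattice d → ℝ) (P : HomPoly d q)
    (u : FreqLattice d → ℂ) : ℝ :=
  quadHam freq u + P.eval u

/-- The small divisor
`Ω(k,ℓ) = 2i (freq_{k₁} + ⋯ + freq_{k_q} - freq_{ℓ₁} - ⋯ - freq_{ℓ_q})`. -/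
def smallDivisor {d q : ℕ} (freq : FreqLattice d → ℝ) (k l : Fin q → FreqLattice d) : ℂ :=
  2 * Complex.I * (((∑ j, freq (k j)) - ∑ j, freq (l j) : ℝ) : ℂ)

/-- `ν`-resonant polynomials (for the frequencies `freq`). -/
def HomPoly.IsResonant {d q : ℕ} (freq : FreqLattice d → ℝ) (ν : ℝ) (P : HomPoly d q) : Prop :=
  ∀ k l, ν ≤ ‖smallDivisor freq k l‖ → P.coeff k l = 0

end

noncomputable section

open scoped ENNReal

/-! ### Sums over finite families of indices -/

/-! A single time-dependent generator replaces the usual composition of successive Lie transforms.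
Let χ(t) = ∑ t^(n-1) χ_n over 1 ≤ n < r, with χ_n of degree 2n+2, and let γ be the integral curve of
i∇χ(t) on [0,1] with γ(0) = u. One seeks W_t = ∑ t^(n-p) W_n with W_t(γ(t)) = P(u), and N_t = Z₂ + ∑
t^n Q_n with N_t(γ(t)) = Z₂(u) + t^p P(u). Differentiating in t and comparing powers gives, with
{F,G} = (∇F, i∇G), (n-p) W_n + ∑_{i+j=n} {W_i, χ_j} = 0 (`transport_eq`), n Q_n + {Z₂, χ_n} +
∑_{i+j=n} {Q_i, χ_j} = p W_n (`homological_eq`). The bracket with Z₂ multiplies coefficients by -Ω.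
For n < r, χ_n removes the coefficients with |Ω| ≥ ν at the cost of a factor 1/ν, and Q_n is
resonant; for n ≥ r, χ_n = 0. At t = 1 this reads H(u) = Z₂(γ(1)) + ∑ Q_n(γ(1)). So τ⁽⁰⁾ is the time
one map, τ⁽¹⁾ that of the reversed flow, L^(2n+2) = Q_n for n < r, and R is the rest of the series.

Growth of the coefficients: a bracket costs the product of the degrees. A first induction gives
(n!)² (D/ν)^n (`NormRecursion.factorial_bounds`). Since the generators stop at order r, their
factorials are at most powers of r, and a second induction, using the divisions by n and n-p, gives
geometric growth with rate of order r²/ν at every order (`NormRecursion.pow_bounds`). The series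
therefore converge for ‖u‖ of order √ν/r.

Sobolev estimates: the fields are convolutions with bounded coefficients, controlled by Young's
inequality. On ℓ¹ ∩ H^s with the norm max(‖u‖_{ℓ¹}, δ‖u‖_{H^s}) the multilinear bounds do not depend
on δ; choosing δ so that both entries agree at a given u gives bounds linear in ‖u‖_{H^s} and of the
right degree in ‖u‖_{ℓ¹}. The constants depend on s while ρ must not, so for large s the time
interval is halved until each piece is short enough (`liftsAt_of_le`).

The flow solves γ - ∫X(γ) = u in the space of curves, a small perturbation of the identity inverted
smoothly by `exists_smooth_inverse_sub`. It is symplectic because Hessians are symmetric. The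
conservation law involves Z₂, which needs H¹, and is derived along curves in a weighted H¹ space. -/

theorem ENNReal.tsum_pi_prod {ι : Type*} [Fintype ι] {Z : Type*} (a : ι → Z → ℝ≥0∞) :
    ∑' κ : ι → Z, ∏ i, a i (κ i) = ∏ i, ∑' x, a i x := by
  refine Fintype.induction_empty_option
    (P := fun ι _ => ∀ a : ι → Z → ℝ≥0∞, ∑' κ : ι → Z, ∏ i, a i (κ i) = ∏ i, ∑' x, a i x)
    ?_ ?_ ?_ ι a
  · intro α β _ e ih a
    let : Fintype α := Fintype.ofEquiv β e.symm
    have h := ih (fun i => a (e i))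
    rw [← Equiv.prod_comp e (fun i => ∑' x, a i x)]
    refine Eq.trans ?_ h
    rw [← Equiv.tsum_eq (e.arrowCongr (Equiv.refl Z))]
    refine tsum_congr fun κ => ?_
    rw [← Equiv.prod_comp e]
    simp [Equiv.arrowCongr]
  · intro a
    simp
  · intro α _ ih a
    rw [← Equiv.tsum_eq (Equiv.piOptionEquivProd (β := fun _ : Option α => Z)).symm]
    simp only [Fintype.prod_option]
    rw [← ih, ← ENNReal.tsum_mul_right, ENNReal.tsum_prod']
    refine tsum_congr fun x => ?_
    rw [← ENNReal.tsum_mul_left]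
    rfl

theorem ENNReal.two_mul_le_sq_add_sq (a b : ℝ≥0∞) : 2 * (a * b) ≤ a ^ 2 + b ^ 2 := by
  rcases eq_or_ne a ∞ with rfl | ha
  · simp
  rcases eq_or_ne b ∞ with rfl | hb
  · simp
  lift a to NNReal using ha
  lift b to NNReal using hb
  have := two_mul_le_add_sq a b
  rw [← mul_assoc]
  exact_mod_cast this

/-- The weighted Cauchy–Schwarz inequality for series. -/
theorem ENNReal.sq_tsum_mul_le {K : Type*} (b q : K → ℝ≥0∞) :
    (∑' k, b k * q k) ^ 2 ≤ (∑' k, q k) * ∑' k, b k ^ 2 * q k := by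
  have h : 2 * (∑' k, b k * q k) ^ 2 ≤ 2 * ((∑' k, q k) * ∑' k, b k ^ 2 * q k) := by
    calc 2 * (∑' k, b k * q k) ^ 2
        = ∑' k, ∑' l, 2 * (b k * b l) * (q k * q l) := by
          rw [sq, ← ENNReal.tsum_mul_right, ← ENNReal.tsum_mul_left]
          refine tsum_congr fun k => ?_
          rw [← ENNReal.tsum_mul_left, ← ENNReal.tsum_mul_left]
          exact tsum_congr fun l => by ring
      _ ≤ ∑' k, ∑' l, (b k ^ 2 + b l ^ 2) * (q k * q l) := by
          gcongr with k l
          exact ENNReal.two_mul_le_sq_add_sq _ _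
      _ = ∑' k, ∑' l, (b k ^ 2 * q k) * q l + ∑' k, ∑' l, q k * (b l ^ 2 * q l) := by
          rw [← ENNReal.tsum_add]
          refine tsum_congr fun k => ?_
          rw [← ENNReal.tsum_add]
          exact tsum_congr fun l => by ring
      _ = 2 * ((∑' k, q k) * ∑' k, b k ^ 2 * q k) := by
          simp_rw [ENNReal.tsum_mul_left, ENNReal.tsum_mul_right]
          ring
  exact (ENNReal.mul_le_mul_iff_right (by simp) (by simp)).1 h

theorem ENNReal.sq_sum_le {ι : Type*} (s : Finset ι) (f : ι → ℝ≥0∞) :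
    (∑ i ∈ s, f i) ^ 2 ≤ s.card * ∑ i ∈ s, f i ^ 2 := by
  have := ENNReal.inner_le_Lp_mul_Lq s (fun _ => 1) f Real.HolderConjugate.two_two
  simp only [one_mul, ENNReal.one_rpow, Finset.sum_const, nsmul_eq_mul, mul_one] at this
  calc (∑ i ∈ s, f i) ^ 2
      ≤ ((s.card : ℝ≥0∞) ^ (1 / 2 : ℝ) * (∑ i ∈ s, f i ^ (2 : ℝ)) ^ (1 / 2 : ℝ)) ^ 2 := by
        gcongr
    _ = _ := by
        rw [mul_pow, ← ENNReal.rpow_two, ← ENNReal.rpow_two, ← ENNReal.rpow_mul,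
          ← ENNReal.rpow_mul]
        norm_num

/-! ### Young's inequality for signed convolutions. -/

section Convolution

variable {Z : Type*} [AddCommGroup Z] {ι : Type*} [Fintype ι] [DecidableEq ι]

/-- The momentum `∑ ± κ_i` of a family of modes, with the signs given by `ε`. -/
def momentum (ε : ι → Bool) (κ : ι → Z) : Z := ∑ i, if ε i then κ i else -κ i

open Classical in
/-- The part of momentum `m` of the series of products: a signed convolution. -/
def signedConv (ε : ι → Bool) (f : (ι → Z) → ℝ≥0∞) (m : Z) : ℝ≥0∞ :=
  ∑' κ : ι → Z, if momentum ε κ = m then f κ else 0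

theorem momentum_funSplitAt (ε : ι → Bool) (j : ι) (x : Z) (κ : {i // i ≠ j} → Z) :
    momentum ε ((Equiv.funSplitAt j Z).symm (x, κ)) =
      (if ε j then x else -x) + momentum (fun i => ε i.1) κ := by
  unfold momentum
  rw [Fintype.sum_eq_add_sum_subtype_ne _ j]
  congr 1
  · simp [Equiv.funSplitAt, Equiv.piSplitAt]
  · refine Finset.sum_congr rfl fun i _ => ?_
    simp [Equiv.funSplitAt, Equiv.piSplitAt, i.2]

/-- Fixing the total momentum determines the mode at `j` from the others. The convolution is then an
average of translates or reflections of `b`, weighted by `q` of total mass `∏ ∑ a i`. The weighted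
Cauchy–Schwarz inequality and the translation invariance of the ℓ² sum conclude. -/
theorem tsum_signedConv_sq_le (ε : ι → Bool) (j : ι) (b : Z → ℝ≥0∞) (a : ι → Z → ℝ≥0∞) :
    ∑' m, signedConv ε (fun κ => b (κ j) * ∏ i : {i // i ≠ j}, a i (κ i)) m ^ 2 ≤
      (∑' x, b x ^ 2) * ∏ i : {i // i ≠ j}, (∑' x, a i x) ^ 2 := by
  classical
  set q : ({i // i ≠ j} → Z) → ℝ≥0∞ := fun κ => ∏ i : {i // i ≠ j}, a i.1 (κ i) with hq
  set M : ({i // i ≠ j} → Z) → Z := momentum (fun i => ε i.1) with hM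
  have hD : ∀ m, signedConv ε (fun κ => b (κ j) * ∏ i : {i // i ≠ j}, a i (κ i)) m =
      ∑' κ, b (if ε j then m - M κ else -(m - M κ)) * q κ := by
    intro m
    unfold signedConv
    rw [← Equiv.tsum_eq (Equiv.funSplitAt j Z).symm, ENNReal.tsum_prod', ENNReal.tsum_comm]
    refine tsum_congr fun κ => ?_
    rw [tsum_eq_single (if ε j then m - M κ else -(m - M κ))]
    · rw [if_pos]
      · refine congrArg₂ (· * ·) ?_ ?_
        · simp [Equiv.funSplitAt, Equiv.piSplitAt]
        · refine Finset.prod_congr rfl fun i _ => ?_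
          simp [Equiv.funSplitAt, Equiv.piSplitAt, i.2]
      · rw [momentum_funSplitAt]
        split_ifs <;> simp [hM]
    · intro x hx
      rw [if_neg]
      rw [momentum_funSplitAt]
      rintro rfl
      apply hx
      split_ifs <;> simp [hM]
  have hS : ∑' κ, q κ = ∏ i : {i // i ≠ j}, ∑' x, a i x :=
    ENNReal.tsum_pi_prod fun (i : {i // i ≠ j}) => a i
  calc ∑' m, signedConv ε (fun κ => b (κ j) * ∏ i : {i // i ≠ j}, a i (κ i)) m ^ 2
      ≤ ∑' m, (∑' κ, q κ) * ∑' κ, b (if ε j then m - M κ else -(m - M κ)) ^ 2 * q κ := by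
        gcongr with m
        rw [hD]
        exact ENNReal.sq_tsum_mul_le _ _
    _ = (∑' κ, q κ) * ∑' κ, (∑' x, b x ^ 2) * q κ := by
        rw [ENNReal.tsum_mul_left, ENNReal.tsum_comm]
        congr 1
        refine tsum_congr fun κ => ?_
        rw [ENNReal.tsum_mul_right]
        congr 1
        split_ifs
        · exact (Equiv.subRight (M κ)).tsum_eq fun x => b x ^ 2
        · exact ((Equiv.subRight (M κ)).trans (Equiv.neg Z)).tsum_eq fun x => b x ^ 2
    _ = _ := by
        rw [ENNReal.tsum_mul_left, hS, Finset.prod_pow]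
        ring

/-- Young's inequality for signed convolutions in a weighted `ℓ²` space whose weight is
subadditive up to the constant `c`. -/
theorem tsum_weight_mul_signedConv_sq_le (ε : ι → Bool) (w : Z → ℝ≥0∞) (c : ℝ≥0∞)
    (hw : ∀ κ : ι → Z, w (momentum ε κ) ≤ c * ∑ j, w (κ j)) (a : ι → Z → ℝ≥0∞) :
    ∑' m, (w m * signedConv ε (fun κ => ∏ i, a i (κ i)) m) ^ 2 ≤
      c ^ 2 * Fintype.card ι * ∑ j, (∑' x, (w x * a j x) ^ 2) *
        ∏ i : {i // i ≠ j}, (∑' x, a i x) ^ 2 := by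
  classical
  set D : ι → Z → ℝ≥0∞ := fun j =>
    signedConv ε (fun κ => (fun x => w x * a j x) (κ j) * ∏ i : {i // i ≠ j}, a i (κ i)) with hD
  -- Subadditivity lets the weight of the output fall on one input at a time; each resulting term is
  -- a convolution of one ℓ² factor with ℓ¹ factors.
  have h1 : ∀ m, w m * signedConv ε (fun κ => ∏ i, a i (κ i)) m ≤ c * ∑ j, D j m := by
    intro m
    simp only [hD, signedConv]
    rw [← ENNReal.tsum_mul_left, ← Summable.tsum_finsetSum (fun _ _ => ENNReal.summable),
      ← ENNReal.tsum_mul_left]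
    refine ENNReal.tsum_le_tsum fun κ => ?_
    by_cases hκ : momentum ε κ = m
    · simp only [hκ, if_true]
      have h2 : ∀ j, w (κ j) * a j (κ j) * ∏ i : {i // i ≠ j}, a i (κ i) =
          w (κ j) * ∏ i, a i (κ i) := by
        intro j
        rw [Fintype.prod_eq_mul_prod_subtype_ne _ j, mul_assoc]
      simp_rw [h2]
      rw [← Finset.sum_mul, ← mul_assoc]
      gcongr
      rw [← hκ]
      exact hw κ
    · simp [hκ]
  calc ∑' m, (w m * signedConv ε (fun κ => ∏ i, a i (κ i)) m) ^ 2
      ≤ ∑' m, c ^ 2 * (Fintype.card ι * ∑ j, D j m ^ 2) := by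
        gcongr with m
        refine (pow_le_pow_left₀ zero_le (h1 m) 2).trans ?_
        rw [mul_pow]
        gcongr
        exact ENNReal.sq_sum_le _ _
    _ = c ^ 2 * Fintype.card ι * ∑ j, ∑' m, D j m ^ 2 := by
        rw [ENNReal.tsum_mul_left, ENNReal.tsum_mul_left,
          Summable.tsum_finsetSum (fun _ _ => ENNReal.summable), mul_assoc]
    _ ≤ _ := by
        gcongr with j
        exact tsum_signedConv_sq_le ε j _ a

end Convolution
end

noncomputable section

open scoped ENNReal

/-! ### Norms in `ℓ¹` and `ℓ²` as extended nonnegative series -/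

theorem EllOne.enorm_eq {d : ℕ} (u : EllOne d) : ‖u‖ₑ = ∑' k, ‖u k‖ₑ := by
  have h := lp.norm_eq_tsum_rpow (p := 1) (by simp) u
  have hs : Summable fun k => ‖u k‖ := by
    simpa using (memℓp_gen_iff (p := 1) (by simp)).1 (lp.memℓp u)
  simp only [ENNReal.toReal_one, Real.rpow_one, one_div, inv_one] at h
  rw [← ofReal_norm, h, ENNReal.ofReal_tsum_of_nonneg (fun _ => norm_nonneg _) hs]
  simp [ofReal_norm]

theorem EllOne.summable_norm {d : ℕ} (u : EllOne d) : Summable fun k => ‖u k‖ := by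
  simpa using (memℓp_gen_iff (p := 1) (by simp)).1 (lp.memℓp u)

theorem EllOne.norm_eq {d : ℕ} (u : EllOne d) : ‖u‖ = ∑' k, ‖u k‖ := by
  simpa using lp.norm_eq_tsum_rpow (p := 1) (by simp) u

theorem EllTwo.summable_norm_sq {d : ℕ} (u : EllTwo d) : Summable fun k => ‖u k‖ ^ 2 := by
  simpa using (memℓp_gen_iff (p := 2) (by simp)).1 (lp.memℓp u)

theorem EllTwo.norm_sq_eq {d : ℕ} (u : EllTwo d) : ‖u‖ ^ 2 = ∑' k, ‖u k‖ ^ 2 := by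
  have h := lp.norm_rpow_eq_tsum (p := 2) (by simp) u
  simpa using h

theorem EllTwo.enorm_sq_eq {d : ℕ} (u : EllTwo d) : ‖u‖ₑ ^ 2 = ∑' k, ‖u k‖ₑ ^ 2 := by
  rw [← ofReal_norm, ← ENNReal.ofReal_pow (norm_nonneg _), EllTwo.norm_sq_eq,
    ENNReal.ofReal_tsum_of_nonneg (fun _ => by positivity) u.summable_norm_sq]
  simp [ENNReal.ofReal_pow, ofReal_norm]

theorem memℓp_two_of_tsum_enorm {K : Type*} {f : K → ℂ} (h : ∑' k, ‖f k‖ₑ ^ 2 ≠ ⊤) :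
    Memℓp f 2 := by
  rw [memℓp_gen_iff (by simp)]
  have := ENNReal.summable_toReal h
  simpa using this

theorem summable_of_tsum_enorm {K E : Type*} [NormedAddCommGroup E] [CompleteSpace E]
    {f : K → E} (h : ∑' k, ‖f k‖ₑ ≠ ⊤) : Summable f := by
  have := ENNReal.summable_toReal h
  exact Summable.of_norm (by simpa using this)

/-! ### Monomials and multilinear maps given by bounded coefficient arrays -/

/-- Complex conjugation, applied when the sign is negative. -/
def conjIf (b : Bool) (z : ℂ) : ℂ := if b then z else conj z

theorem norm_conjIf (b : Bool) (z : ℂ) : ‖conjIf b z‖ = ‖z‖ := by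
  cases b <;> simp [conjIf]

theorem conjIf_add (b : Bool) (z w : ℂ) : conjIf b (z + w) = conjIf b z + conjIf b w := by
  cases b <;> simp [conjIf]

theorem conjIf_real_mul (b : Bool) (c : ℝ) (z : ℂ) : conjIf b (c * z) = c * conjIf b z := by
  cases b <;> simp [conjIf]

section Arrays

variable {d : ℕ} {ι : Type*} [Fintype ι]

/-- The monomial `∏ u_i(κ_i)^±`. -/
def monom (ε : ι → Bool) (u : ι → FreqLattice d → ℂ) (κ : ι → FreqLattice d) : ℂ :=
  ∏ i, conjIf (ε i) (u i (κ i))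

theorem enorm_monom (ε : ι → Bool) (u : ι → FreqLattice d → ℂ) (κ : ι → FreqLattice d) :
    ‖monom ε u κ‖ₑ = ∏ i, ‖u i (κ i)‖ₑ := by
  have h : ‖monom ε u κ‖₊ = ∏ i, ‖u i (κ i)‖₊ := by
    rw [monom, nnnorm_prod]
    refine Finset.prod_congr rfl fun i _ => ?_
    exact NNReal.eq (norm_conjIf _ _)
  rw [enorm_eq_nnnorm, h]
  simp [enorm_eq_nnnorm]

theorem monom_update [DecidableEq ι] (ε : ι → Bool) (u : ι → EllOne d) (i : ι) (x : EllOne d)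
    (κ : ι → FreqLattice d) :
    monom ε (fun j => (Function.update u i x j : EllOne d)) κ =
      conjIf (ε i) (x (κ i)) * ∏ j : {j // j ≠ i}, conjIf (ε j) (u j (κ j)) := by
  unfold monom
  rw [Fintype.prod_eq_mul_prod_subtype_ne _ i]
  congr 1
  · simp
  · refine Finset.prod_congr rfl fun j _ => ?_
    simp [Function.update_of_ne j.2]

theorem tsum_enorm_mul_monom_le (ε : ι → Bool) {F : (ι → FreqLattice d) → ℂ} {B : ℝ}
    (hF : ∀ κ, ‖F κ‖ ≤ B) (u : ι → EllOne d) :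
    ∑' κ, ‖F κ * monom ε (fun i => u i) κ‖ₑ ≤ ENNReal.ofReal B * ∏ i, ‖u i‖ₑ := by
  simp_rw [EllOne.enorm_eq]
  rw [← ENNReal.tsum_pi_prod, ← ENNReal.tsum_mul_left]
  refine ENNReal.tsum_le_tsum fun κ => ?_
  rw [enorm_mul, enorm_monom]
  gcongr
  rw [← ofReal_norm]
  exact ENNReal.ofReal_le_ofReal (hF κ)

theorem tsum_enorm_mul_monom_ne_top (ε : ι → Bool) {F : (ι → FreqLattice d) → ℂ} {B : ℝ}
    (hF : ∀ κ, ‖F κ‖ ≤ B) (u : ι → EllOne d) :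
    ∑' κ, ‖F κ * monom ε (fun i => u i) κ‖ₑ ≠ ⊤ :=
  ne_top_of_le_ne_top (ENNReal.mul_ne_top (by simp) (ENNReal.prod_ne_top (by simp)))
    (tsum_enorm_mul_monom_le ε hF u)

theorem summable_mul_monom (ε : ι → Bool) {F : (ι → FreqLattice d) → ℂ} {B : ℝ}
    (hF : ∀ κ, ‖F κ‖ ≤ B) (u : ι → EllOne d) :
    Summable fun κ => F κ * monom ε (fun i => u i) κ :=
  summable_of_tsum_enorm (tsum_enorm_mul_monom_ne_top ε hF u)

/-- The `ℓ¹`-valued series `∑ F_κ ∏ u_i(κ_i)^± e_{∑ ± κ_i}`. -/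
def arrVec (ε : ι → Bool) (F : (ι → FreqLattice d) → ℂ) (u : ι → FreqLattice d → ℂ) :
    EllOne d :=
  ∑' κ, lp.single 1 (momentum ε κ) (F κ * monom ε u κ)

theorem summable_arrVec (ε : ι → Bool) {F : (ι → FreqLattice d) → ℂ} {B : ℝ}
    (hF : ∀ κ, ‖F κ‖ ≤ B) (u : ι → EllOne d) :
    Summable fun κ => (lp.single 1 (momentum ε κ) (F κ * monom ε (fun i => u i) κ) : EllOne d) := by
  refine Summable.of_norm ?_
  simp_rw [lp.norm_single (E := fun _ : FreqLattice d => ℂ) (p := 1) (by simp)]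
  simpa using ENNReal.summable_toReal (tsum_enorm_mul_monom_ne_top ε hF u)

theorem norm_arrVec_le (ε : ι → Bool) {F : (ι → FreqLattice d) → ℂ} {B : ℝ} (hB : 0 ≤ B)
    (hF : ∀ κ, ‖F κ‖ ≤ B) (u : ι → EllOne d) :
    ‖arrVec ε F (fun i => u i)‖ ≤ B * ∏ i, ‖u i‖ := by
  have h1 : ‖arrVec ε F (fun i => u i)‖ ≤ ∑' κ, ‖F κ * monom ε (fun i => u i) κ‖ := by
    refine (norm_tsum_le_tsum_norm ?_).trans (le_of_eq ?_)
    · simp_rw [lp.norm_single (E := fun _ : FreqLattice d => ℂ) (p := 1) (by simp)]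
      simpa using ENNReal.summable_toReal (tsum_enorm_mul_monom_ne_top ε hF u)
    · simp_rw [lp.norm_single (E := fun _ : FreqLattice d => ℂ) (p := 1) (by simp)]
  refine h1.trans ?_
  have h2 := ENNReal.toReal_mono
    (ENNReal.mul_ne_top (by simp) (ENNReal.prod_ne_top (by simp)))
    (tsum_enorm_mul_monom_le ε hF u)
  rw [ENNReal.tsum_toReal_eq, ENNReal.toReal_mul, ENNReal.toReal_prod,
    ENNReal.toReal_ofReal hB] at h2
  · simpa using h2
  · exact fun κ => enorm_ne_top

/-- Evaluation of a coordinate as a continuous linear map. -/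
def EllOne.coordCLM (d : ℕ) (m : FreqLattice d) : EllOne d →L[ℝ] ℂ :=
  lp.evalCLM ℝ (fun _ : FreqLattice d => ℂ) 1 m

@[simp] theorem EllOne.coordCLM_apply {d : ℕ} (m : FreqLattice d) (u : EllOne d) :
    EllOne.coordCLM d m u = u m := rfl

theorem hasSum_arrVec_apply (ε : ι → Bool) {F : (ι → FreqLattice d) → ℂ} {B : ℝ}
    (hF : ∀ κ, ‖F κ‖ ≤ B) (u : ι → EllOne d) (m : FreqLattice d) :
    HasSum (fun κ => if momentum ε κ = m then F κ * monom ε (fun i => u i) κ else 0)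
      (arrVec ε F (fun i => u i) m) := by
  have h := (EllOne.coordCLM d m).hasSum (summable_arrVec ε hF u).hasSum
  suffices e : ∀ κ, EllOne.coordCLM d m (lp.single 1 (momentum ε κ)
      (F κ * monom ε (fun i => u i) κ)) =
        if momentum ε κ = m then F κ * monom ε (fun i => u i) κ else 0 by
    simp_rw [e] at h
    exact h
  intro κ
  simp only [EllOne.coordCLM_apply, lp.single_apply]
  by_cases hκ : momentum ε κ = m
  · subst hκ; simp
  · rw [if_neg hκ, Pi.single_eq_of_ne (Ne.symm hκ)]

theorem enorm_arrVec_apply_le (ε : ι → Bool) {F : (ι → FreqLattice d) → ℂ} {B : ℝ}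
    (hF : ∀ κ, ‖F κ‖ ≤ B) (u : ι → EllOne d) (m : FreqLattice d) :
    ‖arrVec ε F (fun i => u i) m‖ₑ ≤
      ENNReal.ofReal B * signedConv ε (fun κ => ∏ i, ‖u i (κ i)‖ₑ) m := by
  rw [← (hasSum_arrVec_apply ε hF u m).tsum_eq]
  refine enorm_tsum_le_tsum_enorm.trans ?_
  rw [signedConv, ← ENNReal.tsum_mul_left]
  refine ENNReal.tsum_le_tsum fun κ => ?_
  by_cases hκ : momentum ε κ = m
  · simp only [hκ, if_true, enorm_mul, enorm_monom]
    gcongr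
    rw [← ofReal_norm]
    exact ENNReal.ofReal_le_ofReal (hF κ)
  · simp [hκ]

/-- The multilinear map on `ℓ¹` given by a bounded coefficient array. -/
def arrMap (ε : ι → Bool) {F : (ι → FreqLattice d) → ℂ} {B : ℝ} (hB : 0 ≤ B)
    (hF : ∀ κ, ‖F κ‖ ≤ B) : ContinuousMultilinearMap ℝ (fun _ : ι => EllOne d) (EllOne d) :=
  MultilinearMap.mkContinuous
    { toFun := fun u => arrVec ε F fun i => u i
      map_update_add' := by
        intro _ u i x y
        have h := (summable_arrVec ε hF (Function.update u i x)).tsum_add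
          (summable_arrVec ε hF (Function.update u i y))
        refine Eq.trans (tsum_congr fun κ => ?_) h
        rw [monom_update, monom_update, monom_update, ← lp.single_add]
        congr 1
        rw [lp.coeFn_add, Pi.add_apply, conjIf_add]
        ring
      map_update_smul' := by
        intro _ u i c x
        have h := (summable_arrVec ε hF (Function.update u i x)).tsum_const_smul c
        refine Eq.trans (tsum_congr fun κ => ?_) h
        rw [monom_update, monom_update, ← lp.single_smul]
        congr 1
        rw [lp.coeFn_smul, Pi.smul_apply, Complex.real_smul, conjIf_real_mul, Complex.real_smul]
        ring }
    B fun u => norm_arrVec_le ε hB hF u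

theorem norm_arrMap_le (ε : ι → Bool) {F : (ι → FreqLattice d) → ℂ} {B : ℝ} (hB : 0 ≤ B)
    (hF : ∀ κ, ‖F κ‖ ≤ B) : ‖arrMap ε hB hF‖ ≤ B :=
  MultilinearMap.mkContinuous_norm_le _ hB _

end Arrays

/-! ### Weighted spaces -/

/-- The space of pairs `(u, w u)` in `ℓ¹ × ℓ²`. -/
def WSpace {d : ℕ} (w : FreqLattice d → ℝ) : Submodule ℝ (EllOne d × EllTwo d) where
  carrier := {x | ∀ k, x.2 k = ((w k : ℝ) : ℂ) * x.1 k}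
  zero_mem' := by intro k; simp
  add_mem' := by
    intro x y hx hy k
    simp only [Prod.snd_add, Prod.fst_add, lp.coeFn_add, Pi.add_apply]
    rw [hx k, hy k]
    ring
  smul_mem' := by
    intro c x hx k
    simp only [Prod.smul_snd, Prod.smul_fst, lp.coeFn_smul, Pi.smul_apply, Complex.real_smul]
    rw [hx k]
    ring

namespace WSpace

variable {d : ℕ} {w : FreqLattice d → ℝ}

theorem snd_apply (x : WSpace w) (k : FreqLattice d) : x.1.2 k = ((w k : ℝ) : ℂ) * x.1.1 k :=
  x.2 k

theorem ext_fst {x y : WSpace w} (h : x.1.1 = y.1.1) : x = y := by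
  refine Subtype.ext (Prod.ext h (lp.ext (funext fun k => ?_)))
  rw [snd_apply, snd_apply, h]

/-- The inclusion in `ℓ¹`. -/
def fstCLM (w : FreqLattice d → ℝ) : WSpace w →L[ℝ] EllOne d :=
  (ContinuousLinearMap.fst ℝ (EllOne d) (EllTwo d)).comp (WSpace w).subtypeL

theorem norm_eq (x : WSpace w) : ‖x‖ = max ‖x.1.1‖ ‖x.1.2‖ := rfl

theorem norm_fst_le (x : WSpace w) : ‖x.1.1‖ ≤ ‖x‖ := le_max_left _ _

theorem norm_snd_le (x : WSpace w) : ‖x.1.2‖ ≤ ‖x‖ := le_max_right _ _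

theorem isClosed : IsClosed (WSpace w : Set (EllOne d × EllTwo d)) := by
  have : (WSpace w : Set (EllOne d × EllTwo d)) =
      ⋂ k, {x | lp.evalCLM ℝ (fun _ : FreqLattice d => ℂ) 2 k x.2 =
        ((w k : ℝ) : ℂ) * lp.evalCLM ℝ (fun _ : FreqLattice d => ℂ) 1 k x.1} := by
    ext x
    simp [WSpace, Set.mem_iInter]
    rfl
  rw [this]
  exact isClosed_iInter fun k => isClosed_eq (by fun_prop) (by fun_prop)

instance : CompleteSpace (WSpace w) := isClosed.completeSpace_coe

section

variable {ι : Type*} [Fintype ι] [DecidableEq ι]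

/-- Young's inequality, with every factor bounded by the norm of the weighted space. The weight
enters the constant only through `c`, so rescaling the weight is free. -/
theorem tsum_weight_arrVec_sq_le (ε : ι → Bool) {F : (ι → FreqLattice d) → ℂ} {B : ℝ}
    (hB : 0 ≤ B) (hF : ∀ κ, ‖F κ‖ ≤ B) {c : ℝ} (hc : 0 ≤ c) (hw0 : ∀ k, 0 ≤ w k)
    (hw : ∀ κ : ι → FreqLattice d, w (momentum ε κ) ≤ c * ∑ j, w (κ j)) (u : ι → WSpace w) :
    ∑' m, ‖((w m : ℝ) : ℂ) * arrVec ε F (fun i => (u i).1.1) m‖ₑ ^ 2 ≤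
      (ENNReal.ofReal (B * (c * Fintype.card ι) * ∏ i, ‖u i‖)) ^ 2 := by
  have hwe : ∀ k, ‖((w k : ℝ) : ℂ)‖ₑ = ENNReal.ofReal (w k) := by
    intro k
    rw [← ofReal_norm, Complex.norm_real, Real.norm_of_nonneg (hw0 k)]
  have hY := tsum_weight_mul_signedConv_sq_le ε (fun k => ENNReal.ofReal (w k))
    (ENNReal.ofReal c) (fun κ => by
      rw [← ENNReal.ofReal_sum_of_nonneg (fun j _ => hw0 _), ← ENNReal.ofReal_mul hc]
      exact ENNReal.ofReal_le_ofReal (hw κ)) (fun i k => ‖(u i).1.1 k‖ₑ)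
  have hle : ∀ i, (∑' k, ‖(u i).1.1 k‖ₑ) ≤ ‖u i‖ₑ := by
    intro i
    rw [← EllOne.enorm_eq, ← ofReal_norm, ← ofReal_norm]
    exact ENNReal.ofReal_le_ofReal (norm_fst_le _)
  have hle2 : ∀ i, (∑' k, (ENNReal.ofReal (w k) * ‖(u i).1.1 k‖ₑ) ^ 2) ≤ ‖u i‖ₑ ^ 2 := by
    intro i
    have : ∀ k, ENNReal.ofReal (w k) * ‖(u i).1.1 k‖ₑ = ‖(u i).1.2 k‖ₑ := by
      intro k
      rw [snd_apply, enorm_mul, hwe]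
    simp_rw [this]
    rw [← EllTwo.enorm_sq_eq, ← ofReal_norm, ← ofReal_norm]
    gcongr
    exact norm_snd_le _
  calc ∑' m, ‖((w m : ℝ) : ℂ) * arrVec ε F (fun i => (u i).1.1) m‖ₑ ^ 2
      ≤ ∑' m, ENNReal.ofReal B ^ 2 * (ENNReal.ofReal (w m) *
          signedConv ε (fun κ => ∏ i, ‖(u i).1.1 (κ i)‖ₑ) m) ^ 2 := by
        refine ENNReal.tsum_le_tsum fun m => ?_
        rw [enorm_mul, hwe, ← mul_pow]
        refine pow_le_pow_left₀ zero_le ?_ 2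
        refine (mul_le_mul_right (enorm_arrVec_apply_le ε hF (fun i => (u i).1.1) m) _).trans
          (le_of_eq ?_)
        ring
    _ ≤ ENNReal.ofReal B ^ 2 * (ENNReal.ofReal c ^ 2 * Fintype.card ι *
          ∑ j, ‖u j‖ₑ ^ 2 * ∏ i : {i // i ≠ j}, ‖u i‖ₑ ^ 2) := by
        rw [ENNReal.tsum_mul_left]
        gcongr
        refine hY.trans ?_
        gcongr with j _ i _
        · exact hle2 j
        · exact hle i
    _ = _ := by
        have h1 : ∀ j, ‖u j‖ₑ ^ 2 * ∏ i : {i // i ≠ j}, ‖u i‖ₑ ^ 2 = (∏ i, ‖u i‖ₑ) ^ 2 := by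
          intro j
          rw [Finset.prod_pow, ← mul_pow, Fintype.prod_eq_mul_prod_subtype_ne _ j]
        simp_rw [h1]
        rw [ENNReal.ofReal_mul (by positivity), ENNReal.ofReal_mul hB, ENNReal.ofReal_mul hc,
          ENNReal.ofReal_prod_of_nonneg (fun i _ => norm_nonneg _)]
        simp only [Finset.sum_const, Finset.card_univ, nsmul_eq_mul, ENNReal.ofReal_natCast,
          ofReal_norm]
        ring

/-- The vector of a weighted space given by a bounded coefficient array. -/
def arrVecW (ε : ι → Bool) {F : (ι → FreqLattice d) → ℂ} {B : ℝ}
    (hB : 0 ≤ B) (hF : ∀ κ, ‖F κ‖ ≤ B) {c : ℝ} (hc : 0 ≤ c) (hw0 : ∀ k, 0 ≤ w k)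
    (hw : ∀ κ : ι → FreqLattice d, w (momentum ε κ) ≤ c * ∑ j, w (κ j)) (u : ι → WSpace w) :
    WSpace w :=
  ⟨(arrVec ε F (fun i => (u i).1.1),
    ⟨fun m => ((w m : ℝ) : ℂ) * arrVec ε F (fun i => (u i).1.1) m,
      memℓp_two_of_tsum_enorm (ne_top_of_le_ne_top (by simp)
        (tsum_weight_arrVec_sq_le ε hB hF hc hw0 hw u))⟩), fun _ => rfl⟩

theorem norm_arrVecW_le (ε : ι → Bool) {F : (ι → FreqLattice d) → ℂ} {B : ℝ}
    (hB : 0 ≤ B) (hF : ∀ κ, ‖F κ‖ ≤ B) {c : ℝ} (hc : 0 ≤ c) (hw0 : ∀ k, 0 ≤ w k)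
    (hw : ∀ κ : ι → FreqLattice d, w (momentum ε κ) ≤ c * ∑ j, w (κ j)) (u : ι → WSpace w) :
    ‖arrVecW ε hB hF hc hw0 hw u‖ ≤ B * max 1 (c * Fintype.card ι) * ∏ i, ‖u i‖ := by
  rw [norm_eq]
  refine max_le ?_ ?_
  · refine (norm_arrVec_le ε hB hF _).trans ?_
    calc B * ∏ i, ‖(u i).1.1‖ ≤ B * ∏ i, ‖u i‖ := by
          gcongr with i; exact norm_fst_le _
      _ ≤ B * max 1 (c * Fintype.card ι) * ∏ i, ‖u i‖ := by
          gcongr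
          exact le_mul_of_one_le_right hB (le_max_left _ _)
  · have h := tsum_weight_arrVec_sq_le ε hB hF hc hw0 hw u
    have h2 : ‖(arrVecW ε hB hF hc hw0 hw u).1.2‖ₑ ^ 2 ≤
        (ENNReal.ofReal (B * (c * Fintype.card ι) * ∏ i, ‖u i‖)) ^ 2 := by
      rw [EllTwo.enorm_sq_eq]
      exact h
    have h3 := (ENNReal.pow_le_pow_left_iff two_ne_zero).1 h2
    rw [← ofReal_norm, ENNReal.ofReal_le_ofReal_iff (by positivity)] at h3
    refine h3.trans ?_
    gcongr
    exact le_max_right _ _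

/-- The multilinear map on a weighted space given by a bounded coefficient array. -/
def arrMapW (ε : ι → Bool) {F : (ι → FreqLattice d) → ℂ} {B : ℝ}
    (hB : 0 ≤ B) (hF : ∀ κ, ‖F κ‖ ≤ B) {c : ℝ} (hc : 0 ≤ c) (hw0 : ∀ k, 0 ≤ w k)
    (hw : ∀ κ : ι → FreqLattice d, w (momentum ε κ) ≤ c * ∑ j, w (κ j)) :
    ContinuousMultilinearMap ℝ (fun _ : ι => WSpace w) (WSpace w) :=
  MultilinearMap.mkContinuous
    { toFun := fun u => arrVecW ε hB hF hc hw0 hw u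
      map_update_add' := by
        intro _ u i x y
        refine ext_fst ?_
        have e : ∀ z : WSpace w, (fun j => (Function.update u i z j).1.1) =
            Function.update (fun j => (u j).1.1) i z.1.1 := fun z =>
          funext fun j => Function.apply_update (fun _ (v : WSpace w) => v.1.1) u i z j
        have h := (arrMap ε hB hF).map_update_add (fun j => (u j).1.1) i x.1.1 y.1.1
        rw [← e, ← e, show x.1.1 + y.1.1 = (x + y).1.1 from rfl, ← e] at h
        exact h
      map_update_smul' := by
        intro _ u i a x
        refine ext_fst ?_
        have e : ∀ z : WSpace w, (fun j => (Function.update u i z j).1.1) =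
            Function.update (fun j => (u j).1.1) i z.1.1 := fun z =>
          funext fun j => Function.apply_update (fun _ (v : WSpace w) => v.1.1) u i z j
        have h := (arrMap ε hB hF).map_update_smul (fun j => (u j).1.1) i a x.1.1
        rw [← e, show a • x.1.1 = (a • x).1.1 from rfl, ← e] at h
        exact h }
    (B * max 1 (c * Fintype.card ι)) fun u => norm_arrVecW_le ε hB hF hc hw0 hw u

theorem norm_arrMapW_le (ε : ι → Bool) {F : (ι → FreqLattice d) → ℂ} {B : ℝ}
    (hB : 0 ≤ B) (hF : ∀ κ, ‖F κ‖ ≤ B) {c : ℝ} (hc : 0 ≤ c) (hw0 : ∀ k, 0 ≤ w k)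
    (hw : ∀ κ : ι → FreqLattice d, w (momentum ε κ) ≤ c * ∑ j, w (κ j)) :
    ‖arrMapW ε hB hF hc hw0 hw‖ ≤ B * max 1 (c * Fintype.card ι) :=
  MultilinearMap.mkContinuous_norm_le _ (by positivity) _

end

end WSpace
end

noncomputable section

open scoped ENNReal

/-! ### The pairing of `ℓ¹` with bounded sequences -/

section Pairing

variable {d : ℕ}

theorem summable_mul_of_bounded (x : EllOne d) {g : FreqLattice d → ℂ} {b : ℝ}
    (hg : ∀ m, ‖g m‖ ≤ b) : Summable fun m => x m * g m := by
  refine Summable.of_norm_bounded (x.summable_norm.mul_right b) fun m => ?_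
  rw [norm_mul]
  gcongr
  exact hg m

theorem tsum_mul_norm_le_of_bounded (x : EllOne d) {g : FreqLattice d → ℂ} {b : ℝ}
    (hg : ∀ m, ‖g m‖ ≤ b) : ‖∑' m, x m * g m‖ ≤ b * ‖x‖ := by
  rw [EllOne.norm_eq, mul_comm, ← tsum_mul_right]
  refine tsum_of_norm_bounded (x.summable_norm.mul_right b).hasSum fun m => ?_
  rw [norm_mul]
  gcongr
  exact hg m

/-- The pairing with a bounded sequence as a continuous linear functional on `ℓ¹`. -/
def pairCLM (g : FreqLattice d → ℂ) {b : ℝ} (hg : ∀ m, ‖g m‖ ≤ b) : EllOne d →L[ℂ] ℂ :=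
  LinearMap.mkContinuous
    { toFun := fun x => ∑' m, x m * g m
      map_add' := fun x y => by
        rw [← (summable_mul_of_bounded x hg).tsum_add (summable_mul_of_bounded y hg)]
        exact tsum_congr fun m => by rw [lp.coeFn_add, Pi.add_apply, add_mul]
      map_smul' := fun c x => by
        rw [RingHom.id_apply, smul_eq_mul, ← tsum_mul_left]
        exact tsum_congr fun m => by rw [lp.coeFn_smul, Pi.smul_apply, smul_eq_mul, mul_assoc] }
    b fun x => tsum_mul_norm_le_of_bounded x hg

theorem pairCLM_apply (g : FreqLattice d → ℂ) {b : ℝ} (hg : ∀ m, ‖g m‖ ≤ b) (x : EllOne d) :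
    pairCLM g hg x = ∑' m, x m * g m := rfl

theorem pairCLM_single (g : FreqLattice d → ℂ) {b : ℝ} (hg : ∀ m, ‖g m‖ ≤ b)
    (m : FreqLattice d) (a : ℂ) : pairCLM g hg (lp.single 1 m a) = a * g m := by
  rw [pairCLM_apply, tsum_eq_single m]
  · simp
  · intro k hk
    simp [Pi.single_eq_of_ne hk]

theorem hasSum_tsum_arrVec_mul {ι : Type*} [Fintype ι] (ε : ι → Bool)
    {F : (ι → FreqLattice d) → ℂ} {B : ℝ}
    (hF : ∀ κ, ‖F κ‖ ≤ B) (u : ι → EllOne d) (g : FreqLattice d → ℂ) {b : ℝ}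
    (hg : ∀ m, ‖g m‖ ≤ b) :
    HasSum (fun κ => F κ * monom ε (fun i => u i) κ * g (momentum ε κ))
      (∑' m, arrVec ε F (fun i => u i) m * g m) := by
  have h := (pairCLM g hg).hasSum (summable_arrVec ε hF u).hasSum
  simp_rw [pairCLM_single] at h
  exact h

theorem EllOne.norm_apply_le (x : EllOne d) (m : FreqLattice d) : ‖x m‖ ≤ ‖x‖ :=
  lp.norm_apply_le_norm (by simp) x m

theorem norm_conj_apply_le (x : EllOne d) (m : FreqLattice d) : ‖conj (x m)‖ ≤ ‖x‖ := by
  rw [RCLike.norm_conj]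
  exact x.norm_apply_le m

/-- The real pairing of two elements of `ℓ¹` is a bounded bilinear map. -/
def realPairingCLM (x : EllOne d) : EllOne d →L[ℝ] ℝ :=
  LinearMap.mkContinuous
    { toFun := fun y => realPairing x y
      map_add' := fun y z => by
        have hy := summable_mul_of_bounded x (norm_conj_apply_le y)
        have hz := summable_mul_of_bounded x (norm_conj_apply_le z)
        simp only [realPairing]
        rw [← Complex.add_re, ← hy.tsum_add hz]
        congr 1
        exact tsum_congr fun m => by rw [lp.coeFn_add, Pi.add_apply, map_add, mul_add]
      map_smul' := fun c y => by
        simp only [realPairing, RingHom.id_apply, smul_eq_mul]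
        rw [← Complex.re_ofReal_mul, ← tsum_mul_left]
        congr 1
        refine tsum_congr fun m => ?_
        rw [lp.coeFn_smul, Pi.smul_apply, Complex.real_smul, map_mul, Complex.conj_ofReal]
        ring }
    ‖x‖ fun y => by
      refine (Complex.abs_re_le_norm _).trans ?_
      rw [mul_comm]
      exact tsum_mul_norm_le_of_bounded x (norm_conj_apply_le y)

@[simp] theorem realPairingCLM_apply (x y : EllOne d) : realPairingCLM x y = realPairing x y := rfl

theorem realPairing_comm (x y : FreqLattice d → ℂ) : realPairing x y = realPairing y x := by
  have h : (∑' k, y k * conj (x k)) = conj (∑' k, x k * conj (y k)) := by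
    rw [Complex.conj_tsum]
    exact tsum_congr fun k => by simp [mul_comm]
  rw [realPairing, realPairing, h, Complex.conj_re]

theorem abs_realPairing_le (x y : EllOne d) : |realPairing x y| ≤ ‖x‖ * ‖y‖ := by
  refine (Complex.abs_re_le_norm _).trans ?_
  rw [mul_comm]
  exact tsum_mul_norm_le_of_bounded x (norm_conj_apply_le y)

end Pairing

/-! ### Polynomials with bounded coefficients as multilinear forms -/

section IsLeft

variable {d : ℕ} {a b : ℕ}

theorem momentum_isLeft (κ : Fin a ⊕ Fin b → FreqLattice d) :
    momentum Sum.isLeft κ = ∑ j, κ (Sum.inl j) - ∑ j, κ (Sum.inr j) := by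
  simp [momentum, Fintype.sum_sum_type, sub_eq_add_neg]

theorem monom_isLeft (u : Fin a ⊕ Fin b → FreqLattice d → ℂ) (κ : Fin a ⊕ Fin b → FreqLattice d) :
    monom Sum.isLeft u κ = (∏ j, u (Sum.inl j) (κ (Sum.inl j))) *
      ∏ j, conj (u (Sum.inr j) (κ (Sum.inr j))) := by
  simp [monom, Fintype.prod_sum_type, conjIf]

end IsLeft

namespace HomPoly

variable {d q : ℕ}

theorem bddAbove_coeff (P : HomPoly d q) :
    BddAbove (Set.range fun x : (Fin q → FreqLattice d) × (Fin q → FreqLattice d) =>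
      ‖P.coeff x.1 x.2‖) := by
  obtain ⟨B, hB⟩ := P.bounded
  exact ⟨B, by rintro _ ⟨x, rfl⟩; exact hB _ _⟩

theorem norm_coeff_le (P : HomPoly d q) (k l : Fin q → FreqLattice d) :
    ‖P.coeff k l‖ ≤ P.supNorm :=
  le_ciSup P.bddAbove_coeff (k, l)

theorem supNorm_nonneg (P : HomPoly d q) : 0 ≤ P.supNorm :=
  (norm_nonneg _).trans (P.norm_coeff_le 0 0)

theorem supNorm_le (P : HomPoly d q) {B : ℝ} (h : ∀ k l, ‖P.coeff k l‖ ≤ B) : P.supNorm ≤ B :=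
  ciSup_le fun x => h x.1 x.2

/-- The coefficients, indexed by the joint family of modes. -/
def arr (P : HomPoly d q) (κ : Fin q ⊕ Fin q → FreqLattice d) : ℂ :=
  P.coeff (fun j => κ (Sum.inl j)) (fun j => κ (Sum.inr j))

theorem norm_arr_le (P : HomPoly d q) (κ : Fin q ⊕ Fin q → FreqLattice d) :
    ‖P.arr κ‖ ≤ P.supNorm := P.norm_coeff_le _ _

theorem arr_eq_zero (P : HomPoly d q) {κ : Fin q ⊕ Fin q → FreqLattice d}
    (h : momentum Sum.isLeft κ ≠ 0) : P.arr κ = 0 := by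
  by_contra h0
  refine h ?_
  rw [momentum_isLeft, sub_eq_zero]
  exact P.zero_momentum _ _ h0

/-- The complex polarized form. -/
def cform (P : HomPoly d q) (u : Fin q ⊕ Fin q → FreqLattice d → ℂ) : ℂ :=
  ∑' κ, P.arr κ * monom Sum.isLeft u κ

/-- The real polarized form. -/
def form (P : HomPoly d q) :
    ContinuousMultilinearMap ℝ (fun _ : Fin q ⊕ Fin q => EllOne d) ℝ :=
  (Complex.reCLM.comp (EllOne.coordCLM d 0)).compContinuousMultilinearMap
    (arrMap Sum.isLeft P.supNorm_nonneg P.norm_arr_le)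

theorem form_apply (P : HomPoly d q) (u : Fin q ⊕ Fin q → EllOne d) :
    P.form u = (P.cform fun i => u i).re := by
  have h := (hasSum_arrVec_apply Sum.isLeft P.norm_arr_le u 0).tsum_eq
  change (arrVec Sum.isLeft P.arr (fun i => u i) 0).re = _
  rw [← h, cform]
  congr 1
  refine tsum_congr fun κ => ?_
  by_cases hκ : momentum Sum.isLeft κ = 0
  · rw [if_pos hκ]
  · rw [if_neg hκ, P.arr_eq_zero hκ, zero_mul]

theorem norm_form_le (P : HomPoly d q) (u : Fin q ⊕ Fin q → EllOne d) :
    ‖P.form u‖ ≤ P.supNorm * ∏ i, ‖u i‖ := by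
  refine (Complex.abs_re_le_norm _).trans ?_
  exact (EllOne.norm_apply_le _ _).trans (norm_arrVec_le Sum.isLeft P.supNorm_nonneg P.norm_arr_le u)

theorem eval_eq_cform (P : HomPoly d q) (u : FreqLattice d → ℂ) :
    P.eval u = (P.cform fun _ => u).re := by
  unfold eval cform
  congr 1
  rw [← (Equiv.sumArrowEquivProdArrow (Fin q) (Fin q) (FreqLattice d)).tsum_eq]
  refine tsum_congr fun κ => ?_
  rw [monom_isLeft, ← mul_assoc]
  rfl

theorem eval_eq_form (P : HomPoly d q) (u : EllOne d) : P.eval u = P.form fun _ => u := by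
  rw [form_apply, eval_eq_cform]

theorem abs_eval_le (P : HomPoly d q) (u : EllOne d) :
    |P.eval u| ≤ P.supNorm * ‖u‖ ^ (2 * q) := by
  rw [eval_eq_form]
  refine (P.norm_form_le _).trans (le_of_eq ?_)
  simp [two_mul]

/-- Reality of the coefficients: exchanging the two groups of variables conjugates every term. This
makes the real part treat both groups alike. -/
theorem cform_comp_swap (P : HomPoly d q) (u : Fin q ⊕ Fin q → FreqLattice d → ℂ) :
    P.cform (fun i => u i.swap) = conj (P.cform u) := by
  unfold cform
  rw [Complex.conj_tsum, ← ((Equiv.sumComm (Fin q) (Fin q)).arrowCongr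
    (Equiv.refl (FreqLattice d))).tsum_eq]
  refine tsum_congr fun κ => ?_
  rw [monom_isLeft, monom_isLeft, map_mul, arr, arr, P.reality]
  simp only [map_mul, map_prod, Complex.conj_conj]
  rw [mul_comm (∏ j, _)]
  rfl

theorem cform_comp_perm (P : HomPoly d q) (φ σ : Equiv.Perm (Fin q))
    (u : Fin q ⊕ Fin q → FreqLattice d → ℂ) :
    P.cform (fun i => u (Sum.map φ σ i)) = P.cform u := by
  unfold cform
  refine (Equiv.tsum_eq ((Equiv.sumCongr φ σ).symm.arrowCongr (Equiv.refl (FreqLattice d)))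
    _).symm.trans (tsum_congr fun κ => ?_)
  rw [monom_isLeft, monom_isLeft]
  refine congrArg₂ (· * ·) ?_ (congrArg₂ (· * ·) ?_ ?_)
  · exact P.symmetry φ σ (fun j => κ (Sum.inl j)) (fun j => κ (Sum.inr j))
  · exact Equiv.prod_comp φ fun j => u (Sum.inl j) (κ (Sum.inl j))
  · exact Equiv.prod_comp σ fun j => conj (u (Sum.inr j) (κ (Sum.inr j)))

end HomPoly

/-! ### Gradients -/

/-- The modes of the monomials of a vector field of degree `2 n + 1`. -/
abbrev FieldIdx (n : ℕ) : Type := Fin (n + 1) ⊕ Fin n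

namespace HomPoly

variable {d n : ℕ}

/-- The coefficients of the gradient. -/
def gradArr (P : HomPoly d (n + 1)) (κ : FieldIdx n → FreqLattice d) : ℂ :=
  2 * (n + 1) * P.coeff (fun j => κ (Sum.inl j))
    (Fin.cons (momentum Sum.isLeft κ) fun j => κ (Sum.inr j))

theorem norm_gradArr_le (P : HomPoly d (n + 1)) (κ : FieldIdx n → FreqLattice d) :
    ‖P.gradArr κ‖ ≤ 2 * (n + 1) * P.supNorm := by
  have h : ‖((n : ℂ) + 1)‖ = (n : ℝ) + 1 := by
    rw [← Nat.cast_add_one, Complex.norm_natCast, Nat.cast_add_one]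
  rw [gradArr, norm_mul, norm_mul, h, Complex.norm_two]
  gcongr
  exact P.norm_coeff_le _ _

theorem gradBound_nonneg (P : HomPoly d (n + 1)) : 0 ≤ 2 * ((n : ℝ) + 1) * P.supNorm :=
  mul_nonneg (by positivity) P.supNorm_nonneg

/-- The gradient, as a multilinear map. -/
def gradMap (P : HomPoly d (n + 1)) :
    ContinuousMultilinearMap ℝ (fun _ : FieldIdx n => EllOne d) (EllOne d) :=
  arrMap Sum.isLeft P.gradBound_nonneg P.norm_gradArr_le

/-- The gradient of the function defined by a polynomial. -/
def grad (P : HomPoly d (n + 1)) (u : EllOne d) : EllOne d := P.gradMap fun _ => u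

theorem grad_eq (P : HomPoly d (n + 1)) (u : EllOne d) :
    P.grad u = arrVec Sum.isLeft P.gradArr fun _ => u := rfl

theorem norm_grad_le (P : HomPoly d (n + 1)) (u : EllOne d) :
    ‖P.grad u‖ ≤ 2 * (n + 1) * P.supNorm * ‖u‖ ^ (2 * n + 1) := by
  refine (norm_arrVec_le Sum.isLeft P.gradBound_nonneg P.norm_gradArr_le _).trans (le_of_eq ?_)
  simp only [Finset.prod_const, Finset.card_univ, Fintype.card_sum, Fintype.card_fin]
  congr 2
  ring

/-- The extension of a family of modes by its momentum. -/
def consMomentum (κ : FieldIdx n → FreqLattice d) : Fin (n + 1) ⊕ Fin (n + 1) → FreqLattice d :=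
  Sum.elim (fun j => κ (Sum.inl j)) (Fin.cons (momentum Sum.isLeft κ) fun j => κ (Sum.inr j))

/-- Zero total momentum determines the mode at `Sum.inr 0` from the others, so `consMomentum`
parametrizes exactly the families that may carry a nonzero coefficient. -/
theorem consMomentum_injective :
    Function.Injective (consMomentum : (FieldIdx n → FreqLattice d) → _) := by
  intro κ κ' h
  funext i
  rcases i with i | i
  · simpa [consMomentum] using congrFun h (Sum.inl i)
  · simpa [consMomentum] using congrFun h (Sum.inr i.succ)

theorem mem_range_consMomentum {κ : Fin (n + 1) ⊕ Fin (n + 1) → FreqLattice d}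
    (h0 : momentum Sum.isLeft κ = 0) : κ ∈ Set.range (consMomentum (d := d) (n := n)) := by
  refine ⟨Sum.elim (fun j => κ (Sum.inl j)) fun j => κ (Sum.inr j.succ), ?_⟩
  have h1 : momentum Sum.isLeft (Sum.elim (fun j => κ (Sum.inl j))
      fun j : Fin n => κ (Sum.inr j.succ)) = κ (Sum.inr 0) := by
    rw [momentum_isLeft, Fin.sum_univ_succ (fun j => κ (Sum.inr j))] at h0
    rw [momentum_isLeft]
    simp only [Sum.elim_inl, Sum.elim_inr]
    rw [← sub_eq_zero, ← h0]
    abel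
  funext i
  rcases i with i | i
  · simp [consMomentum]
  · refine Fin.cases ?_ (fun j => ?_) i
    · simpa [consMomentum] using h1
    · simp [consMomentum]

theorem two_mul_arr_consMomentum (P : HomPoly d (n + 1)) (κ : FieldIdx n → FreqLattice d) :
    2 * ((n : ℂ) + 1) * P.arr (consMomentum κ) = P.gradArr κ := rfl

/-- The variation is placed in the conjugated slot `Sum.inr 0`. Solving for the mode in that slot
turns the sum into a pairing of `conj v` with the coordinates of the gradient, indexed by the
momentum of the remaining modes. -/
theorem cform_update_zero (P : HomPoly d (n + 1)) (u v : EllOne d) :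
    2 * ((n : ℂ) + 1) *
      P.cform (fun i => (Function.update (fun _ => u) (Sum.inr 0) v i : EllOne d)) =
      ∑' m, P.grad u m * conj (v m) := by
  have h := (hasSum_tsum_arrVec_mul Sum.isLeft P.norm_gradArr_le (fun _ => u) (fun m => conj (v m))
    (norm_conj_apply_le v)).tsum_eq
  rw [grad_eq, ← h, cform, ← tsum_mul_left]
  rw [← consMomentum_injective.tsum_eq]
  · refine tsum_congr fun κ => ?_
    have h2 : ∏ j, conj ((Function.update (fun _ => u) (Sum.inr 0) v
        (Sum.inr j : Fin (n + 1) ⊕ Fin (n + 1)) : EllOne d) (consMomentum κ (Sum.inr j))) =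
        conj (v (momentum Sum.isLeft κ)) * ∏ j, conj (u (κ (Sum.inr j))) := by
      rw [Fin.prod_univ_succ]
      simp [consMomentum]
    rw [← two_mul_arr_consMomentum, monom_isLeft, monom_isLeft, h2]
    simp [consMomentum]
    ring
  · intro κ hκ
    refine mem_range_consMomentum ?_
    by_contra h0
    exact hκ (by simp [P.arr_eq_zero h0])

/-- Permutation symmetry moves the varied slot within its group, and reality moves it across the
groups up to a conjugation that the real part ignores. All the slots thus contribute equally to the
derivative, which explains the factor in `gradArr`. -/
theorem form_update (P : HomPoly d (n + 1)) (u v : EllOne d) (i : Fin (n + 1) ⊕ Fin (n + 1)) :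
    2 * ((n : ℝ) + 1) * P.form (Function.update (fun _ => u) i v) = realPairing (P.grad u) v := by
  have h0 : 2 * ((n : ℝ) + 1) * P.form (Function.update (fun _ => u) (Sum.inr 0) v) =
      realPairing (P.grad u) v := by
    rw [form_apply, realPairing, ← cform_update_zero, ← Complex.re_ofReal_mul]
    push_cast
    rfl
  rw [← h0]
  congr 1
  have hr : ∀ j, P.form (Function.update (fun _ => u) (Sum.inr j) v) =
      P.form (Function.update (fun _ => u) (Sum.inr 0) v) := by
    intro j
    rw [form_apply, form_apply, ← P.cform_comp_perm 1 (Equiv.swap 0 j)]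
    congr 2
    funext i
    rcases i with i | i
    · simp
    · by_cases hi : i = 0
      · subst hi; simp
      · have : Equiv.swap 0 j i ≠ j := fun h => hi (by simpa using congrArg (Equiv.swap 0 j) h)
        simp [hi, this]
  rcases i with j | j
  · rw [← hr j, form_apply, form_apply, ← Complex.conj_re, ← P.cform_comp_swap]
    congr 2
    funext i
    rcases i with i | i
    · simp
    · by_cases hi : i = j
      · subst hi; simp
      · simp [hi]
  · exact hr j

theorem hasFDerivAt_eval (P : HomPoly d (n + 1)) (u : EllOne d) :
    HasFDerivAt (fun u : EllOne d => P.eval u) (realPairingCLM (P.grad u)) u := by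
  have h := (P.form.hasFDerivAt (fun _ => u)).comp u
    (ContinuousLinearMap.pi fun _ : Fin (n + 1) ⊕ Fin (n + 1) =>
      ContinuousLinearMap.id ℝ (EllOne d)).hasFDerivAt
  have e : (fun u : EllOne d => P.eval u) = (fun v => P.form v) ∘
    (ContinuousLinearMap.pi fun _ : Fin (n + 1) ⊕ Fin (n + 1) =>
      ContinuousLinearMap.id ℝ (EllOne d)) := by
    funext u
    exact P.eval_eq_form u
  rw [e]
  refine h.congr_fderiv (ContinuousLinearMap.ext fun v => ?_)
  rw [ContinuousLinearMap.comp_apply, ContinuousMultilinearMap.linearDeriv_apply,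
    realPairingCLM_apply]
  simp only [ContinuousLinearMap.pi_apply, ContinuousLinearMap.id_apply]
  have hn : (2 * ((n : ℝ) + 1)) ≠ 0 := by positivity
  refine mul_left_cancel₀ hn ?_
  rw [Finset.mul_sum]
  simp_rw [P.form_update]
  simp only [Finset.sum_const, Finset.card_univ, Fintype.card_sum, Fintype.card_fin, nsmul_eq_mul]
  push_cast
  ring

end HomPoly
end

noncomputable section

open scoped ENNReal

/-! ### Symmetrization of coefficient arrays -/

section Raw

variable {d q : ℕ}

/-- The complex value of the polynomial with the coefficients `A`. -/
def rawEval (A : (Fin q → FreqLattice d) → (Fin q → FreqLattice d) → ℂ) (u : FreqLattice d → ℂ) :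
    ℂ :=
  ∑' x : (Fin q → FreqLattice d) × (Fin q → FreqLattice d),
    A x.1 x.2 * (∏ j, u (x.1 j)) * ∏ j, conj (u (x.2 j))

theorem HomPoly.eval_eq_rawEval (P : HomPoly d q) (u : FreqLattice d → ℂ) :
    P.eval u = (rawEval P.coeff u).re := rfl

theorem summable_raw {A : (Fin q → FreqLattice d) → (Fin q → FreqLattice d) → ℂ} {B : ℝ}
    (hA : ∀ k l, ‖A k l‖ ≤ B) (u : EllOne d) :
    Summable fun x : (Fin q → FreqLattice d) × (Fin q → FreqLattice d) =>
      A x.1 x.2 * (∏ j, u (x.1 j)) * ∏ j, conj (u (x.2 j)) := by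
  rw [← (Equiv.sumArrowEquivProdArrow (Fin q) (Fin q) (FreqLattice d)).summable_iff]
  have h := summable_mul_monom Sum.isLeft
    (F := fun κ : Fin q ⊕ Fin q → FreqLattice d => A (fun j => κ (Sum.inl j)) fun j => κ (Sum.inr j))
    (fun κ => hA _ _) fun _ => u
  refine h.congr fun κ => ?_
  rw [monom_isLeft, ← mul_assoc]
  rfl

theorem rawEval_add {A A' : (Fin q → FreqLattice d) → (Fin q → FreqLattice d) → ℂ} {B B' : ℝ}
    (hA : ∀ k l, ‖A k l‖ ≤ B) (hA' : ∀ k l, ‖A' k l‖ ≤ B') (u : EllOne d) :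
    rawEval (fun k l => A k l + A' k l) u = rawEval A u + rawEval A' u := by
  unfold rawEval
  rw [← (summable_raw hA u).tsum_add (summable_raw hA' u)]
  exact tsum_congr fun x => by ring

theorem rawEval_const_mul (c : ℂ) (A : (Fin q → FreqLattice d) → (Fin q → FreqLattice d) → ℂ)
    (u : FreqLattice d → ℂ) :
    rawEval (fun k l => c * A k l) u = c * rawEval A u := by
  unfold rawEval
  rw [← tsum_mul_left]
  exact tsum_congr fun x => by ring

theorem rawEval_sum {ι : Type*} (s : Finset ι)
    {A : ι → (Fin q → FreqLattice d) → (Fin q → FreqLattice d) → ℂ} {B : ι → ℝ}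
    (hA : ∀ i k l, ‖A i k l‖ ≤ B i) (u : EllOne d) :
    rawEval (fun k l => ∑ i ∈ s, A i k l) u = ∑ i ∈ s, rawEval (A i) u := by
  unfold rawEval
  rw [← Summable.tsum_finsetSum fun i _ => summable_raw (hA i) u]
  exact tsum_congr fun x => by rw [Finset.sum_mul, Finset.sum_mul]

theorem rawEval_perm (A : (Fin q → FreqLattice d) → (Fin q → FreqLattice d) → ℂ)
    (φ σ : Equiv.Perm (Fin q)) (u : FreqLattice d → ℂ) :
    rawEval (fun k l => A (fun j => k (φ j)) fun j => l (σ j)) u = rawEval A u := by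
  unfold rawEval
  refine (Equiv.tsum_eq ((φ.arrowCongr (Equiv.refl (FreqLattice d))).prodCongr
    (σ.arrowCongr (Equiv.refl (FreqLattice d)))) _).symm.trans (tsum_congr fun x => ?_)
  refine congrArg₂ (· * ·) (congrArg₂ (· * ·) ?_ ?_) ?_
  · simp [Equiv.arrowCongr]
  · exact Equiv.prod_comp φ.symm fun j => u (x.1 j)
  · exact Equiv.prod_comp σ.symm fun j => conj (u (x.2 j))

theorem rawEval_conj (A : (Fin q → FreqLattice d) → (Fin q → FreqLattice d) → ℂ)
    (u : FreqLattice d → ℂ) :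
    rawEval (fun k l => conj (A l k)) u = conj (rawEval A u) := by
  unfold rawEval
  rw [Complex.conj_tsum, ← (Equiv.prodComm _ _).tsum_eq]
  refine tsum_congr fun x => ?_
  simp only [Equiv.prodComm_apply, Prod.fst_swap, Prod.snd_swap, map_mul, map_prod,
    Complex.conj_conj]
  ring

/-- The symmetric real part of a coefficient array. -/
def symmCoeff (A : (Fin q → FreqLattice d) → (Fin q → FreqLattice d) → ℂ)
    (k l : Fin q → FreqLattice d) : ℂ :=
  (2 * (q.factorial : ℂ) ^ 2)⁻¹ * ∑ φ : Equiv.Perm (Fin q), ∑ σ : Equiv.Perm (Fin q),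
    (A (fun j => k (φ j)) (fun j => l (σ j)) + conj (A (fun j => l (σ j)) fun j => k (φ j)))

theorem norm_symmCoeff_le {A : (Fin q → FreqLattice d) → (Fin q → FreqLattice d) → ℂ} {B : ℝ}
    (hA : ∀ k l, ‖A k l‖ ≤ B) (k l : Fin q → FreqLattice d) : ‖symmCoeff A k l‖ ≤ B := by
  have hq : (0 : ℝ) < q.factorial := by exact_mod_cast q.factorial_pos
  have h : ‖∑ φ : Equiv.Perm (Fin q), ∑ σ : Equiv.Perm (Fin q),
      (A (fun j => k (φ j)) (fun j => l (σ j)) + conj (A (fun j => l (σ j)) fun j => k (φ j)))‖ ≤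
      ∑ φ : Equiv.Perm (Fin q), ∑ σ : Equiv.Perm (Fin q), (B + B) := by
    refine norm_sum_le_of_le _ fun φ _ => norm_sum_le_of_le _ fun σ _ => ?_
    refine norm_add_le_of_le (hA _ _) ?_
    rw [RCLike.norm_conj]
    exact hA _ _
  rw [symmCoeff, norm_mul, norm_inv, norm_mul, norm_pow, Complex.norm_natCast, Complex.norm_two,
    inv_mul_le_iff₀ (by positivity)]
  refine h.trans (le_of_eq ?_)
  simp only [Finset.sum_const, Finset.card_univ, Fintype.card_perm, Fintype.card_fin, nsmul_eq_mul]
  ring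

/-- The polynomial obtained by symmetrizing an array of coefficients. -/
def HomPoly.ofRaw (A : (Fin q → FreqLattice d) → (Fin q → FreqLattice d) → ℂ)
    (hA0 : ∀ k l, A k l ≠ 0 → ∑ j, k j = ∑ j, l j) (hA : ∃ B : ℝ, ∀ k l, ‖A k l‖ ≤ B) :
    HomPoly d q where
  coeff := symmCoeff A
  reality := by
    intro k l
    simp only [symmCoeff, map_mul, map_inv₀, map_pow, map_sum, map_add, Complex.conj_conj,
      Complex.conj_natCast, Complex.conj_ofNat]
    rw [Finset.sum_comm]
    congr 1
    exact Finset.sum_congr rfl fun φ _ => Finset.sum_congr rfl fun σ _ => add_comm _ _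
  symmetry := by
    intro φ σ k l
    unfold symmCoeff
    congr 1
    exact Fintype.sum_equiv (Equiv.mulLeft φ) _ _ fun φ' =>
      Fintype.sum_equiv (Equiv.mulLeft σ) _ _ fun σ' => rfl
  zero_momentum := by
    intro k l h
    by_contra hkl
    refine h ?_
    unfold symmCoeff
    rw [Finset.sum_eq_zero fun φ _ => Finset.sum_eq_zero fun σ _ => ?_, mul_zero]
    have h1 : A (fun j => k (φ j)) (fun j => l (σ j)) = 0 := by
      by_contra h1
      have := hA0 _ _ h1
      rw [Equiv.sum_comp φ k, Equiv.sum_comp σ l] at this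
      exact hkl this
    have h2 : A (fun j => l (σ j)) (fun j => k (φ j)) = 0 := by
      by_contra h2
      have := hA0 _ _ h2
      rw [Equiv.sum_comp φ k, Equiv.sum_comp σ l] at this
      exact hkl this.symm
    rw [h1, h2, map_zero, add_zero]
  bounded := by
    obtain ⟨B, hB⟩ := hA
    exact ⟨B, norm_symmCoeff_le hB⟩

theorem HomPoly.supNorm_ofRaw_le {A : (Fin q → FreqLattice d) → (Fin q → FreqLattice d) → ℂ}
    (hA0 : ∀ k l, A k l ≠ 0 → ∑ j, k j = ∑ j, l j) {B : ℝ} (hA : ∀ k l, ‖A k l‖ ≤ B) :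
    (HomPoly.ofRaw A hA0 ⟨B, hA⟩).supNorm ≤ B :=
  HomPoly.supNorm_le _ (norm_symmCoeff_le hA)

/-- Permuting the entries of the coefficients does not change the value of the series, and the
reflected coefficients give its conjugate. Each of the (q!)² pairs of permutations contributes twice
the real part, which the normalization of `symmCoeff` cancels. -/
theorem HomPoly.eval_ofRaw {A : (Fin q → FreqLattice d) → (Fin q → FreqLattice d) → ℂ}
    (hA0 : ∀ k l, A k l ≠ 0 → ∑ j, k j = ∑ j, l j) (hA : ∃ B : ℝ, ∀ k l, ‖A k l‖ ≤ B)
    (u : EllOne d) : (HomPoly.ofRaw A hA0 hA).eval u = (rawEval A u).re := by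
  obtain ⟨B, hB⟩ := hA
  have hq : (q.factorial : ℂ) ≠ 0 := by exact_mod_cast q.factorial_ne_zero
  have hc : ∀ k l : Fin q → FreqLattice d, ‖conj (A l k)‖ ≤ B := fun k l => by
    rw [RCLike.norm_conj]; exact hB _ _
  have h1 : ∀ φ σ : Equiv.Perm (Fin q),
      rawEval (fun k l => A (fun j => k (φ j)) (fun j => l (σ j)) +
        conj (A (fun j => l (σ j)) fun j => k (φ j))) u = rawEval A u + conj (rawEval A u) := by
    intro φ σ
    rw [rawEval_add (A := fun k l => A (fun j => k (φ j)) (fun j => l (σ j)))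
      (A' := fun k l => conj (A (fun j => l (σ j)) fun j => k (φ j))) (fun k l => hB _ _)
      (fun k l => hc _ _), rawEval_perm A,
      rawEval_perm (fun k l => conj (A l k)), rawEval_conj]
  have hn : ∀ (φ σ : Equiv.Perm (Fin q)) (k l : Fin q → FreqLattice d),
      ‖A (fun j => k (φ j)) (fun j => l (σ j)) +
        conj (A (fun j => l (σ j)) fun j => k (φ j))‖ ≤ B + B := fun φ σ k l =>
    norm_add_le_of_le (hB _ _) (hc _ _)
  have h2 : rawEval (symmCoeff A) u = (2 * (q.factorial : ℂ) ^ 2)⁻¹ *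
      ∑ _x : Equiv.Perm (Fin q) × Equiv.Perm (Fin q),
        (rawEval A u + conj (rawEval A u)) := by
    rw [← Finset.sum_congr rfl fun (x : Equiv.Perm (Fin q) × Equiv.Perm (Fin q)) _ => h1 x.1 x.2,
      ← rawEval_sum (ι := Equiv.Perm (Fin q) × Equiv.Perm (Fin q)) Finset.univ
        (A := fun x k l => A (fun j => k (x.1 j)) (fun j => l (x.2 j)) +
          conj (A (fun j => l (x.2 j)) fun j => k (x.1 j))) (B := fun _ => B + B)
        (fun x k l => hn x.1 x.2 k l), ← rawEval_const_mul]
    congr 1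
    funext k l
    rw [symmCoeff, Fintype.sum_prod_type]
  rw [HomPoly.eval_eq_rawEval]
  change (rawEval (symmCoeff A) u).re = _
  rw [h2]
  simp only [Finset.sum_const, Finset.card_univ, Fintype.card_prod, Fintype.card_perm,
    Fintype.card_fin, nsmul_eq_mul, Complex.add_conj, Nat.cast_mul]
  rw [show (2 * (q.factorial : ℂ) ^ 2)⁻¹ * (q.factorial * q.factorial *
    ((2 * (rawEval A u).re : ℝ) : ℂ)) = ((rawEval A u).re : ℂ) by
      push_cast; field_simp, Complex.ofReal_re]

/-- Multiplication of the coefficients by a bounded, symmetric and skew-compatible symbol. -/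
def HomPoly.mulSymbol (P : HomPoly d q) (m : (Fin q → FreqLattice d) → (Fin q → FreqLattice d) → ℂ)
    (hr : ∀ k l, m l k = conj (m k l))
    (hs : ∀ (φ σ : Equiv.Perm (Fin q)) (k l : Fin q → FreqLattice d),
      m (fun j => k (φ j)) (fun j => l (σ j)) = m k l)
    (hb : ∃ b : ℝ, ∀ k l, ‖m k l‖ ≤ b) : HomPoly d q where
  coeff := fun k l => m k l * P.coeff k l
  reality := fun k l => by rw [hr k l, P.reality k l, map_mul]
  symmetry := fun φ σ k l => by rw [hs φ σ k l, P.symmetry φ σ k l]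
  zero_momentum := fun k l h => P.zero_momentum k l (right_ne_zero_of_mul h)
  bounded := by
    obtain ⟨b, hb⟩ := hb
    refine ⟨b * P.supNorm, fun k l => ?_⟩
    rw [norm_mul]
    exact mul_le_mul (hb k l) (P.norm_coeff_le k l) (norm_nonneg _) ((norm_nonneg _).trans (hb k l))

end Raw

/-! ### Poisson brackets -/

/-- The Hamiltonian vector field `i ∇χ`. -/
def HomPoly.field {d n : ℕ} (χ : HomPoly d (n + 1)) (u : EllOne d) : EllOne d :=
  Complex.I • χ.grad u

section Bracket

variable {d n₁ n₂ n : ℕ}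

/-- The positions of the unconjugated variables in a bracket. -/
def bracketIdx₁ (h : n₁ + n₂ = n) : Fin (n₁ + 1) ⊕ Fin n₂ ≃ Fin (n + 1) :=
  finSumFinEquiv.trans (finCongr (by omega))

/-- The positions of the conjugated variables in a bracket. -/
def bracketIdx₂ (h : n₁ + n₂ = n) : Fin n₁ ⊕ Fin (n₂ + 1) ≃ Fin (n + 1) :=
  finSumFinEquiv.trans (finCongr (by omega))

/-- The modes attached to the first factor of a bracket. -/
def bracketModes₁ (h : n₁ + n₂ = n) (K Λ : Fin (n + 1) → FreqLattice d) :
    FieldIdx n₁ → FreqLattice d :=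
  Sum.elim (fun j => K (bracketIdx₁ h (Sum.inl j))) fun j => Λ (bracketIdx₂ h (Sum.inl j))

/-- The modes attached to the second factor of a bracket. -/
def bracketModes₂ (h : n₁ + n₂ = n) (K Λ : Fin (n + 1) → FreqLattice d) :
    FieldIdx n₂ → FreqLattice d :=
  Sum.elim (fun j => Λ (bracketIdx₂ h (Sum.inr j))) fun j => K (bracketIdx₁ h (Sum.inr j))

/-- The splitting of the modes of a bracket between its factors. -/
def bracketEquiv (d : ℕ) (h : n₁ + n₂ = n) :
    (Fin (n + 1) → FreqLattice d) × (Fin (n + 1) → FreqLattice d) ≃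
      (FieldIdx n₁ → FreqLattice d) × (FieldIdx n₂ → FreqLattice d) where
  toFun x := (bracketModes₁ h x.1 x.2, bracketModes₂ h x.1 x.2)
  invFun y :=
    (fun j => Sum.elim (fun i => y.1 (Sum.inl i)) (fun i => y.2 (Sum.inr i))
      ((bracketIdx₁ h).symm j),
    fun j => Sum.elim (fun i => y.1 (Sum.inr i)) (fun i => y.2 (Sum.inl i))
      ((bracketIdx₂ h).symm j))
  left_inv x := by
    ext1 <;> funext j
    · obtain ⟨i, rfl⟩ := (bracketIdx₁ h).surjective j
      rcases i with i | i <;> simp [bracketModes₁, bracketModes₂]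
    · obtain ⟨i, rfl⟩ := (bracketIdx₂ h).surjective j
      rcases i with i | i <;> simp [bracketModes₁, bracketModes₂]
  right_inv y := by
    ext1 <;> funext i <;> rcases i with i | i <;> simp [bracketModes₁, bracketModes₂]

/-- The coefficients of the Poisson bracket of two polynomials. -/
def bracketArr (Q : HomPoly d (n₁ + 1)) (χ : HomPoly d (n₂ + 1)) (h : n₁ + n₂ = n)
    (K Λ : Fin (n + 1) → FreqLattice d) : ℂ :=
  if momentum Sum.isLeft (bracketModes₁ h K Λ) = momentum Sum.isLeft (bracketModes₂ h K Λ) then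
    Q.gradArr (bracketModes₁ h K Λ) * conj (Complex.I * χ.gradArr (bracketModes₂ h K Λ))
  else 0

theorem norm_bracketArr_le (Q : HomPoly d (n₁ + 1)) (χ : HomPoly d (n₂ + 1)) (h : n₁ + n₂ = n)
    (K Λ : Fin (n + 1) → FreqLattice d) :
    ‖bracketArr Q χ h K Λ‖ ≤ (2 * (n₁ + 1) * Q.supNorm) * (2 * (n₂ + 1) * χ.supNorm) := by
  unfold bracketArr
  split_ifs
  · rw [norm_mul, RCLike.norm_conj, norm_mul, Complex.norm_I, one_mul]
    exact mul_le_mul (Q.norm_gradArr_le _) (χ.norm_gradArr_le _) (norm_nonneg _)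
      Q.gradBound_nonneg
  · rw [norm_zero]
    exact mul_nonneg Q.gradBound_nonneg χ.gradBound_nonneg

theorem bracketArr_momentum (Q : HomPoly d (n₁ + 1)) (χ : HomPoly d (n₂ + 1)) (h : n₁ + n₂ = n)
    (K Λ : Fin (n + 1) → FreqLattice d) (h0 : bracketArr Q χ h K Λ ≠ 0) :
    ∑ j, K j = ∑ j, Λ j := by
  unfold bracketArr at h0
  split_ifs at h0 with hm
  · rw [momentum_isLeft, momentum_isLeft] at hm
    rw [← Equiv.sum_comp (bracketIdx₁ h), ← Equiv.sum_comp (bracketIdx₂ h),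
      Fintype.sum_sum_type, Fintype.sum_sum_type]
    simp only [bracketModes₁, bracketModes₂, Sum.elim_inl, Sum.elim_inr] at hm
    rw [sub_eq_sub_iff_add_eq_add] at hm
    rw [hm, add_comm]
  · exact absurd rfl h0

/-- The pairing is a double sum over two families of modes with equal momentum. Conjugating the
field exchanges the conjugated and unconjugated modes of `χ`, and `bracketEquiv` collects the n + 1
modes of each kind. -/
theorem re_rawEval_bracketArr (Q : HomPoly d (n₁ + 1)) (χ : HomPoly d (n₂ + 1)) (h : n₁ + n₂ = n)
    (u : EllOne d) :
    (rawEval (bracketArr Q χ h) u).re = realPairing (Q.grad u) (χ.field u) := by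
  have hc : ∀ m, ‖conj (χ.field u m)‖ ≤ ‖χ.field u‖ := norm_conj_apply_le _
  rw [realPairing, Q.grad_eq,
    ← (hasSum_tsum_arrVec_mul Sum.isLeft Q.norm_gradArr_le (fun _ => u) _ hc).tsum_eq]
  congr 1
  have hχ : ∀ m, conj (χ.field u m) = ∑' κ, if momentum Sum.isLeft κ = m then
      conj (Complex.I * χ.gradArr κ) * conj (monom Sum.isLeft (fun _ => u) κ) else 0 := by
    intro m
    rw [HomPoly.field, lp.coeFn_smul, Pi.smul_apply, smul_eq_mul, χ.grad_eq,
      ← (hasSum_arrVec_apply Sum.isLeft χ.norm_gradArr_le (fun _ => u) m).tsum_eq,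
      ← tsum_mul_left, Complex.conj_tsum]
    refine tsum_congr fun κ => ?_
    split_ifs
    · simp only [map_mul, mul_assoc]
    · simp
  simp_rw [hχ, ← tsum_mul_left]
  have hs1 := summable_mul_monom Sum.isLeft Q.norm_gradArr_le fun _ => u
  have hs2 := summable_mul_monom Sum.isLeft χ.norm_gradArr_le fun _ => u
  rw [← Summable.tsum_prod' (f := fun x : (FieldIdx n₁ → FreqLattice d) ×
    (FieldIdx n₂ → FreqLattice d) => Q.gradArr x.1 * monom Sum.isLeft (fun _ => u) x.1 *
      if momentum Sum.isLeft x.2 = momentum Sum.isLeft x.1 then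
        conj (Complex.I * χ.gradArr x.2) * conj (monom Sum.isLeft (fun _ => u) x.2) else 0)]
  · rw [← (bracketEquiv d h).tsum_eq]
    refine tsum_congr fun x => ?_
    simp only [bracketEquiv, Equiv.coe_fn_mk, bracketArr, monom_isLeft]
    by_cases hm : momentum Sum.isLeft (bracketModes₂ h x.1 x.2) =
        momentum Sum.isLeft (bracketModes₁ h x.1 x.2)
    · rw [if_pos hm.symm, if_pos hm]
      rw [← Equiv.prod_comp (bracketIdx₁ h), ← Equiv.prod_comp (bracketIdx₂ h),
        Fintype.prod_sum_type, Fintype.prod_sum_type]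
      simp only [bracketModes₁, bracketModes₂, Sum.elim_inl, Sum.elim_inr, map_mul, map_prod,
        Complex.conj_conj]
      ring
    · rw [if_neg (Ne.symm hm), if_neg hm]
      simp
  all_goals
    have hp : Summable fun x : (FieldIdx n₁ → FreqLattice d) × (FieldIdx n₂ → FreqLattice d) =>
        Q.gradArr x.1 * monom Sum.isLeft (fun _ => u) x.1 *
        if momentum Sum.isLeft x.2 = momentum Sum.isLeft x.1 then
          conj (Complex.I * χ.gradArr x.2) * conj (monom Sum.isLeft (fun _ => u) x.2) else 0 := by
      refine Summable.of_norm_bounded (hs1.norm.mul_of_nonneg hs2.norm (fun _ => norm_nonneg _)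
        fun _ => norm_nonneg _) fun x => ?_
      rw [norm_mul]
      gcongr
      split_ifs
      · simp
      · simp
        positivity
  · exact hp
  · exact fun κ => hp.comp_injective (Prod.mk_right_injective κ)

end Bracket
end

noncomputable section

open scoped ENNReal

/-! ### The weights `δ ⟨k⟩^s` -/

section Weights

variable {d : ℕ}

theorem one_le_bracket (k : FreqLattice d) : 1 ≤ bracket k := by
  rw [bracket, Real.one_le_sqrt]
  have : 0 ≤ ∑ i, (k i : ℝ) ^ 2 := Finset.sum_nonneg fun i _ => sq_nonneg _
  linarith

theorem bracket_pos (k : FreqLattice d) : 0 < bracket k := one_pos.trans_le (one_le_bracket k)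

theorem bracket_neg (k : FreqLattice d) : bracket (-k) = bracket k := by
  simp [bracket]

theorem bracket_add_le (k l : FreqLattice d) : bracket (k + l) ≤ bracket k + bracket l := by
  set a : ℝ := ∑ i, (k i : ℝ) ^ 2 with ha
  set b : ℝ := ∑ i, (l i : ℝ) ^ 2 with hb
  have ha0 : 0 ≤ a := Finset.sum_nonneg fun i _ => sq_nonneg _
  have hb0 : 0 ≤ b := Finset.sum_nonneg fun i _ => sq_nonneg _
  have hs : ∑ i, ((k + l) i : ℝ) ^ 2 = a + b + 2 * ∑ i, (k i : ℝ) * l i := by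
    rw [ha, hb, Finset.mul_sum, ← Finset.sum_add_distrib, ← Finset.sum_add_distrib]
    refine Finset.sum_congr rfl fun i _ => ?_
    push_cast [Pi.add_apply]
    ring
  have hc : (∑ i, (k i : ℝ) * l i) ≤ bracket k * bracket l := by
    refine le_trans (Real.le_sqrt_of_sq_le (Finset.sum_mul_sq_le_sq_mul_sq _ _ _)) ?_
    rw [bracket, bracket, ← Real.sqrt_mul (by positivity)]
    refine Real.sqrt_le_sqrt ?_
    rw [← ha, ← hb]
    gcongr <;> linarith
  have h1 : bracket k ^ 2 = 1 + a := Real.sq_sqrt (by positivity)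
  have h2 : bracket l ^ 2 = 1 + b := Real.sq_sqrt (by positivity)
  rw [bracket, hs]
  refine Real.sqrt_le_iff.2 ⟨add_nonneg (bracket_pos k).le (bracket_pos l).le, ?_⟩
  nlinarith

theorem bracket_momentum_le {ι : Type*} [Fintype ι] [Nonempty ι] (ε : ι → Bool)
    (κ : ι → FreqLattice d) : bracket (momentum ε κ) ≤ ∑ j, bracket (κ j) := by
  have h : ∀ s : Finset ι, s.Nonempty →
      bracket (∑ i ∈ s, if ε i then κ i else -κ i) ≤ ∑ j ∈ s, bracket (κ j) := by
    intro s hs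
    induction hs using Finset.Nonempty.cons_induction with
    | singleton a =>
      simp only [Finset.sum_singleton]
      split_ifs
      · exact le_rfl
      · rw [bracket_neg]
    | cons a s ha hs ih =>
      rw [Finset.sum_cons, Finset.sum_cons]
      refine (bracket_add_le _ _).trans (add_le_add (le_of_eq ?_) ih)
      split_ifs
      · rfl
      · rw [bracket_neg]
  exact h Finset.univ Finset.univ_nonempty

/-- The weight `δ ⟨k⟩^s`. -/
def sobWeight (d : ℕ) (δ s : ℝ) (k : FreqLattice d) : ℝ := δ * bracket k ^ s

theorem sobWeight_nonneg {δ : ℝ} (hδ : 0 ≤ δ) (s : ℝ) (k : FreqLattice d) :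
    0 ≤ sobWeight d δ s k :=
  mul_nonneg hδ (Real.rpow_nonneg (bracket_pos k).le s)

/-- The largest of the brackets is at least their sum divided by their number. The constant does not
depend on `δ`, which may therefore be chosen afterwards as a function of the point considered. -/
theorem sobWeight_momentum_le {δ s : ℝ} (hδ : 0 ≤ δ) (hs : 0 ≤ s) {ι : Type*} [Fintype ι]
    [Nonempty ι] (ε : ι → Bool) (κ : ι → FreqLattice d) :
    sobWeight d δ s (momentum ε κ) ≤ (Fintype.card ι : ℝ) ^ s * ∑ j, sobWeight d δ s (κ j) := by
  obtain ⟨i, -, hi⟩ := Finset.exists_max_image Finset.univ (fun j => bracket (κ j))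
    Finset.univ_nonempty
  have h1 : bracket (momentum ε κ) ≤ Fintype.card ι * bracket (κ i) := by
    refine (bracket_momentum_le ε κ).trans ?_
    refine (Finset.sum_le_sum fun j _ => hi j (Finset.mem_univ j)).trans (le_of_eq ?_)
    simp
  have h2 : bracket (momentum ε κ) ^ s ≤ (Fintype.card ι : ℝ) ^ s * bracket (κ i) ^ s := by
    rw [← Real.mul_rpow (Nat.cast_nonneg _) (bracket_pos _).le]
    exact Real.rpow_le_rpow (bracket_pos _).le h1 hs
  have h3 : sobWeight d δ s (κ i) ≤ ∑ j, sobWeight d δ s (κ j) :=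
    Finset.single_le_sum (f := fun j => sobWeight d δ s (κ j))
      (fun j _ => sobWeight_nonneg hδ s _) (Finset.mem_univ i)
  calc sobWeight d δ s (momentum ε κ)
      ≤ δ * ((Fintype.card ι : ℝ) ^ s * bracket (κ i) ^ s) := by
        unfold sobWeight; gcongr
    _ = (Fintype.card ι : ℝ) ^ s * sobWeight d δ s (κ i) := by unfold sobWeight; ring
    _ ≤ _ := by gcongr

end Weights

/-! ### The quadratic Hamiltonian -/

section Quad

variable {d : ℕ} {w : FreqLattice d → ℝ} {freq : FreqLattice d → ℝ} {A : ℝ}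

theorem norm_quad_term_le (hw0 : ∀ k, 0 ≤ w k) (hA : ∀ k, |freq k| ≤ A * w k ^ 2)
    (x y : WSpace w) (k : FreqLattice d) :
    ‖(freq k : ℂ) * x.1.1 k * conj (y.1.1 k)‖ ≤ A * (‖x.1.2 k‖ * ‖y.1.2 k‖) := by
  rw [WSpace.snd_apply, WSpace.snd_apply, norm_mul, norm_mul, norm_mul, norm_mul, RCLike.norm_conj,
    Complex.norm_real, Complex.norm_real, Real.norm_of_nonneg (hw0 k), Real.norm_eq_abs]
  calc |freq k| * ‖x.1.1 k‖ * ‖y.1.1 k‖ ≤ A * w k ^ 2 * ‖x.1.1 k‖ * ‖y.1.1 k‖ := by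
        gcongr; exact hA k
    _ = _ := by ring

theorem summable_snd_mul (x y : WSpace w) : Summable fun k => ‖x.1.2 k‖ * ‖y.1.2 k‖ := by
  refine Summable.of_nonneg_of_le (fun k => by positivity) (fun k => ?_)
    (x.1.2.summable_norm_sq.add y.1.2.summable_norm_sq)
  nlinarith [sq_nonneg (‖x.1.2 k‖ - ‖y.1.2 k‖), sq_nonneg ‖x.1.2 k‖, sq_nonneg ‖y.1.2 k‖]

theorem tsum_snd_mul_le (x y : WSpace w) :
    ∑' k, ‖x.1.2 k‖ * ‖y.1.2 k‖ ≤ ‖x.1.2‖ * ‖y.1.2‖ := by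
  have h := Real.inner_le_Lp_mul_Lq_tsum_of_nonneg (f := fun k => ‖x.1.2 k‖)
    (g := fun k => ‖y.1.2 k‖) Real.HolderConjugate.two_two (fun _ => norm_nonneg _)
    (fun _ => norm_nonneg _) (by simpa using x.1.2.summable_norm_sq)
    (by simpa using y.1.2.summable_norm_sq)
  simp only [Real.rpow_two] at h
  rw [← EllTwo.norm_sq_eq, ← EllTwo.norm_sq_eq, ← Real.sqrt_eq_rpow, ← Real.sqrt_eq_rpow,
    Real.sqrt_sq (norm_nonneg _), Real.sqrt_sq (norm_nonneg _)] at h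
  exact h

/-- The bilinear form of the quadratic Hamiltonian. -/
def quadForm (freq : FreqLattice d → ℝ) (x y : FreqLattice d → ℂ) : ℝ :=
  (∑' k, (freq k : ℂ) * x k * conj (y k)).re

theorem summable_quad (hw0 : ∀ k, 0 ≤ w k) (hA : ∀ k, |freq k| ≤ A * w k ^ 2)
    (x y : WSpace w) : Summable fun k => (freq k : ℂ) * x.1.1 k * conj (y.1.1 k) :=
  Summable.of_norm_bounded ((summable_snd_mul x y).mul_left A) (norm_quad_term_le hw0 hA x y)

theorem abs_quadForm_le (hA0 : 0 ≤ A) (hw0 : ∀ k, 0 ≤ w k) (hA : ∀ k, |freq k| ≤ A * w k ^ 2)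
    (x y : WSpace w) : |quadForm freq x.1.1 y.1.1| ≤ A * ‖x‖ * ‖y‖ := by
  refine (Complex.abs_re_le_norm _).trans ?_
  refine (tsum_of_norm_bounded ((summable_snd_mul x y).mul_left A).hasSum
    (norm_quad_term_le hw0 hA x y)).trans ?_
  rw [tsum_mul_left, mul_assoc]
  gcongr
  refine (tsum_snd_mul_le x y).trans ?_
  gcongr
  · exact WSpace.norm_snd_le x
  · exact WSpace.norm_snd_le y

theorem quadForm_comm (x y : FreqLattice d → ℂ) : quadForm freq x y = quadForm freq y x := by
  have h : (∑' k, (freq k : ℂ) * y k * conj (x k)) =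
      conj (∑' k, (freq k : ℂ) * x k * conj (y k)) := by
    rw [Complex.conj_tsum]
    refine tsum_congr fun k => ?_
    simp only [map_mul, Complex.conj_ofReal, Complex.conj_conj]
    ring
  rw [quadForm, quadForm, h, Complex.conj_re]

theorem quadHam_eq_quadForm (x : FreqLattice d → ℂ) : quadHam freq x = quadForm freq x x := by
  have h : ∀ k, (freq k : ℂ) * x k * conj (x k) = ((freq k * ‖x k‖ ^ 2 : ℝ) : ℂ) := by
    intro k
    rw [mul_assoc, Complex.mul_conj, Complex.normSq_eq_norm_sq]
    push_cast
    ring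
  rw [quadForm]
  simp_rw [h]
  rw [← Complex.ofReal_tsum, Complex.ofReal_re, quadHam]

/-- The bilinear form of the quadratic Hamiltonian on a weighted space. -/
def quadCLM (hA0 : 0 ≤ A) (hw0 : ∀ k, 0 ≤ w k) (hA : ∀ k, |freq k| ≤ A * w k ^ 2) :
    WSpace w →L[ℝ] WSpace w →L[ℝ] ℝ :=
  LinearMap.mkContinuous₂
    (LinearMap.mk₂ ℝ (fun x y : WSpace w => quadForm freq x.1.1 y.1.1)
      (fun x x' y => by
        rw [quadForm, quadForm, quadForm, ← Complex.add_re,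
          ← (summable_quad hw0 hA x y).tsum_add (summable_quad hw0 hA x' y)]
        congr 1
        refine tsum_congr fun k => ?_
        rw [show (x + x').1.1 k = x.1.1 k + x'.1.1 k from rfl]
        ring)
      (fun c x y => by
        rw [quadForm, quadForm, smul_eq_mul, ← Complex.re_ofReal_mul, ← tsum_mul_left]
        congr 1
        refine tsum_congr fun k => ?_
        rw [show (c • x).1.1 k = (c : ℂ) * x.1.1 k from rfl]
        ring)
      (fun x y y' => by
        rw [quadForm, quadForm, quadForm, ← Complex.add_re,
          ← (summable_quad hw0 hA x y).tsum_add (summable_quad hw0 hA x y')]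
        congr 1
        refine tsum_congr fun k => ?_
        rw [show (y + y').1.1 k = y.1.1 k + y'.1.1 k from rfl, map_add]
        ring)
      (fun c x y => by
        rw [quadForm, quadForm, smul_eq_mul, ← Complex.re_ofReal_mul, ← tsum_mul_left]
        congr 1
        refine tsum_congr fun k => ?_
        rw [show (c • y).1.1 k = (c : ℂ) * y.1.1 k from rfl, map_mul, Complex.conj_ofReal]
        ring))
    A fun x y => abs_quadForm_le hA0 hw0 hA x y

theorem hasFDerivAt_quadHam (hA0 : 0 ≤ A) (hw0 : ∀ k, 0 ≤ w k)
    (hA : ∀ k, |freq k| ≤ A * w k ^ 2) (x : WSpace w) :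
    HasFDerivAt (fun x : WSpace w => quadHam freq x.1.1) (2 • quadCLM hA0 hw0 hA x) x := by
  have h := (quadCLM hA0 hw0 hA).hasFDerivAt_of_bilinear (hasFDerivAt_id x) (hasFDerivAt_id x)
  have e : (fun x : WSpace w => quadHam freq x.1.1) = fun x => quadCLM hA0 hw0 hA (id x) (id x) := by
    funext x
    exact quadHam_eq_quadForm _
  rw [e]
  refine h.congr_fderiv (ContinuousLinearMap.ext fun y => ?_)
  have hc : quadCLM hA0 hw0 hA y x = quadCLM hA0 hw0 hA x y := quadForm_comm _ _
  simp [two_smul, hc]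

end Quad

/-! ### The bracket of the quadratic Hamiltonian with a polynomial. -/

namespace HomPoly

variable {d n : ℕ}

theorem arr_perm {q : ℕ} (P : HomPoly d q) (φ σ : Equiv.Perm (Fin q))
    (κ : Fin q ⊕ Fin q → FreqLattice d) :
    P.arr (fun i => κ (Sum.map φ σ i)) = P.arr κ :=
  P.symmetry φ σ (fun j => κ (Sum.inl j)) fun j => κ (Sum.inr j)

theorem arr_swap {q : ℕ} (P : HomPoly d q) (κ : Fin q ⊕ Fin q → FreqLattice d) :
    P.arr (fun i => κ i.swap) = conj (P.arr κ) :=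
  P.reality _ _

theorem monom_perm {q : ℕ} (u : FreqLattice d → ℂ) (φ σ : Equiv.Perm (Fin q))
    (κ : Fin q ⊕ Fin q → FreqLattice d) :
    monom Sum.isLeft (fun _ => u) (fun i => κ (Sum.map φ σ i)) =
      monom Sum.isLeft (fun _ => u) κ := by
  rw [monom_isLeft, monom_isLeft]
  exact congrArg₂ (· * ·) (Equiv.prod_comp φ fun j => u (κ (Sum.inl j)))
    (Equiv.prod_comp σ fun j => conj (u (κ (Sum.inr j))))

theorem monom_swap {q : ℕ} (u : FreqLattice d → ℂ) (κ : Fin q ⊕ Fin q → FreqLattice d) :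
    monom Sum.isLeft (fun _ => u) (fun i => κ i.swap) =
      conj (monom Sum.isLeft (fun _ => u) κ) := by
  rw [monom_isLeft, monom_isLeft]
  simp [mul_comm]

theorem monom_consMomentum (u : FreqLattice d → ℂ) (κ : FieldIdx n → FreqLattice d) :
    monom Sum.isLeft (fun _ => u) (consMomentum κ) =
      conj (u (momentum Sum.isLeft κ)) * monom Sum.isLeft (fun _ => u) κ := by
  rw [monom_isLeft, monom_isLeft]
  simp only [consMomentum, Sum.elim_inl, Sum.elim_inr]
  rw [Fin.prod_univ_succ (fun j => conj (u _))]
  simp only [Fin.cons_zero, Fin.cons_succ]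
  ring

/-- The terms of the series of a polynomial, multiplied by the frequency of one of the modes. -/
def freqTerm (χ : HomPoly d (n + 1)) (freq : FreqLattice d → ℝ) (u : FreqLattice d → ℂ)
    (i : Fin (n + 1) ⊕ Fin (n + 1)) (κ : Fin (n + 1) ⊕ Fin (n + 1) → FreqLattice d) : ℂ :=
  freq (κ i) * (χ.arr κ * monom Sum.isLeft (fun _ => u) κ)

variable {w : FreqLattice d → ℝ} {freq : FreqLattice d → ℝ} {A : ℝ}

theorem _root_.tsum_mul_signedConv {ι : Type*} [Fintype ι] (ε : ι → Bool)
    (f : FreqLattice d → ℝ≥0∞) (h : (ι → FreqLattice d) → ℝ≥0∞) :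
    ∑' m, f m * signedConv ε h m = ∑' κ, f (momentum ε κ) * h κ := by
  classical
  simp_rw [signedConv, ← ENNReal.tsum_mul_left]
  rw [ENNReal.tsum_comm]
  refine tsum_congr fun κ => ?_
  rw [tsum_eq_single (momentum ε κ)]
  · rw [if_pos rfl]
  · intro m hm
    rw [if_neg (Ne.symm hm), mul_zero]

/-- The frequency at the distinguished mode is at most A w². One factor w stays on that mode; the
other, evaluated at the momentum of the remaining modes, weights their convolution. Both sequences
are square summable, the second by Young's inequality, and 2ab ≤ a² + b² finishes. This is how the
quadratic growth of the frequencies requires only H¹. -/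
theorem tsum_enorm_freqTerm_zero_ne_top (χ : HomPoly d (n + 1))
    (hw0 : ∀ k, 0 ≤ w k) (hA : ∀ k, |freq k| ≤ A * w k ^ 2) {c : ℝ} (hc : 0 ≤ c)
    (hw : ∀ κ : FieldIdx n → FreqLattice d, w (momentum Sum.isLeft κ) ≤ c * ∑ j, w (κ j))
    (x : WSpace w) :
    ∑' κ, ‖χ.freqTerm freq x.1.1 (Sum.inr 0) (consMomentum κ)‖ₑ ≠ ⊤ := by
  set a : FieldIdx n → FreqLattice d → ℝ≥0∞ := fun _ k => ‖x.1.1 k‖ₑ with ha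
  set W : FreqLattice d → ℝ≥0∞ := fun k => ENNReal.ofReal (w k) with hW
  have hwe : ∀ k, ‖((w k : ℝ) : ℂ)‖ₑ = W k := by
    intro k
    rw [← ofReal_norm, Complex.norm_real, Real.norm_of_nonneg (hw0 k)]
  have hx : ∑' k, (W k * ‖x.1.1 k‖ₑ) ^ 2 ≠ ⊤ := by
    have : ∀ k, W k * ‖x.1.1 k‖ₑ = ‖x.1.2 k‖ₑ := by
      intro k
      rw [WSpace.snd_apply, enorm_mul, hwe]
    simp_rw [this]
    rw [← EllTwo.enorm_sq_eq]
    simp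
  have hY := tsum_weight_mul_signedConv_sq_le Sum.isLeft W (ENNReal.ofReal c) (fun κ => by
      rw [hW, ← ENNReal.ofReal_sum_of_nonneg (fun j _ => hw0 _), ← ENNReal.ofReal_mul hc]
      exact ENNReal.ofReal_le_ofReal (hw κ)) a
  have hY' : ∑' m, (W m * signedConv Sum.isLeft (fun κ => ∏ i, a i (κ i)) m) ^ 2 ≠ ⊤ := by
    refine ne_top_of_le_ne_top ?_ hY
    refine ENNReal.mul_ne_top (by finiteness) (ENNReal.sum_ne_top.2 fun j _ => ?_)
    refine ENNReal.mul_ne_top hx (ENNReal.prod_ne_top fun i _ => ?_)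
    simp only [ha, ← EllOne.enorm_eq]
    simp
  refine ne_top_of_le_ne_top (ENNReal.mul_ne_top (a := ENNReal.ofReal (A * χ.supNorm))
    (by simp) (ENNReal.add_ne_top.2 ⟨hx, hY'⟩)) ?_
  rw [← ENNReal.tsum_add]
  calc ∑' κ, ‖χ.freqTerm freq x.1.1 (Sum.inr 0) (consMomentum κ)‖ₑ
      ≤ ∑' κ : FieldIdx n → FreqLattice d, ENNReal.ofReal (A * χ.supNorm) *
        ((W (momentum Sum.isLeft κ) ^ 2 * ‖x.1.1 (momentum Sum.isLeft κ)‖ₑ) *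
          ∏ i, a i (κ i)) := by
        refine ENNReal.tsum_le_tsum fun κ => ?_
        rw [freqTerm, monom_consMomentum, enorm_mul, enorm_mul, enorm_mul, enorm_monom]
        have h1 : ‖(freq (consMomentum κ (Sum.inr 0)) : ℂ)‖ₑ ≤
            ENNReal.ofReal A * W (momentum Sum.isLeft κ) ^ 2 := by
          rw [hW, ← ENNReal.ofReal_pow (hw0 _), ← ENNReal.ofReal_mul' (by positivity),
            ← ofReal_norm, Complex.norm_real]
          exact ENNReal.ofReal_le_ofReal (hA _)
        have h2 : ‖χ.arr (consMomentum κ)‖ₑ ≤ ENNReal.ofReal χ.supNorm := by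
          rw [← ofReal_norm]
          exact ENNReal.ofReal_le_ofReal (χ.norm_arr_le _)
        have h3 : ‖conj (x.1.1 (momentum Sum.isLeft κ))‖ₑ = ‖x.1.1 (momentum Sum.isLeft κ)‖ₑ := by
          rw [← ofReal_norm, RCLike.norm_conj, ofReal_norm]
        rw [h3, ENNReal.ofReal_mul' χ.supNorm_nonneg]
        refine (mul_le_mul' h1 (mul_le_mul' h2 le_rfl)).trans (le_of_eq ?_)
        simp only [ha]
        ring
    _ = ENNReal.ofReal (A * χ.supNorm) * ∑' m, (W m * ‖x.1.1 m‖ₑ) *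
          (W m * signedConv Sum.isLeft (fun κ => ∏ i, a i (κ i)) m) := by
        rw [ENNReal.tsum_mul_left, ← tsum_mul_signedConv Sum.isLeft fun m => W m ^ 2 * ‖x.1.1 m‖ₑ]
        congr 1
        exact tsum_congr fun m => by ring
    _ ≤ _ := by
        gcongr with m
        refine le_trans ?_ (ENNReal.two_mul_le_sq_add_sq _ _)
        rw [two_mul]
        exact le_self_add

theorem freqTerm_inr (χ : HomPoly d (n + 1)) (u : FreqLattice d → ℂ) (j : Fin (n + 1))
    (κ : Fin (n + 1) ⊕ Fin (n + 1) → FreqLattice d) :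
    χ.freqTerm freq u (Sum.inr j) κ =
      χ.freqTerm freq u (Sum.inr 0) (fun i => κ (Sum.map (Equiv.refl _) (Equiv.swap 0 j) i)) := by
  have h1 := χ.arr_perm (Equiv.refl _) (Equiv.swap 0 j) κ
  have h2 := monom_perm u (Equiv.refl _) (Equiv.swap 0 j) κ
  unfold freqTerm
  rw [h1, h2]
  simp

theorem freqTerm_inl (χ : HomPoly d (n + 1)) (u : FreqLattice d → ℂ) (j : Fin (n + 1))
    (κ : Fin (n + 1) ⊕ Fin (n + 1) → FreqLattice d) :
    χ.freqTerm freq u (Sum.inl j) κ =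
      conj (χ.freqTerm freq u (Sum.inr j) (fun i => κ i.swap)) := by
  unfold freqTerm
  rw [arr_swap, monom_swap]
  simp

/-- Convergence for the mode `Sum.inr 0` extends to all positions: permutations reach the other
conjugated modes, and reality gives the unconjugated ones with the conjugate sum. The small divisor
may then be split and summed position by position. -/
theorem hasSum_freqTerm (χ : HomPoly d (n + 1))
    (hw0 : ∀ k, 0 ≤ w k) (hA : ∀ k, |freq k| ≤ A * w k ^ 2) {c : ℝ} (hc : 0 ≤ c)
    (hw : ∀ κ : FieldIdx n → FreqLattice d, w (momentum Sum.isLeft κ) ≤ c * ∑ j, w (κ j))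
    (x : WSpace w) :
    ∃ T : ℂ, HasSum (fun κ => χ.freqTerm freq x.1.1 (Sum.inr 0) (consMomentum κ)) T ∧
      (∀ j, HasSum (χ.freqTerm freq x.1.1 (Sum.inr j)) T) ∧
      ∀ j, HasSum (χ.freqTerm freq x.1.1 (Sum.inl j)) (conj T) := by
  have h0 := (summable_of_tsum_enorm
    (χ.tsum_enorm_freqTerm_zero_ne_top hw0 hA hc hw x)).hasSum
  refine ⟨_, h0, ?_⟩
  have h1 : HasSum (χ.freqTerm freq x.1.1 (Sum.inr 0))
      (∑' κ, χ.freqTerm freq x.1.1 (Sum.inr 0) (consMomentum κ)) := by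
    refine (consMomentum_injective.hasSum_iff fun κ hκ => ?_).1 h0
    have : momentum Sum.isLeft κ ≠ 0 := fun h => hκ (mem_range_consMomentum h)
    simp [freqTerm, χ.arr_eq_zero this]
  have h2 : ∀ j, HasSum (χ.freqTerm freq x.1.1 (Sum.inr j))
      (∑' κ, χ.freqTerm freq x.1.1 (Sum.inr 0) (consMomentum κ)) := by
    intro j
    have := (((Equiv.sumCongr (Equiv.refl (Fin (n + 1))) (Equiv.swap 0 j)).symm.arrowCongr
      (Equiv.refl (FreqLattice d))).hasSum_iff).2 h1
    convert this using 1
    funext κ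
    rw [freqTerm_inr]
    rfl
  refine ⟨h2, fun j => ?_⟩
  have := Complex.hasSum_conj'.2 ((((Equiv.sumComm (Fin (n + 1)) (Fin (n + 1))).arrowCongr
    (Equiv.refl (FreqLattice d))).hasSum_iff).2 (h2 j))
  convert this using 1
  funext κ
  rw [freqTerm_inl]
  rfl

/-- The bracket of the quadratic Hamiltonian with a polynomial multiplies the coefficients by the
small divisors. -/
theorem two_mul_quadForm_field (χ P : HomPoly d (n + 1))
    (hP : ∀ k l, P.coeff k l = -smallDivisor freq k l * χ.coeff k l)
    (hw0 : ∀ k, 0 ≤ w k) (hA : ∀ k, |freq k| ≤ A * w k ^ 2) {c : ℝ} (hc : 0 ≤ c)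
    (hw : ∀ κ : FieldIdx n → FreqLattice d, w (momentum Sum.isLeft κ) ≤ c * ∑ j, w (κ j))
    (x : WSpace w) : 2 * quadForm freq x.1.1 (χ.field x.1.1) = P.eval x.1.1 := by
  obtain ⟨T, h0, hr, hl⟩ := χ.hasSum_freqTerm hw0 hA hc hw x
  -- The divisor contributes `conj T` for each unconjugated mode and `-T` for each conjugated one;
  -- the factor `-2i` turns this into a multiple of the imaginary part.
  have h1 : P.eval x.1.1 = -4 * (n + 1) * T.im := by
    have h := ((hasSum_sum (s := Finset.univ) fun j _ => hl j).sub
      (hasSum_sum (s := Finset.univ) fun j _ => hr j)).mul_left (-2 * Complex.I)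
    have e : P.cform (fun _ => x.1.1) = _ := (tsum_congr fun κ => by
      rw [arr, hP, smallDivisor]
      simp only [freqTerm, ← Finset.sum_mul]
      push_cast
      rw [arr]
      ring).trans h.tsum_eq
    rw [eval_eq_cform, e]
    simp
    ring
  -- Grouping the same series `T` according to the momentum of the remaining modes recovers the
  -- coordinates of the field.
  have h2 : quadForm freq x.1.1 (χ.field x.1.1) = -2 * (n + 1) * T.im := by
    have h3 := ((h0.mul_left (2 * ((n : ℂ) + 1))).tsum_fiberwise (momentum Sum.isLeft)).tsum_eq
    have h4 : ∑' k, (freq k : ℂ) * x.1.1 k * conj (χ.field x.1.1 k) =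
        conj (Complex.I * (2 * ((n : ℂ) + 1) * T)) := by
      rw [← h3, ← tsum_mul_left, Complex.conj_tsum]
      refine tsum_congr fun m => ?_
      rw [tsum_subtype (momentum Sum.isLeft ⁻¹' {m}) fun κ => 2 * ((n : ℂ) + 1) *
        χ.freqTerm freq x.1.1 (Sum.inr 0) (consMomentum κ)]
      rw [field, lp.coeFn_smul, Pi.smul_apply, smul_eq_mul, χ.grad_eq,
        ← (hasSum_arrVec_apply Sum.isLeft χ.norm_gradArr_le (fun _ => x.1.1) m).tsum_eq]
      have h5 : ∀ κ, (momentum Sum.isLeft ⁻¹' {m}).indicator (fun κ => 2 * ((n : ℂ) + 1) *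
          χ.freqTerm freq x.1.1 (Sum.inr 0) (consMomentum κ)) κ =
          freq m * conj (x.1.1 m) * (if momentum Sum.isLeft κ = m then
            χ.gradArr κ * monom Sum.isLeft (fun _ => x.1.1) κ else 0) := by
        intro κ
        by_cases hκ : momentum Sum.isLeft κ = m
        · rw [if_pos hκ, Set.indicator_of_mem (by simpa using hκ), freqTerm, monom_consMomentum,
            ← two_mul_arr_consMomentum, hκ, show consMomentum κ (Sum.inr 0) = m from hκ]
          ring
        · rw [if_neg hκ, Set.indicator_of_notMem (by simpa using hκ), mul_zero]
      simp_rw [h5]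
      rw [tsum_mul_left]
      simp only [map_mul, Complex.conj_ofReal, Complex.conj_conj]
      ring
    rw [quadForm, h4]
    simp
  rw [h1, h2]
  ring

end HomPoly
end

noncomputable section

set_option linter.unusedSectionVars false

/-! ### Small Lipschitz perturbations of the identity -/

section Perturbation

variable {Γ : Type*} [NormedAddCommGroup Γ] [NormedSpace ℝ Γ] [CompleteSpace Γ]

/-- The map x ↦ x - G x approximates the identity up to the Lipschitz constant Λ < 1, so it is
injective on the ball and covers the ball of radius (1 - Λ)R. Its derivative is invertible by a
Neumann series, so the local inverses are smooth. -/
theorem exists_smooth_inverse_sub {G : Γ → Γ} (hG : ContDiff ℝ ∞ G) (h0 : G 0 = 0) {R Λ : ℝ}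
    (hΛ0 : 0 ≤ Λ) (hΛ : Λ < 1)
    (hL : ∀ x ∈ Metric.ball (0 : Γ) R, ∀ y ∈ Metric.ball (0 : Γ) R, ‖G x - G y‖ ≤ Λ * ‖x - y‖) :
    (∀ x, ‖x‖ < R → ∀ y, ‖y‖ < R → x - G x = y - G y → x = y) ∧
    ∃ S : Γ → Γ, (∀ y, ‖y‖ < (1 - Λ) * R → ‖S y‖ < R ∧ S y - G (S y) = y ∧
      (1 - Λ) * ‖S y‖ ≤ ‖y‖) ∧ ∀ y, ‖y‖ < (1 - Λ) * R → ContDiffAt ℝ ∞ S y := by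
  lift Λ to NNReal using hΛ0
  have hinj : ∀ x, ‖x‖ < R → ∀ y, ‖y‖ < R → x - G x = y - G y → x = y := by
    intro x hx y hy h
    have h1 := hL x (by simpa using hx) y (by simpa using hy)
    have h2 : x - y = G x - G y := by
      rw [sub_eq_sub_iff_add_eq_add] at h ⊢
      rw [add_comm (G x), ← h, add_comm]
    rw [← h2] at h1
    have h3 : ‖x - y‖ = 0 := by nlinarith [norm_nonneg (x - y)]
    exact sub_eq_zero.1 (norm_eq_zero.1 h3)
  have hlip : LipschitzOnWith Λ G (Metric.ball (0 : Γ) R) :=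
    LipschitzOnWith.of_dist_le_mul fun x hx y hy => by
      rw [dist_eq_norm, dist_eq_norm]
      exact hL x hx y hy
  have happ : ApproximatesLinearOn (fun x => x - G x) (ContinuousLinearMap.id ℝ Γ)
      (Metric.ball (0 : Γ) R) Λ := by
    refine LipschitzOnWith.approximatesLinearOn ?_
    refine LipschitzOnWith.of_dist_le_mul fun x hx y hy => ?_
    rw [dist_eq_norm, dist_eq_norm]
    refine le_trans (le_of_eq ?_) (hL x hx y hy)
    rw [← norm_neg]
    congr 1
    simp only [Pi.sub_apply, ContinuousLinearMap.coe_id', id]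
    abel
  have hex : ∀ y, ‖y‖ < (1 - Λ) * R → ∃ x, ‖x‖ < R ∧ x - G x = y ∧ (1 - Λ) * ‖x‖ ≤ ‖y‖ := by
    intro y hy
    -- Solving in the closed ball of radius ‖y‖/(1 - Λ), which depends on `y`, also yields the
    -- linear bound on the solution.
    have hε : ‖y‖ / (1 - Λ) < R := by
      rw [div_lt_iff₀ (by linarith)]
      linarith
    have hε0 : 0 ≤ ‖y‖ / (1 - Λ) := div_nonneg (norm_nonneg _) (by linarith)
    have hs := happ.surjOn_closedBall_of_nonlinearRightInverse
      ⟨id, 1, fun y => by simp, fun y => rfl⟩ (b := 0) hε0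
      (Metric.closedBall_subset_ball hε)
    obtain ⟨x, hx, hxy⟩ := hs (a := y) (by
      simp only [h0, sub_zero, mem_closedBall_zero_iff, NNReal.coe_one, inv_one]
      rw [mul_div_cancel₀ _ (by linarith)])
    rw [mem_closedBall_zero_iff] at hx
    refine ⟨x, hx.trans_lt hε, hxy, ?_⟩
    rwa [le_div_iff₀' (by linarith)] at hx
  choose! S hS using hex
  refine ⟨hinj, S, hS, fun y hy => ?_⟩
  obtain ⟨hx, hxy, -⟩ := hS y hy
  set x := S y with hxdef
  have hxb : Metric.ball (0 : Γ) R ∈ nhds x := Metric.isOpen_ball.mem_nhds (by simpa using hx)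
  have hGd : HasFDerivAt G (fderiv ℝ G x) x := (hG.differentiable (by simp) x).hasFDerivAt
  have hn : ‖fderiv ℝ G x‖ < 1 := (hGd.le_of_lipschitzOn hxb hlip).trans_lt hΛ
  have hF : ContDiffAt ℝ ∞ (fun x => x - G x) x := contDiffAt_id.sub hG.contDiffAt
  have hFd : HasFDerivAt (fun x => x - G x)
      ((ContinuousLinearEquiv.unitsEquiv ℝ Γ (Units.oneSub _ hn) : Γ ≃L[ℝ] Γ) : Γ →L[ℝ] Γ) x :=
    (hasFDerivAt_id x).sub hGd
  have hloc := hF.to_localInverse hFd (by simp)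
  simp only [hxy] at hloc
  refine hloc.congr_of_eventuallyEq ?_
  have hstr := hF.hasStrictFDerivAt' hFd (by simp)
  have e1 := hstr.eventually_right_inverse
  have e2 := hstr.localInverse_tendsto.eventually hxb
  simp only [hxy] at e1 e2
  have e3 : ∀ᶠ z in nhds y, ‖z‖ < (1 - Λ) * R :=
    (isOpen_lt continuous_norm continuous_const).mem_nhds hy
  -- `S` is merely chosen pointwise; injectivity on the ball forces it to coincide with the smooth
  -- local inverse near `y`.
  filter_upwards [e1, e2, e3] with z h1 h2 h3
  obtain ⟨h4, h5, -⟩ := hS z h3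
  exact hinj _ h4 _ (mem_ball_zero_iff.1 h2) (h5.trans h1.symm)

end Perturbation

/-! ### Curves -/

section Curves

variable {E : Type*} [NormedAddCommGroup E] [NormedSpace ℝ E] [CompleteSpace E]

theorem continuous_comp_projIcc (f : C(unitInterval, E)) :
    Continuous fun τ : ℝ => f (Set.projIcc 0 1 zero_le_one τ) :=
  f.continuous.comp continuous_projIcc

/-- The primitive of a curve, as a continuous linear operator. -/
def primitiveCLM (E : Type*) [NormedAddCommGroup E] [NormedSpace ℝ E] [CompleteSpace E] :
    C(unitInterval, E) →L[ℝ] C(unitInterval, E) :=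
  LinearMap.mkContinuous
    { toFun := fun f =>
        ⟨fun t => ∫ τ in (0 : ℝ)..t, f (Set.projIcc 0 1 zero_le_one τ),
          (intervalIntegral.continuous_primitive
            (fun a b => (continuous_comp_projIcc f).intervalIntegrable a b) 0).comp
              continuous_subtype_val⟩
      map_add' := fun f g => ContinuousMap.ext fun t =>
        intervalIntegral.integral_add ((continuous_comp_projIcc f).intervalIntegrable _ _)
          ((continuous_comp_projIcc g).intervalIntegrable _ _)
      map_smul' := fun c f => ContinuousMap.ext fun t => intervalIntegral.integral_smul _ _ }
    1 fun f => by
      rw [one_mul, ContinuousMap.norm_le _ (norm_nonneg f)]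
      intro t
      refine (intervalIntegral.norm_integral_le_of_norm_le_const
        fun τ _ => f.norm_coe_le_norm _).trans ?_
      rw [sub_zero, abs_of_nonneg t.2.1]
      exact mul_le_of_le_one_right (norm_nonneg f) t.2.2

theorem primitiveCLM_apply (f : C(unitInterval, E)) (t : unitInterval) :
    primitiveCLM E f t = ∫ τ in (0 : ℝ)..t, f (Set.projIcc 0 1 zero_le_one τ) := rfl

theorem norm_primitiveCLM_apply_le (f : C(unitInterval, E)) : ‖primitiveCLM E f‖ ≤ ‖f‖ := by
  have h : ‖primitiveCLM E‖ ≤ 1 := LinearMap.mkContinuous_norm_le _ zero_le_one _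
  simpa using (primitiveCLM E).le_of_opNorm_le h f

/-- The constant curves. -/
def constCLM (E : Type*) [NormedAddCommGroup E] [NormedSpace ℝ E] :
    E →L[ℝ] C(unitInterval, E) :=
  LinearMap.mkContinuous
    { toFun := fun u => ContinuousMap.const _ u
      map_add' := fun _ _ => rfl
      map_smul' := fun _ _ => rfl }
    1 fun u => by
      rw [one_mul, ContinuousMap.norm_le _ (norm_nonneg u)]
      exact fun _ => le_rfl

@[simp] theorem constCLM_apply (u : E) (t : unitInterval) : constCLM E u t = u := rfl

theorem norm_constCLM_apply_le (u : E) : ‖constCLM E u‖ ≤ ‖u‖ := by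
  rw [ContinuousMap.norm_le _ (norm_nonneg u)]
  exact fun _ => le_rfl

variable {ι : Type*} [Fintype ι]

/-- A multilinear map acting pointwise on curves, with a time dependent factor. -/
def curveLift (T : ContinuousMultilinearMap ℝ (fun _ : ι => E) E) (c : C(unitInterval, ℝ)) :
    ContinuousMultilinearMap ℝ (fun _ : ι => C(unitInterval, E)) C(unitInterval, E) :=
  MultilinearMap.mkContinuous
    { toFun := fun γ => ⟨fun t => c t • T fun i => γ i t, by fun_prop⟩
      map_update_add' := by
        intro _ γ i x y
        ext t
        have e : ∀ z : C(unitInterval, E), (fun j => Function.update γ i z j t) =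
            Function.update (fun j => γ j t) i (z t) := fun z =>
          funext fun j => Function.apply_update (fun _ (v : C(unitInterval, E)) => v t) γ i z j
        change c t • T (fun j => Function.update γ i (x + y) j t) =
          c t • T (fun j => Function.update γ i x j t) + c t • T (fun j => Function.update γ i y j t)
        rw [e, e, e, ContinuousMap.add_apply, T.map_update_add, smul_add]
      map_update_smul' := by
        intro _ γ i a x
        ext t
        have e : ∀ z : C(unitInterval, E), (fun j => Function.update γ i z j t) =
            Function.update (fun j => γ j t) i (z t) := fun z =>
          funext fun j => Function.apply_update (fun _ (v : C(unitInterval, E)) => v t) γ i z j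
        change c t • T (fun j => Function.update γ i (a • x) j t) =
          a • c t • T (fun j => Function.update γ i x j t)
        rw [e, e, ContinuousMap.smul_apply, T.map_update_smul, smul_comm] }
    (‖c‖ * ‖T‖) fun γ => by
      rw [ContinuousMap.norm_le _ (by positivity)]
      intro t
      refine (norm_smul_le _ _).trans ?_
      rw [mul_assoc]
      refine mul_le_mul (c.norm_coe_le_norm t) ((T.le_opNorm _).trans ?_) (norm_nonneg _)
        (norm_nonneg _)
      gcongr with i
      exact (γ i).norm_coe_le_norm t

theorem norm_curveLift_le (T : ContinuousMultilinearMap ℝ (fun _ : ι => E) E)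
    (c : C(unitInterval, ℝ)) : ‖curveLift T c‖ ≤ ‖c‖ * ‖T‖ :=
  MultilinearMap.mkContinuous_norm_le _ (by positivity) _

theorem ContinuousMultilinearMap.contDiff_diag {F : Type*} [NormedAddCommGroup F]
    [NormedSpace ℝ F] (T : ContinuousMultilinearMap ℝ (fun _ : ι => E) F) {n : WithTop ℕ∞} :
    ContDiff ℝ n fun x : E => T fun _ => x :=
  T.contDiff.comp (contDiff_pi.2 fun _ => contDiff_id)

theorem ContinuousMultilinearMap.norm_diag_sub_le {F : Type*} [NormedAddCommGroup F]
    [NormedSpace ℝ F] (T : ContinuousMultilinearMap ℝ (fun _ : ι => E) F) {x y : E} {R : ℝ}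
    (hx : ‖x‖ ≤ R) (hy : ‖y‖ ≤ R) :
    ‖(T fun _ => x) - T fun _ => y‖ ≤
      ‖T‖ * Fintype.card ι * R ^ (Fintype.card ι - 1) * ‖x - y‖ := by
  have h := T.norm_image_sub_le (fun _ => x) fun _ => y
  refine h.trans ?_
  have hc : ∀ z : E, ‖fun _ : ι => z‖ ≤ ‖z‖ := fun z => pi_norm_const_le z
  have hR : 0 ≤ R := (norm_nonneg x).trans hx
  gcongr
  · exact max_le ((hc x).trans hx) ((hc y).trans hy)
  · exact hc (x - y)

end Curves
end

noncomputable section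

set_option linter.unusedSectionVars false

/-! ### Integral curves of time-dependent polynomial fields. -/

section Flows

variable {E : Type*} [NormedAddCommGroup E] [NormedSpace ℝ E] [CompleteSpace E]
variable {α : Type*} {ι : α → Type*} [∀ a, Fintype (ι a)]

/-- The polynomial vector field `∑ c_a(t) X_a(γ(t))` along a curve. -/
def timeField (S : Finset α) (X : ∀ a, ContinuousMultilinearMap ℝ (fun _ : ι a => E) E)
    (c : α → C(unitInterval, ℝ)) (γ : C(unitInterval, E)) : C(unitInterval, E) :=
  ∑ a ∈ S, curveLift (X a) (c a) fun _ => γ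

/-- `γ` is the integral curve starting at `u` of the time dependent field `∑ c_a(t) X_a`. -/
def IsIntegralCurveFrom (S : Finset α)
    (X : ∀ a, ContinuousMultilinearMap ℝ (fun _ : ι a => E) E)
    (c : α → C(unitInterval, ℝ)) (u : E) (γ : C(unitInterval, E)) : Prop :=
  γ - primitiveCLM E (timeField S X c γ) = constCLM E u

variable {S : Finset α} {X : ∀ a, ContinuousMultilinearMap ℝ (fun _ : ι a => E) E}
  {c : α → C(unitInterval, ℝ)} {u : E} {γ : C(unitInterval, E)}

theorem timeField_apply (γ : C(unitInterval, E)) (t : unitInterval) :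
    timeField S X c γ t = ∑ a ∈ S, c a t • X a fun _ => γ t := by
  rw [timeField, ContinuousMap.sum_apply]
  rfl

theorem contDiff_timeField : ContDiff ℝ ∞ (timeField S X c) :=
  ContDiff.sum fun a _ => (curveLift (X a) (c a)).contDiff_diag

/-- A Lipschitz constant, on the ball of radius `R`, of the field `∑ c_a(t) X_a`. -/
def fieldLip (S : Finset α) (X : ∀ a, ContinuousMultilinearMap ℝ (fun _ : ι a => E) E)
    (c : α → C(unitInterval, ℝ)) (R : ℝ) : ℝ :=
  ∑ a ∈ S, ‖c a‖ * ‖X a‖ * Fintype.card (ι a) * R ^ (Fintype.card (ι a) - 1)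

theorem fieldLip_nonneg {R : ℝ} (hR : 0 ≤ R) : 0 ≤ fieldLip S X c R :=
  Finset.sum_nonneg fun a _ => by positivity

theorem norm_timeField_sub_le {R : ℝ} {γ γ' : C(unitInterval, E)} (h : ‖γ‖ ≤ R) (h' : ‖γ'‖ ≤ R) :
    ‖timeField S X c γ - timeField S X c γ'‖ ≤ fieldLip S X c R * ‖γ - γ'‖ := by
  have hR : 0 ≤ R := (norm_nonneg γ).trans h
  rw [timeField, timeField, ← Finset.sum_sub_distrib, fieldLip, Finset.sum_mul]
  refine (norm_sum_le _ _).trans (Finset.sum_le_sum fun a _ => ?_)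
  refine ((curveLift (X a) (c a)).norm_diag_sub_le h h').trans ?_
  gcongr
  exact norm_curveLift_le _ _

/-- Solution operator of a field which is a small perturbation of the identity. -/
theorem exists_flow (hcard : ∀ a ∈ S, Nonempty (ι a)) {R : ℝ} (hR : 0 ≤ R)
    (hΛ : fieldLip S X c R < 1) :
    (∀ u γ γ', ‖γ‖ < R → ‖γ'‖ < R → IsIntegralCurveFrom S X c u γ →
      IsIntegralCurveFrom S X c u γ' → γ = γ') ∧
    ∃ Φ : E → C(unitInterval, E), (∀ u, ‖u‖ < (1 - fieldLip S X c R) * R →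
      ‖Φ u‖ < R ∧ IsIntegralCurveFrom S X c u (Φ u) ∧ (1 - fieldLip S X c R) * ‖Φ u‖ ≤ ‖u‖) ∧
      ∀ u, ‖u‖ < (1 - fieldLip S X c R) * R → ContDiffAt ℝ ∞ Φ u := by
  obtain ⟨hinj, Ψ, hΨ, hs⟩ := exists_smooth_inverse_sub
    (G := fun γ => primitiveCLM E (timeField S X c γ)) (R := R)
    ((primitiveCLM E).contDiff.comp contDiff_timeField) (by
      have : timeField S X c (0 : C(unitInterval, E)) = 0 := by
        refine Finset.sum_eq_zero fun a ha => ?_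
        have := hcard a ha
        exact (curveLift (X a) (c a)).map_zero
      simp only [this, map_zero]) (fieldLip_nonneg hR) hΛ (by
      intro x hx y hy
      rw [← map_sub]
      exact (norm_primitiveCLM_apply_le _).trans (norm_timeField_sub_le
        (mem_ball_zero_iff.1 hx).le (mem_ball_zero_iff.1 hy).le))
  refine ⟨fun u γ γ' h h' hu hu' => hinj _ h _ h' (hu.trans hu'.symm),
    fun u => Ψ (constCLM E u), fun u hu => ?_, fun u hu => ?_⟩
  · obtain ⟨h1, h2, h3⟩ := hΨ (constCLM E u) ((norm_constCLM_apply_le u).trans_lt hu)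
    exact ⟨h1, h2, h3.trans (norm_constCLM_apply_le u)⟩
  · exact (hs (constCLM E u) ((norm_constCLM_apply_le u).trans_lt hu)).comp u
      (constCLM E).contDiff.contDiffAt

namespace IsIntegralCurveFrom

theorem apply_eq (h : IsIntegralCurveFrom S X c u γ) (t : unitInterval) :
    γ t = u + ∫ τ in (0 : ℝ)..t, timeField S X c γ (Set.projIcc 0 1 zero_le_one τ) := by
  have := DFunLike.congr_fun h t
  rw [ContinuousMap.sub_apply, constCLM_apply, sub_eq_iff_eq_add] at this
  exact this

theorem apply_zero (h : IsIntegralCurveFrom S X c u γ) : γ 0 = u := by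
  rw [h.apply_eq]
  simp

theorem of_apply_eq (h : ∀ t : unitInterval,
    γ t = u + ∫ τ in (0 : ℝ)..t, timeField S X c γ (Set.projIcc 0 1 zero_le_one τ)) :
    IsIntegralCurveFrom S X c u γ := by
  refine ContinuousMap.ext fun t => ?_
  rw [ContinuousMap.sub_apply, constCLM_apply, sub_eq_iff_eq_add]
  exact h t

/-- The derivative of the extended curve. -/
theorem hasDerivAt (h : IsIntegralCurveFrom S X c u γ) {t : ℝ} (ht : t ∈ Set.Ioo (0 : ℝ) 1) :
    HasDerivAt (fun τ => γ (Set.projIcc 0 1 zero_le_one τ))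
      (timeField S X c γ (Set.projIcc 0 1 zero_le_one t)) t := by
  have hc := continuous_comp_projIcc (timeField S X c γ)
  have h1 : HasDerivAt (fun s => u + ∫ τ in (0 : ℝ)..s,
      timeField S X c γ (Set.projIcc 0 1 zero_le_one τ))
      (timeField S X c γ (Set.projIcc 0 1 zero_le_one t)) t :=
    (intervalIntegral.integral_hasDerivAt_right (hc.intervalIntegrable _ _)
      (hc.stronglyMeasurableAtFilter _ _) hc.continuousAt).const_add u
  refine h1.congr_of_eventuallyEq ?_
  filter_upwards [Ioo_mem_nhds ht.1 ht.2] with s hs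
  rw [h.apply_eq, Set.projIcc_of_mem zero_le_one ⟨hs.1.le, hs.2.le⟩]

/-- Affine reparametrization of an integral curve. -/
theorem reparam (h : IsIntegralCurveFrom S X c u γ) (φ : C(unitInterval, unitInterval)) (a b : ℝ)
    (hφ : ∀ t, (φ t : ℝ) = a + b * t) :
    IsIntegralCurveFrom S X (fun i => b • (c i).comp φ) (γ (φ 0)) (γ.comp φ) := by
  refine of_apply_eq fun t => ?_
  have hc := continuous_comp_projIcc (timeField S X c γ)
  have h0 : (φ 0 : ℝ) = a := by simp [hφ]
  have e : ∫ τ in (0 : ℝ)..t, timeField S X (fun i => b • (c i).comp φ) (γ.comp φ)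
      (Set.projIcc 0 1 zero_le_one τ) =
      ∫ τ in (0 : ℝ)..t, b • timeField S X c γ (Set.projIcc 0 1 zero_le_one (a + b * τ)) := by
    refine intervalIntegral.integral_congr fun τ hτ => ?_
    rw [Set.uIcc_of_le t.2.1] at hτ
    have hτ' : τ ∈ Set.Icc (0 : ℝ) 1 := ⟨hτ.1, hτ.2.trans t.2.2⟩
    have e1 : Set.projIcc 0 1 zero_le_one (a + b * τ) = φ ⟨τ, hτ'⟩ := by
      have := hφ ⟨τ, hτ'⟩
      simp only at this
      rw [← this, Set.projIcc_val]
    simp only [e1, Set.projIcc_of_mem zero_le_one hτ', timeField_apply, Finset.smul_sum, smul_smul]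
    rfl
  have e2 : b • ∫ τ in (0 : ℝ)..t, timeField S X c γ (Set.projIcc 0 1 zero_le_one (a + b * τ)) =
      ∫ τ in (a + b * 0)..(a + b * t), timeField S X c γ (Set.projIcc 0 1 zero_le_one τ) :=
    intervalIntegral.smul_integral_comp_add_mul
      (fun τ => timeField S X c γ (Set.projIcc 0 1 zero_le_one τ)) b a
  rw [e, intervalIntegral.integral_smul, e2, mul_zero, add_zero, ContinuousMap.comp_apply, h.apply_eq (φ t), h.apply_eq (φ 0), h0, add_assoc,
    intervalIntegral.integral_add_adjacent_intervals (hc.intervalIntegrable _ _)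
      (hc.intervalIntegrable _ _), hφ t]

/-- Integral curves are mapped to integral curves by a linear map intertwining the fields. -/
theorem map {F : Type*} [NormedAddCommGroup F] [NormedSpace ℝ F] [CompleteSpace F]
    {Y : ∀ a, ContinuousMultilinearMap ℝ (fun _ : ι a => F) F} (j : E →L[ℝ] F)
    (hj : ∀ a ∈ S, ∀ x : E, j (X a fun _ => x) = Y a fun _ => j x)
    (h : IsIntegralCurveFrom S X c u γ) :
    IsIntegralCurveFrom S Y c (j u) ((j : C(E, F)).comp γ) := by
  refine of_apply_eq fun t => ?_
  have hc := continuous_comp_projIcc (timeField S X c γ)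
  rw [ContinuousMap.comp_apply, h.apply_eq]
  simp only [ContinuousMap.coe_coe, map_add]
  rw [← ContinuousLinearMap.intervalIntegral_comp_comm _ (hc.intervalIntegrable _ _)]
  congr 1
  refine intervalIntegral.integral_congr fun τ _ => ?_
  simp only [timeField_apply, map_sum, map_smul]
  exact Finset.sum_congr rfl fun a ha => by rw [hj a ha]; rfl

end IsIntegralCurveFrom

end Flows
end

noncomputable section

/-! ### Hamiltonian fields as multilinear maps on ℓ¹ and on the weighted spaces. -/

namespace HomPoly

variable {d n : ℕ}

/-- The coefficients of the Hamiltonian vector field. -/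
def fieldArr (χ : HomPoly d (n + 1)) (κ : FieldIdx n → FreqLattice d) : ℂ :=
  Complex.I * χ.gradArr κ

theorem norm_fieldArr_le (χ : HomPoly d (n + 1)) (κ : FieldIdx n → FreqLattice d) :
    ‖χ.fieldArr κ‖ ≤ 2 * (n + 1) * χ.supNorm := by
  rw [fieldArr, norm_mul, Complex.norm_I, one_mul]
  exact χ.norm_gradArr_le κ

/-- The Hamiltonian vector field, as a multilinear map. -/
def fieldMap (χ : HomPoly d (n + 1)) :
    ContinuousMultilinearMap ℝ (fun _ : FieldIdx n => EllOne d) (EllOne d) :=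
  arrMap Sum.isLeft χ.gradBound_nonneg χ.norm_fieldArr_le

theorem fieldMap_apply (χ : HomPoly d (n + 1)) (u : EllOne d) :
    (χ.fieldMap fun _ => u) = χ.field u := by
  have h := (summable_arrVec Sum.isLeft χ.norm_gradArr_le fun _ => u).tsum_const_smul Complex.I
  refine Eq.trans (tsum_congr fun κ => ?_) h
  rw [← lp.single_smul, fieldArr, smul_eq_mul, mul_assoc]

theorem norm_fieldMap_le (χ : HomPoly d (n + 1)) :
    ‖χ.fieldMap‖ ≤ 2 * (n + 1) * χ.supNorm :=
  norm_arrMap_le _ _ _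

variable {δ s : ℝ}

/-- The Hamiltonian vector field on a weighted space. -/
def fieldMapW (χ : HomPoly d (n + 1)) (hδ : 0 ≤ δ) (hs : 0 ≤ s) :
    ContinuousMultilinearMap ℝ (fun _ : FieldIdx n => WSpace (sobWeight d δ s))
      (WSpace (sobWeight d δ s)) :=
  WSpace.arrMapW Sum.isLeft χ.gradBound_nonneg χ.norm_fieldArr_le
    (Real.rpow_nonneg (Nat.cast_nonneg _) s) (sobWeight_nonneg hδ s)
    (sobWeight_momentum_le hδ hs Sum.isLeft)

/-- The gradient on a weighted space. -/
def gradMapW (χ : HomPoly d (n + 1)) (hδ : 0 ≤ δ) (hs : 0 ≤ s) :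
    ContinuousMultilinearMap ℝ (fun _ : FieldIdx n => WSpace (sobWeight d δ s))
      (WSpace (sobWeight d δ s)) :=
  WSpace.arrMapW Sum.isLeft χ.gradBound_nonneg χ.norm_gradArr_le
    (Real.rpow_nonneg (Nat.cast_nonneg _) s) (sobWeight_nonneg hδ s)
    (sobWeight_momentum_le hδ hs Sum.isLeft)

theorem max_one_card_rpow (n : ℕ) (hs : 0 ≤ s) :
    max 1 ((Fintype.card (FieldIdx n) : ℝ) ^ s * Fintype.card (FieldIdx n)) =
      (2 * n + 1 : ℝ) ^ (s + 1) := by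
  have h : ((Fintype.card (FieldIdx n) : ℕ) : ℝ) = 2 * n + 1 := by
    simp only [Fintype.card_sum, Fintype.card_fin]
    push_cast
    ring
  have h1 : (1 : ℝ) ≤ 2 * n + 1 := by linarith [(Nat.cast_nonneg n : (0 : ℝ) ≤ n)]
  rw [h, Real.rpow_add_one (by positivity)]
  exact max_eq_right (one_le_mul_of_one_le_of_one_le (Real.one_le_rpow h1 hs) h1)

theorem norm_fieldMapW_le (χ : HomPoly d (n + 1)) (hδ : 0 ≤ δ) (hs : 0 ≤ s) :
    ‖χ.fieldMapW hδ hs‖ ≤ 2 * (n + 1) * χ.supNorm * (2 * n + 1 : ℝ) ^ (s + 1) := by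
  rw [← max_one_card_rpow n hs]
  exact WSpace.norm_arrMapW_le _ _ _ _ _ _

theorem norm_gradMapW_le (χ : HomPoly d (n + 1)) (hδ : 0 ≤ δ) (hs : 0 ≤ s) :
    ‖χ.gradMapW hδ hs‖ ≤ 2 * (n + 1) * χ.supNorm * (2 * n + 1 : ℝ) ^ (s + 1) := by
  rw [← max_one_card_rpow n hs]
  exact WSpace.norm_arrMapW_le _ _ _ _ _ _

end HomPoly

/-! ### Smallness of the fields -/

/-- The constant measuring the loss on the vector fields in `H^s`. -/
def tameConst (s : ℝ) : ℝ := ∑' n : ℕ, (2 * n + 1 : ℝ) ^ (s + 2) * (1 / 16) ^ n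

theorem summable_tameConst (s : ℝ) :
    Summable fun n : ℕ => (2 * n + 1 : ℝ) ^ (s + 2) * (1 / 16) ^ n := by
  obtain ⟨m, hm⟩ := exists_nat_ge (s + 2)
  have h := summable_pow_mul_geometric_of_norm_lt_one m
    (r := (1 / 16 : ℝ)) (by norm_num)
  have h1 : Summable fun n : ℕ => (3 : ℝ) ^ m * ((n : ℝ) ^ m * (1 / 16) ^ n) := h.mul_left _
  refine Summable.of_norm_bounded_eventually_nat h1 ?_
  filter_upwards [Filter.eventually_ge_atTop 1] with n hn
  have hn' : (1 : ℝ) ≤ n := by exact_mod_cast hn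
  rw [Real.norm_of_nonneg (by positivity), ← mul_assoc, ← mul_pow]
  gcongr
  rw [← Real.rpow_natCast (3 * (n : ℝ))]
  calc (2 * n + 1 : ℝ) ^ (s + 2) ≤ (2 * n + 1 : ℝ) ^ (m : ℝ) :=
        Real.rpow_le_rpow_of_exponent_le (by linarith) hm
    _ ≤ (3 * n : ℝ) ^ (m : ℝ) := by
        refine Real.rpow_le_rpow (by positivity) (by linarith) (Nat.cast_nonneg _)

theorem tameConst_nonneg (s : ℝ) : 0 ≤ tameConst s := tsum_nonneg fun n => by positivity

theorem tameConst_zero_le {s : ℝ} (hs : 0 ≤ s) : tameConst 0 ≤ tameConst s :=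
  (summable_tameConst 0).tsum_le_tsum (fun n => by
    gcongr
    linarith [(Nat.cast_nonneg n : (0 : ℝ) ≤ n)]) (summable_tameConst s)

section Small

variable {d : ℕ} {χ : ∀ n, HomPoly d (n + 1)} {S : Finset ℕ} {c : ℕ → C(unitInterval, ℝ)}
  {R η h : ℝ}

/-- The vector fields are small on the ball of radius `R`. -/
def FieldsSmall (χ : ∀ n, HomPoly d (n + 1)) (S : Finset ℕ) (R η : ℝ) : Prop :=
  ∀ n ∈ S, 2 * (n + 1) * (χ n).supNorm * R ^ (2 * n) ≤ η * (1 / 16) ^ n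

theorem card_fieldIdx_sub_one (n : ℕ) : Fintype.card (FieldIdx n) - 1 = 2 * n := by
  simp only [Fintype.card_sum, Fintype.card_fin]
  omega

theorem card_fieldIdx_cast (n : ℕ) : ((Fintype.card (FieldIdx n) : ℕ) : ℝ) = 2 * n + 1 := by
  simp only [Fintype.card_sum, Fintype.card_fin]
  push_cast
  ring

/-- The norm of the multilinear map costs (2n+1)^(s+1), and the Lipschitz constant of its
restriction to the diagonal costs one more factor 2n+1: hence the exponent s + 2 in `tameConst`. The
factor 16^(-n) in `FieldsSmall` makes the sum converge for every s. -/
theorem fieldLip_le_of_norm_le {E : Type*} [NormedAddCommGroup E] [NormedSpace ℝ E]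
    [CompleteSpace E] {s : ℝ} {X : ∀ n, ContinuousMultilinearMap ℝ (fun _ : FieldIdx n => E) E}
    (hX : ∀ n ∈ S, ‖X n‖ ≤ 2 * (n + 1) * (χ n).supNorm * (2 * n + 1 : ℝ) ^ (s + 1))
    (hR : 0 ≤ R) (hη : 0 ≤ η) (hh : 0 ≤ h)
    (hsmall : FieldsSmall χ S R η) (hc : ∀ n ∈ S, ‖c n‖ ≤ h) :
    fieldLip S X c R ≤ h * η * tameConst s := by
  rw [tameConst, ← tsum_mul_left]
  refine le_trans (Finset.sum_le_sum fun n hn => ?_)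
    (((summable_tameConst s).mul_left (h * η)).sum_le_tsum S fun n _ => by positivity)
  rw [card_fieldIdx_sub_one, card_fieldIdx_cast]
  have h1 : (0 : ℝ) < 2 * n + 1 := by positivity
  calc ‖c n‖ * ‖X n‖ * (2 * n + 1) * R ^ (2 * n)
      ≤ h * (2 * (n + 1) * (χ n).supNorm * (2 * n + 1 : ℝ) ^ (s + 1)) * (2 * n + 1) *
        R ^ (2 * n) := by
        gcongr
        · exact hc n hn
        · exact hX n hn
    _ = h * (2 * n + 1 : ℝ) ^ (s + 2) * (2 * (n + 1) * (χ n).supNorm * R ^ (2 * n)) := by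
        rw [show s + 2 = s + 1 + 1 by ring, Real.rpow_add_one h1.ne' (s + 1)]
        ring
    _ ≤ h * (2 * n + 1 : ℝ) ^ (s + 2) * (η * (1 / 16) ^ n) :=
        mul_le_mul_of_nonneg_left (hsmall n hn) (by positivity)
    _ = _ := by ring

theorem fieldLip_fieldMap_le (hR : 0 ≤ R) (hη : 0 ≤ η) (hh : 0 ≤ h)
    (hsmall : FieldsSmall χ S R η) (hc : ∀ n ∈ S, ‖c n‖ ≤ h) :
    fieldLip S (fun n => (χ n).fieldMap) c R ≤ h * η * tameConst 0 := by
  refine fieldLip_le_of_norm_le (fun n _ => (χ n).norm_fieldMap_le.trans ?_) hR hη hh hsmall hc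
  refine le_mul_of_one_le_right (χ n).gradBound_nonneg (Real.one_le_rpow ?_ (by norm_num))
  linarith [(Nat.cast_nonneg n : (0 : ℝ) ≤ n)]

theorem fieldLip_fieldMapW_le {δ s : ℝ} (hδ : 0 ≤ δ) (hs : 0 ≤ s) (hR : 0 ≤ R) (hη : 0 ≤ η)
    (hh : 0 ≤ h) (hsmall : FieldsSmall χ S R η) (hc : ∀ n ∈ S, ‖c n‖ ≤ h) :
    fieldLip S (fun n => (χ n).fieldMapW hδ hs) c R ≤ h * η * tameConst s :=
  fieldLip_le_of_norm_le (fun n _ => (χ n).norm_fieldMapW_le hδ hs) hR hη hh hsmall hc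

end Small

/-! ### The spaces `ℓ¹ ∩ H^s` -/

namespace EllOneHs

variable {d : ℕ} {s : ℝ}

theorem snd_apply (x : EllOneHs d s) (k : FreqLattice d) :
    x.1.2 k = ((bracket k ^ s : ℝ) : ℂ) * x.1.1 k := x.2 k

theorem weight_term (x : EllOneHs d s) (k : FreqLattice d) :
    bracket k ^ (2 * s) * ‖x.1.1 k‖ ^ 2 = ‖x.1.2 k‖ ^ 2 := by
  rw [snd_apply, norm_mul, Complex.norm_real, Real.norm_of_nonneg
    (Real.rpow_nonneg (bracket_pos k).le s), mul_pow, ← Real.rpow_natCast (bracket k ^ s),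
    ← Real.rpow_mul (bracket_pos k).le, mul_comm s]
  rfl

theorem memHs (x : EllOneHs d s) : MemHs s x.1.1 := by
  refine (EllTwo.summable_norm_sq x.1.2).congr fun k => ?_
  rw [weight_term]

theorem hsNorm_eq (x : EllOneHs d s) : hsNorm s x.1.1 = ‖x.1.2‖ := by
  rw [hsNorm, tsum_congr (weight_term x), ← EllTwo.norm_sq_eq, Real.sqrt_sq (norm_nonneg _)]

theorem exists_of_memHs {u : EllOne d} (hu : MemHs s u) : ∃ x : EllOneHs d s, x.1.1 = u := by
  refine ⟨⟨(u, ⟨fun k => ((bracket k ^ s : ℝ) : ℂ) * u k, ?_⟩), fun k => rfl⟩, rfl⟩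
  refine memℓp_gen ?_
  refine hu.congr fun k => ?_
  rw [norm_mul, Complex.norm_real, Real.norm_of_nonneg
    (Real.rpow_nonneg (bracket_pos k).le s)]
  simp only [ENNReal.toReal_ofNat, Real.rpow_ofNat]
  rw [mul_pow, ← Real.rpow_natCast (bracket k ^ s),
    ← Real.rpow_mul (bracket_pos k).le, mul_comm s]
  rfl

theorem ext_fst {x y : EllOneHs d s} (h : x.1.1 = y.1.1) : x = y := by
  refine Subtype.ext (Prod.ext h (lp.ext (funext fun k => ?_)))
  rw [snd_apply, snd_apply, h]

theorem snd_eq_zero {x : EllOneHs d s} (h : x.1.2 = 0) : x = 0 := by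
  refine ext_fst (lp.ext (funext fun k => ?_))
  have h1 := snd_apply x k
  rw [h] at h1
  have h2 : ((bracket k ^ s : ℝ) : ℂ) ≠ 0 := by
    exact_mod_cast (Real.rpow_pos_of_pos (bracket_pos k) s).ne'
  exact (mul_eq_zero.1 h1.symm).resolve_left h2

/-- The inclusion in `ℓ¹` as a continuous linear map. -/
def fstCLM (d : ℕ) (s : ℝ) : EllOneHs d s →L[ℝ] EllOne d :=
  (ContinuousLinearMap.fst ℝ (EllOne d) (EllTwo d)).comp (EllOneHs d s).subtypeL

/-- Passage to a weighted space. -/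
def toWeighted (d : ℕ) (δ s : ℝ) : EllOneHs d s →L[ℝ] WSpace (sobWeight d δ s) :=
  (((ContinuousLinearMap.id ℝ (EllOne d)).prodMap
    (δ • ContinuousLinearMap.id ℝ (EllTwo d))).comp (EllOneHs d s).subtypeL).codRestrict _
    fun x k => by
      change ((δ : ℝ) : ℂ) * x.1.2 k = _
      rw [snd_apply, sobWeight]
      push_cast
      exact (mul_assoc _ _ _).symm

theorem toWeighted_fst (δ : ℝ) (x : EllOneHs d s) : (toWeighted d δ s x).1.1 = x.1.1 := rfl

theorem toWeighted_snd (δ : ℝ) (x : EllOneHs d s) : (toWeighted d δ s x).1.2 = δ • x.1.2 := rfl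

/-- Passage from a weighted space. -/
def ofWeighted (d : ℕ) {δ : ℝ} (hδ : 0 < δ) (s : ℝ) :
    WSpace (sobWeight d δ s) →L[ℝ] EllOneHs d s :=
  (((ContinuousLinearMap.id ℝ (EllOne d)).prodMap
    (δ⁻¹ • ContinuousLinearMap.id ℝ (EllTwo d))).comp
      (WSpace (sobWeight d δ s)).subtypeL).codRestrict _ fun x k => by
      change ((δ⁻¹ : ℝ) : ℂ) * x.1.2 k = _
      rw [WSpace.snd_apply, sobWeight]
      have h : ((δ : ℝ) : ℂ) ≠ 0 := by exact_mod_cast hδ.ne'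
      push_cast
      rw [← mul_assoc, ← mul_assoc, inv_mul_cancel₀ h, one_mul]
      rfl

theorem ofWeighted_snd {δ : ℝ} (hδ : 0 < δ) (x : WSpace (sobWeight d δ s)) :
    (ofWeighted d hδ s x).1.2 = δ⁻¹ • x.1.2 := rfl

/-- A weight for which both components of the norm balance. -/
theorem exists_balance (x : EllOneHs d s) : ∃ δ : ℝ, 0 < δ ∧ δ * ‖x.1.2‖ = ‖x.1.1‖ := by
  -- At the origin any positive δ balances, and 1 is taken.
  by_cases hx : x.1.1 = 0
  · have : x = 0 := ext_fst hx
    subst this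
    exact ⟨1, one_pos, by simp⟩
  · have h1 : 0 < ‖x.1.2‖ := by
      refine norm_pos_iff.2 fun h => hx ?_
      rw [snd_eq_zero h]
      rfl
    exact ⟨‖x.1.1‖ / ‖x.1.2‖, div_pos (norm_pos_iff.2 hx) h1, div_mul_cancel₀ _ h1.ne'⟩

theorem norm_toWeighted {δ : ℝ} (hδ : 0 ≤ δ) (x : EllOneHs d s) :
    ‖toWeighted d δ s x‖ = max ‖x.1.1‖ (δ * ‖x.1.2‖) := by
  rw [WSpace.norm_eq, toWeighted_fst, toWeighted_snd, norm_smul, Real.norm_of_nonneg hδ]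

end EllOneHs
end

noncomputable section

/-! ### Time one maps on ℓ¹ ∩ H^s. -/

section Lift

variable {d : ℕ} {χ : ∀ n, HomPoly d (n + 1)} {S : Finset ℕ} {c : ℕ → C(unitInterval, ℝ)}
  {R η h s : ℝ}

/-- Integral curves in `ℓ¹` of the Hamiltonian fields of a family of polynomials. -/
abbrev IsHamCurve (χ : ∀ n, HomPoly d (n + 1)) (S : Finset ℕ) (c : ℕ → C(unitInterval, ℝ))
    (u : EllOne d) (γ : C(unitInterval, EllOne d)) : Prop :=
  IsIntegralCurveFrom S (fun n => (χ n).fieldMap) c u γ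

theorem nonempty_fieldIdx (n : ℕ) : Nonempty (FieldIdx n) := ⟨Sum.inl 0⟩

/-- The time one map of small fields acts smoothly on `ℓ¹ ∩ H^s`. -/
def LiftsAt (s : ℝ) (χ : ∀ n, HomPoly d (n + 1)) (S : Finset ℕ) (c : ℕ → C(unitInterval, ℝ))
    (r K : ℝ) (x₀ : EllOneHs d s) : Prop :=
  ∃ T : EllOneHs d s → EllOneHs d s, ContDiffAt ℝ ∞ T x₀ ∧
    (∀ᶠ x in nhds x₀, ∀ γ, IsHamCurve χ S c x.1.1 γ → ‖γ‖ < r → (T x).1.1 = γ 1) ∧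
    ‖(T x₀).1.2‖ ≤ K * ‖x₀.1.2‖

/-- Evaluation of curves at time one. -/
def evalOne (E : Type*) [NormedAddCommGroup E] [NormedSpace ℝ E] :
    C(unitInterval, E) →L[ℝ] E := ContinuousMap.evalCLM ℝ 1

theorem evalOne_apply {E : Type*} [NormedAddCommGroup E] [NormedSpace ℝ E]
    (γ : C(unitInterval, E)) : evalOne E γ = γ 1 := rfl

/-- Weighted integral curves with their `ℓ¹` projection. -/
theorem IsIntegralCurveFrom.fst {δ : ℝ} (hδ : 0 ≤ δ) (hs : 0 ≤ s)
    {x : WSpace (sobWeight d δ s)} {γ : C(unitInterval, WSpace (sobWeight d δ s))}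
    (hγ : IsIntegralCurveFrom S (fun n => (χ n).fieldMapW hδ hs) c x γ) :
    IsHamCurve χ S c x.1.1 ((WSpace.fstCLM (sobWeight d δ s) : C(WSpace (sobWeight d δ s), EllOne d)).comp γ) :=
  hγ.map (WSpace.fstCLM _) fun _ _ _ => rfl

theorem norm_fst_comp_le {δ : ℝ} (γ : C(unitInterval, WSpace (sobWeight d δ s))) :
    ‖(WSpace.fstCLM (sobWeight d δ s) : C(WSpace (sobWeight d δ s), EllOne d)).comp γ‖ ≤ ‖γ‖ := by
  rw [ContinuousMap.norm_le _ (norm_nonneg γ)]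
  exact fun t => (WSpace.norm_fst_le _).trans (γ.norm_coe_le_norm t)

/-- With δ balanced at `x₀`, the weighted norm of `x₀` is its ℓ¹ norm, so the flow exists in the
weighted space on a ball of the same radius. Uniqueness in ℓ¹ identifies its projection with any
given small curve. The weighted curve has norm at most 2‖x₀‖_{ℓ¹} = 2δ‖x₀‖_{H^s}, and dividing by δ
leaves a bound linear in the H^s norm. -/
theorem liftsAt_of_small (hs : 0 ≤ s) (hR : 0 ≤ R) (hη : 0 ≤ η) (hh : 0 ≤ h)
    (hsmall : FieldsSmall χ S R η) (hsm : h * η * tameConst s ≤ 1 / 4)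
    (hc : ∀ n ∈ S, ‖c n‖ ≤ h) (x₀ : EllOneHs d s) (hx₀ : ‖x₀.1.1‖ < 3 / 4 * R) :
    LiftsAt s χ S c (3 / 4 * R) 2 x₀ := by
  obtain ⟨δ, hδ, hbal⟩ := EllOneHs.exists_balance x₀
  have hLW := (fieldLip_fieldMapW_le hδ.le hs hR hη hh hsmall hc).trans hsm
  have hL : fieldLip S (fun n => (χ n).fieldMap) c R ≤ 1 / 4 :=
    (fieldLip_fieldMap_le hR hη hh hsmall hc).trans
      ((mul_le_mul_of_nonneg_left (tameConst_zero_le hs) (by positivity)).trans hsm)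
  obtain ⟨-, Φ, hΦ, hΦs⟩ := exists_flow (S := S) (X := fun n => (χ n).fieldMapW hδ.le hs) (c := c)
    (fun n _ => nonempty_fieldIdx n) hR (hLW.trans_lt (by norm_num))
  obtain ⟨huniq, -⟩ := exists_flow (S := S) (X := fun n => (χ n).fieldMap) (c := c)
    (fun n _ => nonempty_fieldIdx n) hR (hL.trans_lt (by norm_num))
  set Λ := fieldLip S (fun n => (χ n).fieldMapW hδ.le hs) c R
  have hΛR : 3 / 4 * R ≤ (1 - Λ) * R := mul_le_mul_of_nonneg_right (by linarith) hR
  have hn₀ : ‖EllOneHs.toWeighted d δ s x₀‖ = ‖x₀.1.1‖ := by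
    rw [EllOneHs.norm_toWeighted hδ.le, hbal, max_self]
  have hlt₀ : ‖EllOneHs.toWeighted d δ s x₀‖ < 3 / 4 * R := hn₀.trans_lt hx₀
  refine ⟨fun x => EllOneHs.ofWeighted d hδ s (evalOne _ (Φ (EllOneHs.toWeighted d δ s x))),
    ?_, ?_, ?_⟩
  · have h1 : ContDiffAt ℝ ∞ (fun x => Φ (EllOneHs.toWeighted d δ s x)) x₀ :=
      (hΦs _ (hlt₀.trans_le hΛR)).comp x₀ (EllOneHs.toWeighted d δ s).contDiff.contDiffAt
    exact ((EllOneHs.ofWeighted d hδ s).comp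
      (evalOne (WSpace (sobWeight d δ s)))).contDiff.contDiffAt.comp x₀ h1
  · have hev : ∀ᶠ x in nhds x₀, ‖EllOneHs.toWeighted d δ s x‖ < 3 / 4 * R :=
      (isOpen_lt (EllOneHs.toWeighted d δ s).continuous.norm continuous_const).mem_nhds hlt₀
    filter_upwards [hev] with x hx γ hγ hγR
    obtain ⟨h1, h2, -⟩ := hΦ _ (hx.trans_le hΛR)
    have h3 := h2.fst hδ.le hs
    rw [EllOneHs.toWeighted_fst] at h3
    have h4 := huniq _ _ _ ((norm_fst_comp_le _).trans_lt h1) (hγR.trans_le (by linarith)) h3 hγ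
    exact DFunLike.congr_fun h4 1
  · obtain ⟨-, -, h3⟩ := hΦ _ (hlt₀.trans_le hΛR)
    set γ := Φ (EllOneHs.toWeighted d δ s x₀)
    rw [EllOneHs.ofWeighted_snd, norm_smul, Real.norm_of_nonneg (inv_nonneg.2 hδ.le),
      evalOne_apply, inv_mul_le_iff₀ hδ]
    have h4 : ‖(γ 1).1.2‖ ≤ ‖γ‖ := (WSpace.norm_snd_le _).trans (γ.norm_coe_le_norm 1)
    have h5 : ‖γ‖ ≤ 2 * ‖x₀.1.1‖ := by
      rw [hn₀] at h3
      nlinarith [norm_nonneg γ]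
    rw [← hbal] at h5
    linarith

/-- Affine reparametrizations of the unit interval. -/
def affineTime (a b : ℝ) (h : ∀ t ∈ Set.Icc (0 : ℝ) 1, a + b * t ∈ Set.Icc (0 : ℝ) 1) :
    C(unitInterval, unitInterval) :=
  ⟨fun t => ⟨a + b * t, h t t.2⟩, by fun_prop⟩

theorem norm_comp_le {E : Type*} [NormedAddCommGroup E] (γ : C(unitInterval, E))
    (φ : C(unitInterval, unitInterval)) : ‖γ.comp φ‖ ≤ ‖γ‖ := by
  rw [ContinuousMap.norm_le _ (norm_nonneg γ)]
  exact fun t => γ.norm_coe_le_norm (φ t)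

theorem norm_smul_comp_le {b K : ℝ} (c : C(unitInterval, ℝ)) (φ : C(unitInterval, unitInterval))
    (hc : ‖c‖ ≤ K) : ‖b • c.comp φ‖ ≤ |b| * K := by
  rw [norm_smul, Real.norm_eq_abs]
  gcongr
  exact (norm_comp_le c φ).trans hc

/-- The first half of the unit interval. -/
def leftHalf : C(unitInterval, unitInterval) :=
  affineTime 0 (1 / 2) fun t ht => ⟨by linarith [ht.1], by linarith [ht.2]⟩

/-- The second half of the unit interval. -/
def rightHalf : C(unitInterval, unitInterval) :=
  affineTime (1 / 2) (1 / 2) fun t ht => ⟨by linarith [ht.1], by linarith [ht.2]⟩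

/-- Time reversal. -/
def timeReversal : C(unitInterval, unitInterval) :=
  affineTime 1 (-1) fun t ht => ⟨by linarith [ht.2], by linarith [ht.1]⟩

theorem leftHalf_zero : leftHalf 0 = 0 := Subtype.ext (by simp [leftHalf, affineTime])

theorem leftHalf_one : leftHalf 1 = rightHalf 0 :=
  Subtype.ext (by simp [leftHalf, rightHalf, affineTime])

theorem rightHalf_one : rightHalf 1 = 1 :=
  Subtype.ext (by simp [rightHalf, affineTime]; norm_num)

theorem timeReversal_zero : timeReversal 0 = 1 := Subtype.ext (by simp [timeReversal, affineTime])

theorem timeReversal_one : timeReversal 1 = 0 := Subtype.ext (by simp [timeReversal, affineTime])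

theorem IsIntegralCurveFrom.norm_start_le {E : Type*} [NormedAddCommGroup E] [NormedSpace ℝ E]
    [CompleteSpace E] {α : Type*} {ι : α → Type*} [∀ a, Fintype (ι a)] {S : Finset α}
    {X : ∀ a, ContinuousMultilinearMap ℝ (fun _ : ι a => E) E} {c : α → C(unitInterval, ℝ)}
    {u : E} {γ : C(unitInterval, E)} (h : IsIntegralCurveFrom S X c u γ) : ‖u‖ ≤ ‖γ‖ := by
  rw [← h.apply_zero]
  exact γ.norm_coe_le_norm 0

/-- Fields too large for `s` over the unit time are handled by halving the interval:
reparametrization halves the coefficients, and the lifts over the two halves are composed. No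
smallness is lost in ℓ¹, since the pieces are parts of the given curve `γ₀`, already known to stay
in the ball. -/
theorem liftsAt_of_le (hs : 0 ≤ s) (hR : 0 ≤ R) (hη : 0 ≤ η) (hh : 0 ≤ h)
    (hsmall : FieldsSmall χ S R η) (hsm : h * η * tameConst s ≤ 1 / 4) (k : ℕ) :
    ∀ c : ℕ → C(unitInterval, ℝ), (∀ n ∈ S, ‖c n‖ ≤ 2 ^ k * h) → ∀ (x₀ : EllOneHs d s) γ₀,
      IsHamCurve χ S c x₀.1.1 γ₀ → ‖γ₀‖ < 3 / 4 * R →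
      LiftsAt s χ S c (3 / 4 * R) (2 ^ 2 ^ k) x₀ := by
  induction k with
  | zero =>
    intro c hc x₀ γ₀ hγ₀ hγR
    have := liftsAt_of_small hs hR hη hh hsmall hsm (by simpa using hc) x₀
      (hγ₀.norm_start_le.trans_lt hγR)
    simpa using this
  | succ k ih =>
    intro c hc x₀ γ₀ hγ₀ hγR
    have hleft : ∀ {u γ}, IsHamCurve χ S c u γ →
        IsHamCurve χ S (fun i => (1 / 2 : ℝ) • (c i).comp leftHalf) u (γ.comp leftHalf) := by
      intro u γ hγ
      have := hγ.reparam leftHalf 0 (1 / 2) fun t => rfl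
      rwa [leftHalf_zero, hγ.apply_zero] at this
    have hright : ∀ {u γ}, IsHamCurve χ S c u γ →
        IsHamCurve χ S (fun i => (1 / 2 : ℝ) • (c i).comp rightHalf) (γ (rightHalf 0))
          (γ.comp rightHalf) := fun hγ => hγ.reparam rightHalf (1 / 2) (1 / 2) fun t => rfl
    have hn : ∀ φ : C(unitInterval, unitInterval), ∀ n ∈ S,
        ‖(1 / 2 : ℝ) • (c n).comp φ‖ ≤ 2 ^ k * h := fun φ n hn =>
      (norm_smul_comp_le (c n) φ (hc n hn)).trans (le_of_eq (by
        rw [abs_of_pos (by norm_num), pow_succ]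
        ring))
    obtain ⟨T₁, hT₁, hT₁c, hT₁b⟩ := ih _ (hn leftHalf) x₀ _ (hleft hγ₀)
      ((norm_comp_le _ _).trans_lt hγR)
    have e₀ : (T₁ x₀).1.1 = γ₀ (rightHalf 0) := by
      rw [hT₁c.self_of_nhds _ (hleft hγ₀) ((norm_comp_le _ _).trans_lt hγR),
        ContinuousMap.comp_apply, leftHalf_one]
    obtain ⟨T₂, hT₂, hT₂c, hT₂b⟩ := ih _ (hn rightHalf) (T₁ x₀) (γ₀.comp rightHalf) (by
      rw [e₀]
      exact hright hγ₀) ((norm_comp_le _ _).trans_lt hγR)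
    refine ⟨T₂ ∘ T₁, hT₂.comp x₀ hT₁, ?_, ?_⟩
    · filter_upwards [hT₁c, hT₁.continuousAt.eventually hT₂c] with x hx₁ hx₂ γ hγ hγr
      have e : (T₁ x).1.1 = γ (rightHalf 0) := by
        rw [hx₁ _ (hleft hγ) ((norm_comp_le _ _).trans_lt hγr),
          ContinuousMap.comp_apply, leftHalf_one]
      rw [Function.comp_apply, hx₂ (γ.comp rightHalf) (by
        rw [e]
        exact hright hγ) ((norm_comp_le _ _).trans_lt hγr), ContinuousMap.comp_apply,
        rightHalf_one]
    · refine hT₂b.trans ?_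
      -- Composing the two halves squares the constant, which explains the double exponential.
      rw [show (2 : ℝ) ^ 2 ^ (k + 1) = 2 ^ 2 ^ k * 2 ^ 2 ^ k by rw [← pow_add]; congr 1; ring,
        mul_assoc]
      gcongr

/-- The number of halvings of the time interval needed in `H^s`. -/
def halvings (s : ℝ) : ℕ := ⌈4 * tameConst s⌉₊

/-- The constant in the estimates in `H^s` of the time one maps. -/
def flowConst (s : ℝ) : ℝ := 2 ^ 2 ^ halvings s

theorem liftsAt_of_le_one (hs : 0 ≤ s) (hR : 0 ≤ R) (hη : 0 ≤ η) (hη1 : η ≤ 1)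
    (hsmall : FieldsSmall χ S R η) (hc : ∀ n ∈ S, ‖c n‖ ≤ 1) {x₀ : EllOneHs d s}
    {γ₀ : C(unitInterval, EllOne d)} (hγ₀ : IsHamCurve χ S c x₀.1.1 γ₀) (hγR : ‖γ₀‖ < 3 / 4 * R) :
    LiftsAt s χ S c (3 / 4 * R) (flowConst s) x₀ := by
  have h2 : (0 : ℝ) < 2 ^ halvings s := by positivity
  refine liftsAt_of_le (h := (2 ^ halvings s)⁻¹) hs hR hη (by positivity) hsmall ?_ (halvings s) c
    (fun n hn => by rw [mul_inv_cancel₀ h2.ne']; exact hc n hn) x₀ γ₀ hγ₀ hγR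
  -- The number m of halvings exceeds `4 * tameConst s`, and m ≤ 2^m.
  have h3 : 4 * tameConst s ≤ 2 ^ halvings s := (Nat.le_ceil _).trans
    (by exact_mod_cast (Nat.lt_two_pow_self (n := halvings s)).le)
  rw [mul_assoc, inv_mul_le_iff₀ h2]
  nlinarith [tameConst_nonneg s]

end Lift
end

noncomputable section

/-! ### The symplectic form and the Hessians of polynomials. -/

section Pairing

variable {d : ℕ}

/-- The real pairing as a continuous bilinear map. -/
def realPairingBilin (d : ℕ) : EllOne d →L[ℝ] EllOne d →L[ℝ] ℝ :=
  LinearMap.mkContinuous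
    { toFun := realPairingCLM
      map_add' := fun x x' => ContinuousLinearMap.ext fun y => by
        change realPairing _ _ = realPairing _ _ + realPairing _ _
        rw [realPairing_comm, realPairing_comm x, realPairing_comm x']
        exact (realPairingCLM y).map_add x x'
      map_smul' := fun c x => ContinuousLinearMap.ext fun y => by
        change realPairing _ _ = c * realPairing _ _
        rw [realPairing_comm, realPairing_comm x]
        exact (realPairingCLM y).map_smul c x }
    1 fun x => by
      rw [one_mul]
      exact ContinuousLinearMap.opNorm_le_bound _ (norm_nonneg x) fun y => abs_realPairing_le x y

theorem realPairing_I_I (x y : FreqLattice d → ℂ) :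
    realPairing (Complex.I • x) (Complex.I • y) = realPairing x y := by
  unfold realPairing
  congr 1
  refine tsum_congr fun k => ?_
  simp only [Pi.smul_apply, smul_eq_mul, map_mul, Complex.conj_I]
  linear_combination (-x k * conj (y k)) * Complex.I_sq

theorem realPairing_neg_left (x y : FreqLattice d → ℂ) :
    realPairing (-x) y = -realPairing x y := by
  unfold realPairing
  rw [← Complex.neg_re, ← tsum_neg]
  congr 1
  exact tsum_congr fun k => by simp

theorem HomPoly.hasFDerivAt_grad {n : ℕ} (P : HomPoly d (n + 1)) (u : EllOne d) :
    HasFDerivAt P.grad (fderiv ℝ P.grad u) u :=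
  ((P.gradMap.contDiff_diag (n := ∞)).differentiable (by simp) u).hasFDerivAt

/-- The Hessian of a polynomial is symmetric. -/
theorem HomPoly.realPairing_fderiv_grad_comm {n : ℕ} (P : HomPoly d (n + 1)) (u v w : EllOne d) :
    realPairing (fderiv ℝ P.grad u v) w = realPairing (fderiv ℝ P.grad u w) v :=
  second_derivative_symmetric (f := fun u : EllOne d => P.eval u)
    (f' := fun u => realPairingBilin d (P.grad u))
    (f'' := (realPairingBilin d).comp (fderiv ℝ P.grad u)) P.hasFDerivAt_eval
    ((realPairingBilin d).hasFDerivAt.comp u (P.hasFDerivAt_grad u)) v w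

theorem HomPoly.hasFDerivAt_field {n : ℕ} (P : HomPoly d (n + 1)) (u : EllOne d) :
    HasFDerivAt (fun u => P.fieldMap fun _ => u) (Complex.I • fderiv ℝ P.grad u) u := by
  simp_rw [P.fieldMap_apply]
  exact (P.hasFDerivAt_grad u).const_smul Complex.I

/-- The linearized Hamiltonian fields are infinitesimally symplectic. -/
theorem HomPoly.realPairing_linearized {n : ℕ} (P : HomPoly d (n + 1)) (u v w : EllOne d) :
    realPairing (Complex.I • (v : FreqLattice d → ℂ))
        (Complex.I • (fderiv ℝ P.grad u w : FreqLattice d → ℂ)) +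
      realPairing (Complex.I • (Complex.I • (fderiv ℝ P.grad u v : FreqLattice d → ℂ))) w = 0 := by
  rw [smul_smul, Complex.I_mul_I, neg_one_smul, realPairing_neg_left, realPairing_I_I,
    P.realPairing_fderiv_grad_comm, realPairing_comm]
  ring

end Pairing

/-! ### Calculus along curves and the linearized field. -/

section Calculus

variable {E : Type*} [NormedAddCommGroup E] [NormedSpace ℝ E] [CompleteSpace E]

theorem hasDerivAt_of_eq_primitive {γ g : C(unitInterval, E)} {u : E}
    (h : γ - primitiveCLM E g = constCLM E u) {t : ℝ} (ht : t ∈ Set.Ioo (0 : ℝ) 1) :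
    HasDerivAt (fun τ => γ (Set.projIcc 0 1 zero_le_one τ))
      (g (Set.projIcc 0 1 zero_le_one t)) t := by
  have hc := continuous_comp_projIcc g
  have h1 : HasDerivAt (fun s => u + ∫ τ in (0 : ℝ)..s, g (Set.projIcc 0 1 zero_le_one τ))
      (g (Set.projIcc 0 1 zero_le_one t)) t :=
    (intervalIntegral.integral_hasDerivAt_right (hc.intervalIntegrable _ _)
      (hc.stronglyMeasurableAtFilter _ _) hc.continuousAt).const_add u
  refine h1.congr_of_eventuallyEq ?_
  filter_upwards [Ioo_mem_nhds ht.1 ht.2] with s hs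
  have := DFunLike.congr_fun h (Set.projIcc 0 1 zero_le_one s)
  rw [ContinuousMap.sub_apply, constCLM_apply, sub_eq_iff_eq_add, primitiveCLM_apply] at this
  rw [this, Set.projIcc_of_mem zero_le_one ⟨hs.1.le, hs.2.le⟩]

/-- A function on the unit interval with vanishing derivative takes the same values at the
endpoints. -/
theorem eq_of_hasDerivAt_zero {f : ℝ → ℝ} (hc : ContinuousOn f (Set.Icc 0 1))
    (hd : ∀ t ∈ Set.Ioo (0 : ℝ) 1, HasDerivAt f 0 t) : f 1 = f 0 := by
  obtain ⟨t, -, ht⟩ := exists_hasDerivAt_eq_slope f (fun _ => 0) zero_lt_one hc hd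
  rw [sub_zero, div_one] at ht
  linarith

theorem eq_of_primitive_zero {γ g : C(unitInterval, E)} {u : E}
    (h : γ - primitiveCLM E g = constCLM E u) : γ 0 = u := by
  have := DFunLike.congr_fun h 0
  rw [ContinuousMap.sub_apply, constCLM_apply, sub_eq_iff_eq_add, primitiveCLM_apply] at this
  rw [this]
  simp

variable {α : Type*} {ι : α → Type*} [∀ a, Fintype (ι a)]
  {S : Finset α} {X : ∀ a, ContinuousMultilinearMap ℝ (fun _ : ι a => E) E}
  {c : α → C(unitInterval, ℝ)}

theorem fderiv_timeField_apply (γ δ : C(unitInterval, E)) (t : unitInterval) :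
    fderiv ℝ (timeField S X c) γ δ t =
      ∑ a ∈ S, c a t • fderiv ℝ (fun x => X a fun _ => x) (γ t) (δ t) := by
  have h1 := ((ContinuousMap.evalCLM ℝ t : C(unitInterval, E) →L[ℝ] E).hasFDerivAt).comp γ
    ((contDiff_timeField (S := S) (X := X) (c := c)).differentiable (by simp) γ).hasFDerivAt
  have h2 : HasFDerivAt (fun γ : C(unitInterval, E) => ∑ a ∈ S, c a t • X a fun _ => γ t)
      (∑ a ∈ S, c a t • (fderiv ℝ (fun x => X a fun _ => x) (γ t)).comp
        (ContinuousMap.evalCLM ℝ t : C(unitInterval, E) →L[ℝ] E)) γ := by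
    refine HasFDerivAt.fun_sum fun a _ => HasFDerivAt.const_smul ?_ _
    exact HasFDerivAt.comp γ (g := fun x => X a fun _ => x)
      (((X a).contDiff_diag (n := ∞)).differentiable (by simp) (γ t)).hasFDerivAt
      (ContinuousMap.evalCLM ℝ t : C(unitInterval, E) →L[ℝ] E).hasFDerivAt
  have e : (fun γ : C(unitInterval, E) => ∑ a ∈ S, c a t • X a fun _ => γ t) =
      (ContinuousMap.evalCLM ℝ t : C(unitInterval, E) →L[ℝ] E) ∘ timeField S X c :=
    funext fun γ => (timeField_apply γ t).symm
  rw [e] at h2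
  have h3 := DFunLike.congr_fun (h1.unique h2) δ
  simpa using h3

end Calculus

/-! ### Symplecticity of the flow. -/

section Symplectic

variable {d : ℕ} {χ : ∀ n, HomPoly d (n + 1)} {S : Finset ℕ} {c : ℕ → C(unitInterval, ℝ)}

/-- The derivative of a smooth family of integral curves solves the linearized equation. -/
theorem linearized_of_eventually {Φ : EllOne d → C(unitInterval, EllOne d)} {u : EllOne d}
    (hΦ : DifferentiableAt ℝ Φ u) (hcurve : ∀ᶠ x in nhds u, IsHamCurve χ S c x (Φ x))
    (v : EllOne d) :
    fderiv ℝ Φ u v - primitiveCLM (EllOne d)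
      (fderiv ℝ (timeField S (fun n => (χ n).fieldMap) c) (Φ u) (fderiv ℝ Φ u v)) =
      constCLM (EllOne d) v := by
  have h1 := hΦ.hasFDerivAt
  have h2 := h1.sub ((primitiveCLM (EllOne d)).hasFDerivAt.comp u
    (((contDiff_timeField (S := S) (X := fun n => (χ n).fieldMap) (c := c)).differentiable
      (by simp) (Φ u)).hasFDerivAt.comp u h1))
  have h3 := (constCLM (EllOne d)).hasFDerivAt (x := u)
  have h4 := h2.unique (h3.congr_of_eventuallyEq hcurve)
  exact DFunLike.congr_fun h4 v

/-- The symplectic form is constant along pairs of solutions of the linearized equation. -/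
theorem realPairing_of_linearized {γ x y : C(unitInterval, EllOne d)} {v w : EllOne d}
    (hv : x - primitiveCLM (EllOne d)
      (fderiv ℝ (timeField S (fun n => (χ n).fieldMap) c) γ x) = constCLM (EllOne d) v)
    (hw : y - primitiveCLM (EllOne d)
      (fderiv ℝ (timeField S (fun n => (χ n).fieldMap) c) γ y) = constCLM (EllOne d) w) :
    realPairing (Complex.I • (v : FreqLattice d → ℂ)) w =
      realPairing (Complex.I • (x 1 : FreqLattice d → ℂ)) (y 1) := by
  set mulI : EllOne d →L[ℝ] EllOne d := Complex.I • ContinuousLinearMap.id ℝ (EllOne d)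
  set B : EllOne d →L[ℝ] EllOne d →L[ℝ] ℝ := (realPairingBilin d).comp mulI
  have hB : ∀ a b : EllOne d, B a b = realPairing (Complex.I • (a : FreqLattice d → ℂ)) b :=
    fun a b => rfl
  set p : ℝ → unitInterval := Set.projIcc 0 1 zero_le_one
  -- The derivative of the symplectic form along two linearized solutions is a sum over the
  -- generators. Each summand vanishes by the symmetry of the Hessian, as expressed by
  -- `HomPoly.realPairing_linearized`.
  have hconst := eq_of_hasDerivAt_zero (f := fun t => B (x (p t)) (y (p t))) (by
      refine Continuous.continuousOn ?_
      exact (B.continuous.comp (continuous_comp_projIcc x)).clm_apply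
        (continuous_comp_projIcc y)) (by
      intro t ht
      have h := B.hasDerivAt_of_bilinear (fun _ => hasDerivAt_of_eq_primitive hv ht)
        (fun _ => hasDerivAt_of_eq_primitive hw ht)
      refine h.congr_deriv ?_
      rw [fderiv_timeField_apply, fderiv_timeField_apply]
      simp only [map_sum, map_smul, sum_apply, smul_apply,
        smul_eq_mul]
      rw [← Finset.sum_add_distrib]
      refine Finset.sum_eq_zero fun n _ => ?_
      rw [((χ n).hasFDerivAt_field _).fderiv, ← mul_add, hB, hB]
      simp only [smul_apply, lp.coeFn_smul]
      exact mul_eq_zero_of_right _ ((χ n).realPairing_linearized _ _ _))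
  have p0 : p 0 = 0 := Set.projIcc_left _
  have p1 : p 1 = 1 := Set.projIcc_right _
  simp only [p0, p1, hB] at hconst
  rw [hconst, eq_of_primitive_zero hv, eq_of_primitive_zero hw]

theorem realPairing_fderiv_evalOne {Φ : EllOne d → C(unitInterval, EllOne d)} {u : EllOne d}
    (hΦ : DifferentiableAt ℝ Φ u) (hcurve : ∀ᶠ x in nhds u, IsHamCurve χ S c x (Φ x))
    (v w : EllOne d) :
    realPairing (Complex.I • (v : FreqLattice d → ℂ)) w =
      realPairing (Complex.I • (fderiv ℝ Φ u v 1 : FreqLattice d → ℂ)) (fderiv ℝ Φ u w 1) :=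
  realPairing_of_linearized (linearized_of_eventually hΦ hcurve v)
    (linearized_of_eventually hΦ hcurve w)

end Symplectic
end

noncomputable section

/-! ### The Hamiltonian flow, its regularity and its inverse. -/

section HamFlow

variable {d : ℕ}

/-- `Φ` associates with every small initial value the integral curve of the Hamiltonian fields. -/
structure IsHamFlow (χ : ∀ n, HomPoly d (n + 1)) (S : Finset ℕ) (c : ℕ → C(unitInterval, ℝ))
    (R : ℝ) (Φ : EllOne d → C(unitInterval, EllOne d)) : Prop where
  curve : ∀ u, ‖u‖ < 7 / 8 * R → IsHamCurve χ S c u (Φ u)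
  bound : ∀ u, ‖u‖ < 7 / 8 * R → 7 / 8 * ‖Φ u‖ ≤ ‖u‖
  smooth : ∀ u, ‖u‖ < 7 / 8 * R → ContDiffAt ℝ ∞ Φ u
  unique : ∀ u γ, ‖u‖ < 7 / 8 * R → ‖γ‖ < R → IsHamCurve χ S c u γ → γ = Φ u

variable {χ : ∀ n, HomPoly d (n + 1)} {S : Finset ℕ} {c : ℕ → C(unitInterval, ℝ)} {R η : ℝ}

theorem exists_isHamFlow (hR : 0 ≤ R) (hη : 0 ≤ η) (hη1 : η * tameConst 0 ≤ 1 / 8)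
    (hsmall : FieldsSmall χ S R η) (hc : ∀ n ∈ S, ‖c n‖ ≤ 1) :
    ∃ Φ, IsHamFlow χ S c R Φ := by
  have hL : fieldLip S (fun n => (χ n).fieldMap) c R ≤ 1 / 8 := by
    refine (fieldLip_fieldMap_le hR hη zero_le_one hsmall hc).trans ?_
    rwa [one_mul]
  obtain ⟨huniq, Φ, hΦ, hΦs⟩ := exists_flow (S := S) (X := fun n => (χ n).fieldMap) (c := c)
    (fun n _ => nonempty_fieldIdx n) hR (hL.trans_lt (by norm_num))
  set Λ := fieldLip S (fun n => (χ n).fieldMap) c R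
  have hΛR : 7 / 8 * R ≤ (1 - Λ) * R := mul_le_mul_of_nonneg_right (by linarith) hR
  refine ⟨Φ, fun u hu => (hΦ u (hu.trans_le hΛR)).2.1, fun u hu => ?_,
    fun u hu => hΦs u (hu.trans_le hΛR), fun u γ hu hγ h => ?_⟩
  · exact (mul_le_mul_of_nonneg_right (by linarith) (norm_nonneg _)).trans
      (hΦ u (hu.trans_le hΛR)).2.2
  · exact huniq u _ _ hγ (hΦ u (hu.trans_le hΛR)).1 h (hΦ u (hu.trans_le hΛR)).2.1

namespace IsHamFlow

variable {Φ : EllOne d → C(unitInterval, EllOne d)} {r : ℝ}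

/-- The curve stays within 8/7 of its initial norm, and (8/7)(R/2) < (3/4)R: this is the radius
required for the lifts to H^s. -/
theorem norm_curve_lt (h : IsHamFlow χ S c R Φ) (hr : r ≤ R / 2) {u : EllOne d} (hu : ‖u‖ < r) :
    ‖u‖ < 7 / 8 * R ∧ ‖Φ u‖ < 3 / 4 * R := by
  have hR : 0 < R := by linarith [norm_nonneg u]
  have h1 : ‖u‖ < 7 / 8 * R := by linarith
  exact ⟨h1, by linarith [h.bound u h1]⟩

theorem eventually_curve (h : IsHamFlow χ S c R Φ) {u : EllOne d} (hu : ‖u‖ < 7 / 8 * R) :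
    ∀ᶠ x in nhds u, IsHamCurve χ S c x (Φ x) := by
  have : ∀ᶠ x in nhds u, ‖x‖ < 7 / 8 * R :=
    (isOpen_lt continuous_norm continuous_const).mem_nhds hu
  filter_upwards [this] with x hx using h.curve x hx

theorem contDiffAt_timeOne (h : IsHamFlow χ S c R Φ) {u : EllOne d} (hu : ‖u‖ < 7 / 8 * R) :
    ContDiffAt ℝ ∞ (fun u => Φ u 1) u :=
  (evalOne (EllOne d)).contDiff.contDiffAt.comp u (h.smooth u hu)

theorem contDiffOn_timeOne (h : IsHamFlow χ S c R Φ) (hr : r ≤ R / 2) :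
    ContDiffOn ℝ ∞ (fun u => Φ u 1) (Metric.ball 0 r) := fun _ hu =>
  (h.contDiffAt_timeOne (h.norm_curve_lt hr (mem_ball_zero_iff.1 hu)).1).contDiffWithinAt

theorem isSymplecticOn_timeOne (h : IsHamFlow χ S c R Φ) (hr : r ≤ R / 2) :
    IsSymplecticOn (fun u => Φ u 1) (Metric.ball 0 r) := by
  intro u hu v w
  have hu' := (h.norm_curve_lt hr (mem_ball_zero_iff.1 hu)).1
  have hd : DifferentiableAt ℝ Φ u := (h.smooth u hu').differentiableAt (by simp)
  have e : fderiv ℝ (fun u => Φ u 1) u = (evalOne (EllOne d)).comp (fderiv ℝ Φ u) :=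
    ((evalOne (EllOne d)).hasFDerivAt.comp u hd.hasFDerivAt).fderiv
  rw [e]
  exact realPairing_fderiv_evalOne hd (h.eventually_curve hu') v w

theorem liftsAt (h : IsHamFlow χ S c R Φ) (hη : 0 ≤ η) (hη1 : η ≤ 1)
    (hsmall : FieldsSmall χ S R η) (hc : ∀ n ∈ S, ‖c n‖ ≤ 1) (hr : r ≤ R / 2) {s : ℝ} (hs : 0 ≤ s)
    {x : EllOneHs d s} (hx : ‖x.1.1‖ < r) :
    ∃ T : EllOneHs d s → EllOneHs d s, ContDiffAt ℝ ∞ T x ∧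
      (∀ᶠ y in nhds x, (T y).1.1 = Φ y.1.1 1) ∧ ‖(T x).1.2‖ ≤ flowConst s * ‖x.1.2‖ := by
  have hR : 0 ≤ R := by linarith [norm_nonneg x.1.1]
  obtain ⟨h1, h2⟩ := h.norm_curve_lt hr hx
  obtain ⟨T, hT, hTc, hTb⟩ := liftsAt_of_le_one hs hR hη hη1 hsmall hc (h.curve _ h1) h2
  refine ⟨T, hT, ?_, hTb⟩
  have hev : ∀ᶠ y in nhds x, ‖y.1.1‖ < r :=
    (isOpen_lt (EllOneHs.fstCLM d s).continuous.norm continuous_const).mem_nhds hx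
  filter_upwards [hTc, hev] with y hy hyr
  obtain ⟨h3, h4⟩ := h.norm_curve_lt hr hyr
  exact hy _ (h.curve _ h3) h4

theorem memHs_timeOne (h : IsHamFlow χ S c R Φ) (hη : 0 ≤ η) (hη1 : η ≤ 1)
    (hsmall : FieldsSmall χ S R η) (hc : ∀ n ∈ S, ‖c n‖ ≤ 1) (hr : r ≤ R / 2) {s : ℝ} (hs : 0 ≤ s)
    {u : EllOne d} (hu : ‖u‖ < r) (hus : MemHs s u) :
    MemHs s (Φ u 1) ∧ hsNorm s (Φ u 1) ≤ flowConst s * hsNorm s u := by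
  obtain ⟨x, rfl⟩ := EllOneHs.exists_of_memHs hus
  obtain ⟨T, -, hT, hTb⟩ := h.liftsAt hη hη1 hsmall hc hr hs hu
  rw [← hT.self_of_nhds, EllOneHs.hsNorm_eq, EllOneHs.hsNorm_eq]
  exact ⟨EllOneHs.memHs _, hTb⟩

/-- A point of ℓ¹ ∩ H^s is determined by its ℓ¹ component. A pointwise choice of lifts therefore
agrees near each point with the smooth local lift, although the latter was built with a δ depending
on the point. -/
theorem exists_contDiffOn_lift (h : IsHamFlow χ S c R Φ) (hη : 0 ≤ η) (hη1 : η ≤ 1)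
    (hsmall : FieldsSmall χ S R η) (hc : ∀ n ∈ S, ‖c n‖ ≤ 1) (hr : r ≤ R / 2)
    {s : ℝ} (hs : 0 ≤ s) :
    ∃ T : EllOneHs d s → EllOneHs d s,
      (∀ u : EllOneHs d s, ‖EllOneHs.toEllOne u‖ < r →
        EllOneHs.toEllOne (T u) = Φ (EllOneHs.toEllOne u) 1) ∧
      ContDiffOn ℝ ∞ T {u | ‖EllOneHs.toEllOne u‖ < r} := by
  have hex : ∀ x : EllOneHs d s, ‖x.1.1‖ < r → ∃ y : EllOneHs d s, y.1.1 = Φ x.1.1 1 := by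
    intro x hx
    obtain ⟨T, -, hT, -⟩ := h.liftsAt hη hη1 hsmall hc hr hs hx
    exact ⟨T x, hT.self_of_nhds⟩
  choose! T hT using hex
  refine ⟨T, hT, fun x hx => ?_⟩
  obtain ⟨T', hT'c, hT', -⟩ := h.liftsAt hη hη1 hsmall hc hr hs hx
  refine (hT'c.congr_of_eventuallyEq ?_).contDiffWithinAt
  have hev : ∀ᶠ y in nhds x, ‖y.1.1‖ < r :=
    (isOpen_lt (EllOneHs.fstCLM d s).continuous.norm continuous_const).mem_nhds hx
  filter_upwards [hT', hev] with y hy hyr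
  exact EllOneHs.ext_fst ((hT y hyr).trans hy.symm)

/-- The coefficients of the reversed flow. -/
abbrev _root_.reverseCoeff (c : ℕ → C(unitInterval, ℝ)) (n : ℕ) : C(unitInterval, ℝ) :=
  (-1 : ℝ) • (c n).comp timeReversal

theorem _root_.norm_reverseCoeff_le (hc : ∀ n ∈ S, ‖c n‖ ≤ 1) :
    ∀ n ∈ S, ‖reverseCoeff c n‖ ≤ 1 := fun n hn =>
  (norm_smul_comp_le (c n) timeReversal (hc n hn)).trans (by simp)

theorem _root_.IsIntegralCurveFrom.reverse {u : EllOne d} {γ : C(unitInterval, EllOne d)}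
    (h : IsHamCurve χ S c u γ) :
    IsHamCurve χ S (reverseCoeff c) (γ 1) (γ.comp timeReversal) := by
  have := h.reparam timeReversal 1 (-1) fun t => rfl
  rwa [timeReversal_zero] at this

/-- The reversed flow inverts the flow. -/
theorem leftInverse {Ψ : EllOne d → C(unitInterval, EllOne d)} (h : IsHamFlow χ S c R Φ)
    (h' : IsHamFlow χ S (reverseCoeff c) R Ψ) {u : EllOne d} (hu : ‖u‖ < R / 4) :
    ‖Φ u 1‖ < R / 2 ∧ Ψ (Φ u 1) 1 = u := by
  have hR : 0 < R := by linarith [norm_nonneg u]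
  have hu' : ‖u‖ < 7 / 8 * R := by linarith
  have h1 := h.bound u hu'
  have h2 : ‖Φ u 1‖ ≤ ‖Φ u‖ := (Φ u).norm_coe_le_norm 1
  refine ⟨by linarith, ?_⟩
  -- The curve run backwards solves the reversed equation from `Φ u 1`. Its norm is at most
  -- (8/7)(R/4), hence below R, so uniqueness applies and its endpoint is `u`.
  rw [← h'.unique _ ((Φ u).comp timeReversal) (by linarith)
    ((norm_comp_le _ _).trans_lt (by linarith)) (h.curve u hu').reverse,
    ContinuousMap.comp_apply, timeReversal_one, (h.curve u hu').apply_zero]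

end IsHamFlow

end HamFlow
end

noncomputable section

/-! ### Sums of Poisson brackets of given total order. -/

namespace HomPoly

variable {d q n : ℕ}

instance : Zero (HomPoly d q) :=
  ⟨⟨fun _ _ => 0, fun _ _ => by simp, fun _ _ _ _ => rfl, fun _ _ h => absurd rfl h,
    ⟨0, fun _ _ => by simp⟩⟩⟩

theorem supNorm_zero : (0 : HomPoly d q).supNorm = 0 :=
  le_antisymm (supNorm_le _ fun _ _ => by
    change ‖(0 : ℂ)‖ ≤ 0
    simp) (supNorm_nonneg _)

theorem grad_eq_zero {P : HomPoly d (n + 1)} (h : P.supNorm = 0) (u : EllOne d) :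
    P.grad u = 0 := by
  have := P.norm_grad_le u
  rw [h, mul_zero, zero_mul] at this
  exact norm_le_zero_iff.1 this

theorem field_eq_zero {P : HomPoly d (n + 1)} (h : P.supNorm = 0) (u : EllOne d) :
    P.field u = 0 := by
  rw [field, grad_eq_zero h, smul_zero]

theorem eval_eq_zero {P : HomPoly d q} (h : P.supNorm = 0) (u : EllOne d) : P.eval u = 0 := by
  have := P.abs_eval_le u
  rw [h, zero_mul] at this
  exact abs_nonpos_iff.1 this

theorem eval_eq_of_coeff {P P₁ P₂ : HomPoly d q} {a b : ℝ}
    (h : ∀ k l, P.coeff k l = a * P₁.coeff k l + b * P₂.coeff k l) (u : EllOne d) :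
    P.eval u = a * P₁.eval u + b * P₂.eval u := by
  have hn : ∀ (c : ℝ) (P : HomPoly d q) k l, ‖(c : ℂ) * P.coeff k l‖ ≤ |c| * P.supNorm := by
    intro c P k l
    rw [norm_mul, Complex.norm_real, Real.norm_eq_abs]
    gcongr
    exact P.norm_coeff_le k l
  have e : P.coeff = fun k l => (a * P₁.coeff k l + b * P₂.coeff k l : ℂ) :=
    funext fun k => funext fun l => h k l
  rw [eval_eq_rawEval, eval_eq_rawEval, eval_eq_rawEval, e, rawEval_add (hn a P₁) (hn b P₂),
    rawEval_const_mul, rawEval_const_mul]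
  simp

/-- The raw coefficients of `a P + b ∑ {f_i, g_j}`, the sum running over `i + j = n`. -/
def bracketSumCoeff (P : HomPoly d (n + 1)) (a b : ℝ) (f g : ∀ m, HomPoly d (m + 1))
    (k l : Fin (n + 1) → FreqLattice d) : ℂ :=
  a * P.coeff k l + b * ∑ x : {x // x ∈ Finset.HasAntidiagonal.antidiagonal n},
    bracketArr (f x.1.1) (g x.1.2) (Finset.HasAntidiagonal.mem_antidiagonal.1 x.2) k l

/-- The bound of the coefficients of the sum of the brackets. -/
def bracketBound (n : ℕ) (f g : ℕ → ℝ) : ℝ :=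
  ∑ x ∈ Finset.HasAntidiagonal.antidiagonal n, (2 * ((x.1 : ℝ) + 1) * f x.1) * (2 * ((x.2 : ℝ) + 1) * g x.2)

theorem norm_bracketSumCoeff_le (P : HomPoly d (n + 1)) (a b : ℝ) (f g : ∀ m, HomPoly d (m + 1))
    (k l : Fin (n + 1) → FreqLattice d) :
    ‖bracketSumCoeff P a b f g k l‖ ≤ |a| * P.supNorm +
      |b| * bracketBound n (fun m => (f m).supNorm) fun m => (g m).supNorm := by
  refine norm_add_le_of_le ?_ ?_
  · rw [norm_mul, Complex.norm_real, Real.norm_eq_abs]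
    gcongr
    exact P.norm_coeff_le k l
  · rw [norm_mul, Complex.norm_real, Real.norm_eq_abs, bracketBound,
      ← Finset.sum_coe_sort (Finset.HasAntidiagonal.antidiagonal n)]
    refine mul_le_mul_of_nonneg_left ?_ (abs_nonneg b)
    exact norm_sum_le_of_le _ fun x _ => norm_bracketArr_le _ _ _ _ _

/-- The polynomial `a P + b ∑ {f_i, g_j}`, the sum running over `i + j = n`. -/
def bracketSum (P : HomPoly d (n + 1)) (a b : ℝ) (f g : ∀ m, HomPoly d (m + 1)) :
    HomPoly d (n + 1) :=
  ofRaw (bracketSumCoeff P a b f g) (by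
    intro k l h
    by_contra hkl
    refine h ?_
    rw [bracketSumCoeff]
    have h1 : P.coeff k l = 0 := by
      by_contra h2
      exact hkl (P.zero_momentum k l h2)
    rw [h1, mul_zero, zero_add]
    refine mul_eq_zero_of_right _ (Finset.sum_eq_zero fun x _ => ?_)
    by_contra h2
    exact hkl (bracketArr_momentum _ _ _ _ _ h2)) ⟨_, norm_bracketSumCoeff_le P a b f g⟩

theorem supNorm_bracketSum_le (P : HomPoly d (n + 1)) (a b : ℝ) (f g : ∀ m, HomPoly d (m + 1)) :
    (bracketSum P a b f g).supNorm ≤ |a| * P.supNorm +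
      |b| * bracketBound n (fun m => (f m).supNorm) fun m => (g m).supNorm :=
  supNorm_ofRaw_le _ (norm_bracketSumCoeff_le P a b f g)

/-- The sum of the brackets `{f_i, g_j}` with `i + j = n`, as a function. -/
def bracketEval (n : ℕ) (f g : ∀ m, HomPoly d (m + 1)) (u : EllOne d) : ℝ :=
  ∑ x ∈ Finset.HasAntidiagonal.antidiagonal n, realPairing ((f x.1).grad u) ((g x.2).field u)

theorem eval_bracketSum (P : HomPoly d (n + 1)) (a b : ℝ) (f g : ∀ m, HomPoly d (m + 1))
    (u : EllOne d) :
    (bracketSum P a b f g).eval u = a * P.eval u + b * bracketEval n f g u := by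
  rw [bracketSum, eval_ofRaw]
  have hn : ∀ k l, ‖(a : ℂ) * P.coeff k l‖ ≤ |a| * P.supNorm := by
    intro k l
    rw [norm_mul, Complex.norm_real, Real.norm_eq_abs]
    gcongr
    exact P.norm_coeff_le k l
  have hb : ∀ (x : {x // x ∈ Finset.HasAntidiagonal.antidiagonal n}) k l, ‖bracketArr (f x.1.1) (g x.1.2)
      (Finset.HasAntidiagonal.mem_antidiagonal.1 x.2) k l‖ ≤ _ := fun x k l => norm_bracketArr_le _ _ _ k l
  have hb' : ∀ k l, ‖(b : ℂ) * ∑ x : {x // x ∈ Finset.HasAntidiagonal.antidiagonal n},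
      bracketArr (f x.1.1) (g x.1.2) (Finset.HasAntidiagonal.mem_antidiagonal.1 x.2) k l‖ ≤ _ := fun k l =>
    (norm_mul_le _ _).trans (mul_le_mul_of_nonneg_left
      (norm_sum_le_of_le _ fun x _ => hb x k l) (norm_nonneg _))
  have e := rawEval_add hn hb' u
  rw [rawEval_const_mul, rawEval_const_mul, rawEval_sum Finset.univ hb] at e
  refine (congrArg Complex.re e).trans ?_
  rw [Complex.add_re, Complex.re_ofReal_mul, Complex.re_ofReal_mul, Complex.re_sum,
    bracketEval, ← Finset.sum_coe_sort (Finset.HasAntidiagonal.antidiagonal n)]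
  congr 2
  exact Finset.sum_congr rfl fun x _ => re_rawEval_bracketArr _ _ _ _

end HomPoly

/-! ### Resonant and nonresonant parts -/

section Symbols

variable {d q : ℕ} (freq : FreqLattice d → ℝ)

theorem smallDivisor_swap (k l : Fin q → FreqLattice d) :
    smallDivisor freq l k = conj (smallDivisor freq k l) := by
  simp only [smallDivisor, map_mul, Complex.conj_ofReal, Complex.conj_I, map_ofNat]
  push_cast
  ring

theorem smallDivisor_perm (φ σ : Equiv.Perm (Fin q)) (k l : Fin q → FreqLattice d) :
    smallDivisor freq (fun j => k (φ j)) (fun j => l (σ j)) = smallDivisor freq k l := by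
  rw [smallDivisor, smallDivisor, Equiv.sum_comp φ fun j => freq (k j),
    Equiv.sum_comp σ fun j => freq (l j)]

/-- Multiplication of the coefficients by a function of the small divisors. -/
def HomPoly.mulDivisor (S : HomPoly d q) (m : ℂ → ℂ) (hm : ∀ z, m (conj z) = conj (m z))
    (hb : ∃ b : ℝ, ∀ z, ‖m z‖ ≤ b) : HomPoly d q :=
  S.mulSymbol (fun k l => m (smallDivisor freq k l))
    (fun k l => by rw [smallDivisor_swap, hm])
    (fun φ σ k l => by rw [smallDivisor_perm])
    (hb.imp fun b hb k l => hb _)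

theorem HomPoly.coeff_mulDivisor (S : HomPoly d q) (m : ℂ → ℂ)
    (hm : ∀ z, m (conj z) = conj (m z)) (hb : ∃ b : ℝ, ∀ z, ‖m z‖ ≤ b)
    (k l : Fin q → FreqLattice d) :
    (S.mulDivisor freq m hm hb).coeff k l = m (smallDivisor freq k l) * S.coeff k l := rfl

theorem HomPoly.supNorm_mulDivisor_le (S : HomPoly d q) (m : ℂ → ℂ)
    (hm : ∀ z, m (conj z) = conj (m z)) {b : ℝ} (hb : ∀ z, ‖m z‖ ≤ b) :
    (S.mulDivisor freq m hm ⟨b, hb⟩).supNorm ≤ b * S.supNorm :=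
  HomPoly.supNorm_le _ fun k l => by
    rw [coeff_mulDivisor, norm_mul]
    exact mul_le_mul (hb _) (S.norm_coeff_le k l) (norm_nonneg _) ((norm_nonneg _).trans (hb 0))

end Symbols
end

noncomputable section

/-! ### The recursive construction of the normal form. -/

section Recursion

variable {d p : ℕ}

/-- The polynomials of degree `2n+2` of the normal form construction: the term `W` of the
transported perturbation, the term `Q` of the normal form and the generator `χ`. -/
structure NormalFormTerm (d n : ℕ) where
  W : HomPoly d (n + 1)
  Q : HomPoly d (n + 1)
  χ : HomPoly d (n + 1)

instance {n : ℕ} : Zero (NormalFormTerm d n) := ⟨⟨0, 0, 0⟩⟩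

/-- The symbol which keeps the resonant coefficients below the order `r`. -/
def resonantSymbol (ν : ℝ) (r n : ℕ) (z : ℂ) : ℂ :=
  if n < r ∧ ν ≤ ‖z‖ then 0 else ((n : ℝ)⁻¹ : ℝ)

/-- The symbol which inverts the large divisors below the order `r`. -/
def generatorSymbol (ν : ℝ) (r n : ℕ) (z : ℂ) : ℂ :=
  if n < r ∧ ν ≤ ‖z‖ then -z⁻¹ else 0

/-- The symbol which keeps the coefficients with large divisors below the order `r`. -/
def nonresonantSymbol (ν : ℝ) (r n : ℕ) (z : ℂ) : ℂ :=
  if n < r ∧ ν ≤ ‖z‖ then 1 else 0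

theorem resonantSymbol_conj (ν : ℝ) (r n : ℕ) (z : ℂ) :
    resonantSymbol ν r n (conj z) = conj (resonantSymbol ν r n z) := by
  unfold resonantSymbol
  rw [RCLike.norm_conj]
  split_ifs
  · simp
  · rw [Complex.conj_ofReal]

theorem generatorSymbol_conj (ν : ℝ) (r n : ℕ) (z : ℂ) :
    generatorSymbol ν r n (conj z) = conj (generatorSymbol ν r n z) := by
  unfold generatorSymbol
  rw [RCLike.norm_conj]
  split_ifs <;> simp

theorem nonresonantSymbol_conj (ν : ℝ) (r n : ℕ) (z : ℂ) :
    nonresonantSymbol ν r n (conj z) = conj (nonresonantSymbol ν r n z) := by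
  unfold nonresonantSymbol
  rw [RCLike.norm_conj]
  split_ifs <;> simp

theorem norm_resonantSymbol_le (ν : ℝ) (r n : ℕ) (z : ℂ) :
    ‖resonantSymbol ν r n z‖ ≤ (n : ℝ)⁻¹ := by
  unfold resonantSymbol
  split_ifs
  · rw [norm_zero]
    positivity
  · rw [Complex.norm_real, Real.norm_of_nonneg (by positivity)]

theorem norm_generatorSymbol_le {ν : ℝ} (hν : 0 < ν) (r n : ℕ) (z : ℂ) :
    ‖generatorSymbol ν r n z‖ ≤ if n < r then ν⁻¹ else 0 := by
  unfold generatorSymbol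
  by_cases h : n < r
  · simp only [h, true_and, if_true]
    split_ifs with hz
    · rw [norm_neg, norm_inv]
      exact inv_anti₀ hν hz
    · rw [norm_zero]
      positivity
  · simp [h]

theorem norm_nonresonantSymbol_le (ν : ℝ) (r n : ℕ) (z : ℂ) :
    ‖nonresonantSymbol ν r n z‖ ≤ 1 := by
  unfold nonresonantSymbol
  split_ifs <;> simp

/-- The homogeneous component of degree `2n+2` of a homogeneous polynomial. -/
def HomPoly.component (P : HomPoly d (p + 1)) (n : ℕ) : HomPoly d (n + 1) :=
  if h : n = p then h ▸ P else 0

theorem HomPoly.component_self (P : HomPoly d (p + 1)) : P.component p = P := by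
  simp [component]

theorem HomPoly.component_of_ne (P : HomPoly d (p + 1)) {n : ℕ} (h : n ≠ p) :
    P.component n = 0 := by
  simp [component, h]

/-- The factor in front of the brackets in the transport equation. -/
def transportFactor (p n : ℕ) : ℝ := if p < n then -((n : ℝ) - p)⁻¹ else 0

/-- The new transported term. -/
def stepW (P : HomPoly d (p + 1)) (n : ℕ) (T : ∀ m, NormalFormTerm d m) : HomPoly d (n + 1) :=
  HomPoly.bracketSum (P.component n) 1 (transportFactor p n) (fun m => (T m).W) fun m => (T m).χ

/-- The right hand side of the homological equation. -/
def stepS (P : HomPoly d (p + 1)) (n : ℕ) (T : ∀ m, NormalFormTerm d m) : HomPoly d (n + 1) :=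
  HomPoly.bracketSum (stepW P n T) p (-1) (fun m => (T m).Q) fun m => (T m).χ

variable (freq : FreqLattice d → ℝ) {ν : ℝ} (hν : 0 < ν) (r : ℕ) (P : HomPoly d (p + 1))

/-- One step of the normal form construction. -/
def normalFormStep (n : ℕ) (T : ∀ m, NormalFormTerm d m) : NormalFormTerm d n where
  W := stepW P n T
  Q := (stepS P n T).mulDivisor freq (resonantSymbol ν r n) (resonantSymbol_conj ν r n)
    ⟨_, norm_resonantSymbol_le ν r n⟩
  χ := (stepS P n T).mulDivisor freq (generatorSymbol ν r n) (generatorSymbol_conj ν r n)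
    ⟨_, norm_generatorSymbol_le hν r n⟩

/-- Replacement by zero of the terms of order at least `n`. -/
def truncateTerms (n : ℕ) (T : ∀ m, NormalFormTerm d m) (m : ℕ) : NormalFormTerm d m :=
  if m < n then T m else 0

/-- The terms of the normal form. -/
def normalForm : ∀ n, NormalFormTerm d n
  | n => normalFormStep freq hν r P n fun m => if m < n then normalForm m else 0
  decreasing_by assumption

theorem normalForm_eq (n : ℕ) : normalForm freq hν r P n =
    normalFormStep freq hν r P n (truncateTerms n (normalForm freq hν r P)) := by
  rw [normalForm]
  rfl

/-- The right hand side of the homological equation, for the terms of the normal form. -/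
def normalFormRhs (n : ℕ) : HomPoly d (n + 1) :=
  stepS P n (truncateTerms n (normalForm freq hν r P))

/-- The part of the right hand side which is removed by the normal form. -/
def normalFormRemoved (n : ℕ) : HomPoly d (n + 1) :=
  (normalFormRhs freq hν r P n).mulDivisor freq (nonresonantSymbol ν r n)
    (nonresonantSymbol_conj ν r n) ⟨_, norm_nonresonantSymbol_le ν r n⟩

theorem normalForm_W (n : ℕ) : (normalForm freq hν r P n).W =
    stepW P n (truncateTerms n (normalForm freq hν r P)) := by
  rw [normalForm_eq]
  rfl

theorem normalForm_Q (n : ℕ) : (normalForm freq hν r P n).Q =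
    (normalFormRhs freq hν r P n).mulDivisor freq (resonantSymbol ν r n)
      (resonantSymbol_conj ν r n) ⟨_, norm_resonantSymbol_le ν r n⟩ := by
  rw [normalForm_eq]
  rfl

theorem normalForm_χ (n : ℕ) : (normalForm freq hν r P n).χ =
    (normalFormRhs freq hν r P n).mulDivisor freq (generatorSymbol ν r n)
      (generatorSymbol_conj ν r n) ⟨_, norm_generatorSymbol_le hν r n⟩ := by
  rw [normalForm_eq]
  rfl

theorem supNorm_Q_le (n : ℕ) : (normalForm freq hν r P n).Q.supNorm ≤
    (n : ℝ)⁻¹ * (normalFormRhs freq hν r P n).supNorm := by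
  rw [normalForm_Q]
  exact HomPoly.supNorm_mulDivisor_le _ _ _ _ (norm_resonantSymbol_le ν r n)

theorem supNorm_χ_le (n : ℕ) : (normalForm freq hν r P n).χ.supNorm ≤
    (if n < r then ν⁻¹ else 0) * (normalFormRhs freq hν r P n).supNorm := by
  rw [normalForm_χ]
  exact HomPoly.supNorm_mulDivisor_le _ _ _ _ (norm_generatorSymbol_le hν r n)

theorem supNorm_χ_of_le {n : ℕ} (h : r ≤ n) : (normalForm freq hν r P n).χ.supNorm = 0 := by
  refine le_antisymm ((supNorm_χ_le freq hν r P n).trans (le_of_eq ?_)) (HomPoly.supNorm_nonneg _)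
  rw [if_neg (not_lt.2 h), zero_mul]

/-- The terms of degree two vanish. -/
theorem supNorm_zero_terms (hp : 1 ≤ p) : (normalForm freq hν r P 0).W.supNorm = 0 ∧
    (normalForm freq hν r P 0).Q.supNorm = 0 ∧ (normalForm freq hν r P 0).χ.supNorm = 0 := by
  have hb : ∀ g : ℕ → ℝ, HomPoly.bracketBound 0
      (fun m => (truncateTerms 0 (normalForm freq hν r P) m).W.supNorm) g = 0 := by
    intro g
    refine Finset.sum_eq_zero fun x _ => ?_
    have : (0 : NormalFormTerm d x.1).W.supNorm = 0 := HomPoly.supNorm_zero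
    simp [truncateTerms, this]
  have hb' : ∀ g : ℕ → ℝ, HomPoly.bracketBound 0
      (fun m => (truncateTerms 0 (normalForm freq hν r P) m).Q.supNorm) g = 0 := by
    intro g
    refine Finset.sum_eq_zero fun x _ => ?_
    have : (0 : NormalFormTerm d x.1).Q.supNorm = 0 := HomPoly.supNorm_zero
    simp [truncateTerms, this]
  have hW : (normalForm freq hν r P 0).W.supNorm = 0 := by
    refine le_antisymm ?_ (HomPoly.supNorm_nonneg _)
    rw [normalForm_W]
    refine (HomPoly.supNorm_bracketSum_le _ _ _ _ _).trans (le_of_eq ?_)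
    rw [hb, P.component_of_ne (by omega), HomPoly.supNorm_zero]
    simp
  have hS : (normalFormRhs freq hν r P 0).supNorm = 0 := by
    refine le_antisymm ?_ (HomPoly.supNorm_nonneg _)
    refine (HomPoly.supNorm_bracketSum_le _ _ _ _ _).trans (le_of_eq ?_)
    rw [hb', ← normalForm_W, hW]
    simp
  refine ⟨hW, le_antisymm ?_ (HomPoly.supNorm_nonneg _), le_antisymm ?_ (HomPoly.supNorm_nonneg _)⟩
  · refine (supNorm_Q_le freq hν r P 0).trans (le_of_eq ?_)
    rw [hS, mul_zero]
  · refine (supNorm_χ_le freq hν r P 0).trans (le_of_eq ?_)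
    rw [hS, mul_zero]

/-- In a bracket of total order n, a term of order n can only be paired with one of order zero. As
the terms of order zero vanish, truncating below n in the recursion changes no bracket; the
transport and homological equations thus hold without truncation. -/
theorem truncate_cases {n : ℕ} {x : ℕ × ℕ}
    (hx : x ∈ Finset.HasAntidiagonal.antidiagonal n) :
    (x.1 < n ∧ x.2 < n) ∨ (¬ x.1 < n ∧ x.2 = 0) ∨ (x.1 = 0 ∧ ¬ x.2 < n) := by
  rw [Finset.HasAntidiagonal.mem_antidiagonal] at hx
  omega

/-- Truncation does not change the brackets. -/
theorem bracketBound_truncate {n : ℕ} (T : ∀ m, NormalFormTerm d m)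
    (f : ∀ m, NormalFormTerm d m → HomPoly d (m + 1)) (hf : ∀ m, f m 0 = 0)
    (hf0 : (f 0 (T 0)).supNorm = 0) (hχ0 : (T 0).χ.supNorm = 0) :
    HomPoly.bracketBound n (fun m => (f m (truncateTerms n T m)).supNorm)
      (fun m => (truncateTerms n T m).χ.supNorm) =
    HomPoly.bracketBound n (fun m => (f m (T m)).supNorm) fun m => (T m).χ.supNorm := by
  refine Finset.sum_congr rfl fun x hx => ?_
  have hz : ∀ m, (0 : NormalFormTerm d m).χ.supNorm = 0 := fun m => HomPoly.supNorm_zero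
  have hz' : ∀ m, (f m 0).supNorm = 0 := fun m => by rw [hf, HomPoly.supNorm_zero]
  obtain ⟨a, b⟩ := x
  rcases truncate_cases hx with ⟨h1, h2⟩ | ⟨h1, h2⟩ | ⟨h1, h2⟩
  · simp only at h1 h2
    simp only [truncateTerms, h1, h2, if_true]
  · simp only at h1 h2
    subst h2
    simp only [truncateTerms, h1, if_false, hz', hχ0, mul_zero, zero_mul]
  · simp only at h1 h2
    subst h1
    simp only [truncateTerms, h2, if_false, hz, hf0, mul_zero, zero_mul]

theorem realPairing_zero_left (x : FreqLattice d → ℂ) :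
    realPairing ((0 : EllOne d) : FreqLattice d → ℂ) x = 0 := by
  simp [realPairing]

theorem realPairing_zero_right (x : FreqLattice d → ℂ) :
    realPairing x ((0 : EllOne d) : FreqLattice d → ℂ) = 0 := by
  simp [realPairing]

theorem bracketEval_truncate {n : ℕ} (T : ∀ m, NormalFormTerm d m)
    (f : ∀ m, NormalFormTerm d m → HomPoly d (m + 1)) (hf : ∀ m, f m 0 = 0)
    (hf0 : (f 0 (T 0)).supNorm = 0) (hχ0 : (T 0).χ.supNorm = 0) (u : EllOne d) :
    HomPoly.bracketEval n (fun m => f m (truncateTerms n T m))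
      (fun m => (truncateTerms n T m).χ) u =
    HomPoly.bracketEval n (fun m => f m (T m)) (fun m => (T m).χ) u := by
  refine Finset.sum_congr rfl fun x hx => ?_
  have hz : ∀ m, (0 : NormalFormTerm d m).χ.field u = 0 := fun m =>
    HomPoly.field_eq_zero HomPoly.supNorm_zero u
  have hz' : ∀ m, (f m 0).grad u = 0 := fun m => by
    rw [hf]
    exact HomPoly.grad_eq_zero HomPoly.supNorm_zero u
  have h0 := HomPoly.grad_eq_zero hf0 u
  have h0' := HomPoly.field_eq_zero hχ0 u
  obtain ⟨a, b⟩ := x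
  rcases truncate_cases hx with ⟨h1, h2⟩ | ⟨h1, h2⟩ | ⟨h1, h2⟩
  · simp only at h1 h2
    simp only [truncateTerms, h1, h2, if_true]
  · simp only at h1 h2
    subst h2
    simp only [truncateTerms, h1, if_false, hz', h0', realPairing_zero_left,
      realPairing_zero_right]
  · simp only at h1 h2
    subst h1
    simp only [truncateTerms, h2, if_false, hz, realPairing_zero_left,
      realPairing_zero_right, h0]

variable {P}

theorem supNorm_W_le (hp : 1 ≤ p) (n : ℕ) : (normalForm freq hν r P n).W.supNorm ≤
    (P.component n).supNorm + |transportFactor p n| * HomPoly.bracketBound n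
      (fun m => (normalForm freq hν r P m).W.supNorm)
      fun m => (normalForm freq hν r P m).χ.supNorm := by
  obtain ⟨h1, h2, h3⟩ := supNorm_zero_terms freq hν r P hp
  rw [normalForm_W]
  refine (HomPoly.supNorm_bracketSum_le _ _ _ _ _).trans (le_of_eq ?_)
  rw [abs_one, one_mul, bracketBound_truncate _ (fun m T => T.W) (fun _ => rfl) h1 h3]

theorem supNorm_rhs_le (hp : 1 ≤ p) (n : ℕ) : (normalFormRhs freq hν r P n).supNorm ≤
    p * (normalForm freq hν r P n).W.supNorm + HomPoly.bracketBound n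
      (fun m => (normalForm freq hν r P m).Q.supNorm)
      fun m => (normalForm freq hν r P m).χ.supNorm := by
  obtain ⟨h1, h2, h3⟩ := supNorm_zero_terms freq hν r P hp
  rw [normalFormRhs]
  refine (HomPoly.supNorm_bracketSum_le _ _ _ _ _).trans (le_of_eq ?_)
  rw [abs_neg, abs_one, one_mul, bracketBound_truncate _ (fun m T => T.Q) (fun _ => rfl) h2 h3,
    ← normalForm_W, Nat.abs_cast]

/-- The perturbation is homogeneous of order p and the generators only raise the order. In the
construction this is encoded by a transport factor equal to zero up to order p. -/
theorem supNorm_W_of_lt (hp : 1 ≤ p) {n : ℕ} (h : n < p) :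
    (normalForm freq hν r P n).W.supNorm = 0 := by
  refine le_antisymm ((supNorm_W_le freq hν r hp n).trans (le_of_eq ?_)) (HomPoly.supNorm_nonneg _)
  rw [P.component_of_ne h.ne, HomPoly.supNorm_zero, transportFactor, if_neg (by omega)]
  simp

theorem eval_W_eq (hp : 1 ≤ p) (n : ℕ) (u : EllOne d) :
    (normalForm freq hν r P n).W.eval u = (P.component n).eval u + transportFactor p n *
      HomPoly.bracketEval n (fun m => (normalForm freq hν r P m).W)
        (fun m => (normalForm freq hν r P m).χ) u := by
  obtain ⟨h1, h2, h3⟩ := supNorm_zero_terms freq hν r P hp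
  rw [normalForm_W, stepW, HomPoly.eval_bracketSum, one_mul,
    bracketEval_truncate _ (fun m T => T.W) (fun _ => rfl) h1 h3]

theorem eval_W_self (hp : 1 ≤ p) (u : EllOne d) :
    (normalForm freq hν r P p).W.eval u = P.eval u := by
  rw [eval_W_eq freq hν r hp, P.component_self, transportFactor, if_neg (lt_irrefl p)]
  ring

/-- The transport equation. -/
theorem transport_eq (hp : 1 ≤ p) (n : ℕ) (u : EllOne d) :
    ((n : ℝ) - p) * (normalForm freq hν r P n).W.eval u +
      HomPoly.bracketEval n (fun m => (normalForm freq hν r P m).W)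
        (fun m => (normalForm freq hν r P m).χ) u = 0 := by
  obtain ⟨h1, h2, h3⟩ := supNorm_zero_terms freq hν r P hp
  rcases lt_or_ge p n with h | h
  · have hn : (n : ℝ) - p ≠ 0 := sub_ne_zero.2 (by exact_mod_cast h.ne')
    rw [eval_W_eq freq hν r hp, P.component_of_ne h.ne', transportFactor, if_pos h,
      HomPoly.eval_eq_zero HomPoly.supNorm_zero]
    field_simp
    ring
  -- Up to order p every bracket vanishes: i + j = n ≤ p forces i < p, where W_i = 0, or j = 0,
  -- where χ_j = 0.
  · have hb : HomPoly.bracketEval n (fun m => (normalForm freq hν r P m).W)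
        (fun m => (normalForm freq hν r P m).χ) u = 0 := by
      refine Finset.sum_eq_zero fun x hx => ?_
      rw [Finset.HasAntidiagonal.mem_antidiagonal] at hx
      by_cases hx1 : x.1 < p
      · rw [HomPoly.grad_eq_zero (supNorm_W_of_lt freq hν r hp hx1), realPairing_zero_left]
      · have : x.2 = 0 := by omega
        rw [this, HomPoly.field_eq_zero h3, realPairing_zero_right]
    rw [hb, add_zero]
    rcases h.lt_or_eq with h | h
    · rw [HomPoly.eval_eq_zero (supNorm_W_of_lt freq hν r hp h), mul_zero]
    · rw [h, sub_self, zero_mul]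

/-- Where the divisor is at least ν, hence nonzero, the product of -Ω with the generator symbol -1/Ω
is 1; elsewhere both symbols vanish. Hence the removed part is exactly the bracket of Z₂ with the
generator. -/
theorem coeff_removed (n : ℕ) (k l : Fin (n + 1) → FreqLattice d) :
    (normalFormRemoved freq hν r P n).coeff k l =
      -smallDivisor freq k l * (normalForm freq hν r P n).χ.coeff k l := by
  rw [normalForm_χ, normalFormRemoved, HomPoly.coeff_mulDivisor, HomPoly.coeff_mulDivisor,
    nonresonantSymbol, generatorSymbol]
  split_ifs with h
  · have : smallDivisor freq k l ≠ 0 := norm_pos_iff.1 (hν.trans_le h.2)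
    field_simp
  · ring

/-- The homological equation. -/
theorem homological_eq (hp : 1 ≤ p) {n : ℕ} (hn : 1 ≤ n) (u : EllOne d) :
    n * (normalForm freq hν r P n).Q.eval u + (normalFormRemoved freq hν r P n).eval u +
      HomPoly.bracketEval n (fun m => (normalForm freq hν r P m).Q)
        (fun m => (normalForm freq hν r P m).χ) u =
      p * (normalForm freq hν r P n).W.eval u := by
  obtain ⟨h1, h2, h3⟩ := supNorm_zero_terms freq hν r P hp
  have hS : (normalFormRhs freq hν r P n).eval u = p * (normalForm freq hν r P n).W.eval u -
      HomPoly.bracketEval n (fun m => (normalForm freq hν r P m).Q)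
        (fun m => (normalForm freq hν r P m).χ) u := by
    rw [normalFormRhs, stepS, HomPoly.eval_bracketSum, ← normalForm_W,
      bracketEval_truncate _ (fun m T => T.Q) (fun _ => rfl) h2 h3]
    ring
  have hS' : (normalFormRhs freq hν r P n).eval u =
      n * (normalForm freq hν r P n).Q.eval u +
        (1 : ℝ) * (normalFormRemoved freq hν r P n).eval u := by
    refine HomPoly.eval_eq_of_coeff (fun k l => ?_) u
    rw [normalForm_Q, normalFormRemoved, HomPoly.coeff_mulDivisor, HomPoly.coeff_mulDivisor,
      resonantSymbol, nonresonantSymbol]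
    have hn' : (n : ℂ) ≠ 0 := by exact_mod_cast (by omega : n ≠ 0)
    split_ifs
    · simp
    · push_cast
      field_simp
      simp
  linarith

theorem isResonant_Q {n : ℕ} (hn : n < r) :
    (normalForm freq hν r P n).Q.IsResonant freq ν := by
  intro k l h
  rw [normalForm_Q, HomPoly.coeff_mulDivisor, resonantSymbol, if_pos ⟨hn, h⟩, zero_mul]

end Recursion
end

noncomputable section

/-! ### Growth of the coefficients. -/

section Numerics

open Finset.HasAntidiagonal

/-- Since the terms of order zero vanish, both indices start at 1. The shift turns each degree
factor 2(i+2) into at most 4(i+1), hence 16. -/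
theorem bracketBound_le_sum {f g : ℕ → ℝ} (hf : ∀ n, 0 ≤ f n) (hg : ∀ n, 0 ≤ g n) (hf0 : f 0 = 0)
    (hg0 : g 0 = 0) (N : ℕ) : HomPoly.bracketBound (N + 2) f g ≤
      ∑ x ∈ antidiagonal N, 16 * (((x.1 : ℝ) + 1) * f (x.1 + 1)) *
        (((x.2 : ℝ) + 1) * g (x.2 + 1)) := by
  rw [HomPoly.bracketBound, Finset.Nat.sum_antidiagonal_succ, Finset.Nat.sum_antidiagonal_succ']
  simp only [hf0, hg0, mul_zero, zero_mul, zero_add]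
  refine Finset.sum_le_sum fun x _ => ?_
  have h1 : (2 * (((x.1 + 1 : ℕ) : ℝ) + 1)) ≤ 4 * ((x.1 : ℝ) + 1) := by
    push_cast
    linarith [(Nat.cast_nonneg x.1 : (0 : ℝ) ≤ x.1)]
  have h2 : (2 * (((x.2 + 1 : ℕ) : ℝ) + 1)) ≤ 4 * ((x.2 : ℝ) + 1) := by
    push_cast
    linarith [(Nat.cast_nonneg x.2 : (0 : ℝ) ≤ x.2)]
  calc _ ≤ (4 * ((x.1 : ℝ) + 1) * f (x.1 + 1)) * (4 * ((x.2 : ℝ) + 1) * g (x.2 + 1)) := by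
        have := hf (x.1 + 1)
        have := hg (x.2 + 1)
        gcongr
    _ = _ := by ring

theorem bracketBound_one {f g : ℕ → ℝ} (hf0 : f 0 = 0) (hg0 : g 0 = 0) :
    HomPoly.bracketBound 1 f g = 0 := by
  rw [HomPoly.bracketBound, Finset.Nat.sum_antidiagonal_succ]
  simp [hf0, hg0]

theorem factorial_succ_mul_le (a b : ℕ) :
    (a + 1).factorial * (b + 1).factorial ≤ (a + b + 1).factorial := by
  induction b with
  | zero => simp
  | succ b ih =>
    rw [Nat.factorial_succ (b + 1), ← add_assoc, Nat.factorial_succ (a + b + 1)]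
    calc (a + 1).factorial * ((b + 1 + 1) * (b + 1).factorial)
        = (b + 1 + 1) * ((a + 1).factorial * (b + 1).factorial) := by ring
      _ ≤ _ := Nat.mul_le_mul (by omega) ih

theorem factorial_mul_le (a b : ℕ) : a.factorial * b.factorial ≤ (a + b).factorial :=
  Nat.le_of_dvd (Nat.factorial_pos _) (Nat.factorial_mul_factorial_dvd_factorial_add a b)

/-- With a + b = N, (a+1)!(b+1)! ≤ (N+1)! and a! b! ≤ N!, so each of the N + 1 terms is at most
(N+1)! N!. Squared factorials are thus stable under the convolution of the brackets, degree factors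
included. -/
theorem sum_antidiagonal_factorial_le (N : ℕ) :
    ∑ x ∈ antidiagonal N, (((x.1 : ℝ) + 1) * (x.1.factorial : ℝ) ^ 2) *
      (((x.2 : ℝ) + 1) * (x.2.factorial : ℝ) ^ 2) ≤ ((N + 1).factorial : ℝ) ^ 2 := by
  have h : ∀ x ∈ antidiagonal N, (((x.1 : ℝ) + 1) * (x.1.factorial : ℝ) ^ 2) *
      (((x.2 : ℝ) + 1) * (x.2.factorial : ℝ) ^ 2) ≤ ((N + 1).factorial : ℝ) * N.factorial := by
    intro x hx
    rw [mem_antidiagonal] at hx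
    have h1 := factorial_succ_mul_le x.1 x.2
    have h2 := factorial_mul_le x.1 x.2
    rw [hx] at h1 h2
    have h3 := Nat.mul_le_mul h1 h2
    rw [Nat.factorial_succ x.1, Nat.factorial_succ x.2] at h3
    have h4 : (((x.1 + 1) * x.1.factorial * ((x.2 + 1) * x.2.factorial) *
      (x.1.factorial * x.2.factorial) : ℕ) : ℝ) ≤ ((N + 1).factorial * N.factorial : ℕ) := by
      exact_mod_cast h3
    push_cast at h4 ⊢
    linarith
  refine (Finset.sum_le_card_nsmul _ _ _ h).trans (le_of_eq ?_)
  rw [Finset.Nat.card_antidiagonal, nsmul_eq_mul, Nat.factorial_succ]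
  push_cast
  ring

theorem sum_range_succ_div_two_pow (n : ℕ) :
    ∑ j ∈ Finset.range n, ((j : ℝ) + 1) * (1 / 2) ^ j = 4 - (2 * n + 4) * (1 / 2) ^ n := by
  induction n with
  | zero => norm_num
  | succ n ih =>
    rw [Finset.sum_range_succ, ih, pow_succ]
    push_cast
    ring

/-- The factor of the first index is at most N + 2, and the other series is at most 4. The growth is
linear in N, which a division by the order can absorb. -/
theorem sum_antidiagonal_half_pow_le (N : ℕ) :
    ∑ x ∈ antidiagonal N, ((x.1 : ℝ) + 1) * (((x.2 : ℝ) + 1) * (1 / 2) ^ x.2) ≤ 4 * (N + 2) := by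
  calc ∑ x ∈ antidiagonal N, ((x.1 : ℝ) + 1) * (((x.2 : ℝ) + 1) * (1 / 2) ^ x.2)
      ≤ ∑ x ∈ antidiagonal N, ((N : ℝ) + 2) * (((x.2 : ℝ) + 1) * (1 / 2) ^ x.2) := by
        refine Finset.sum_le_sum fun x hx => ?_
        rw [mem_antidiagonal] at hx
        have : (x.1 : ℝ) ≤ N := by exact_mod_cast (by omega : x.1 ≤ N)
        gcongr
        norm_num
    _ = (N + 2) * ∑ j ∈ Finset.range (N + 1), ((j : ℝ) + 1) * (1 / 2) ^ j := by
        rw [← Finset.mul_sum]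
        congr 1
        rw [← Finset.Nat.sum_antidiagonal_swap]
        exact Finset.Nat.sum_antidiagonal_eq_sum_range_succ_mk
          (fun x : ℕ × ℕ => ((x.1 : ℝ) + 1) * (1 / 2) ^ x.1) N
    _ ≤ (N + 2) * 4 := by
        rw [sum_range_succ_div_two_pow]
        have : (0 : ℝ) ≤ (2 * (N + 1 : ℕ) + 4) * (1 / 2) ^ (N + 1) := by positivity
        gcongr
        linarith
    _ = _ := by ring

/-- The inequalities satisfied by the norms of the terms of the normal form. -/
structure NormRecursion (p r : ℕ) (ν a : ℝ) (w q x σ : ℕ → ℝ) : Prop where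
  w_nonneg : ∀ n, 0 ≤ w n
  q_nonneg : ∀ n, 0 ≤ q n
  x_nonneg : ∀ n, 0 ≤ x n
  w_zero : w 0 = 0
  q_zero : q 0 = 0
  x_zero : x 0 = 0
  w_le : ∀ n, w n ≤ (if n = p then a else 0) + |transportFactor p n| * HomPoly.bracketBound n w x
  σ_le : ∀ n, σ n ≤ p * w n + HomPoly.bracketBound n q x
  q_le : ∀ n, q n ≤ (n : ℝ)⁻¹ * σ n
  x_le : ∀ n, x n ≤ (if n < r then ν⁻¹ else 0) * σ n

namespace NormRecursion

variable {p r : ℕ} {ν a M D : ℝ} {w q x σ : ℕ → ℝ}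

/-- Below order p nothing is present and at order p only the initial perturbation is, so any bound
above `M` need only be checked against the brackets beyond order p. -/
theorem w_le_of_bracketBound_le (h : NormRecursion p r ν a w q x σ) (haM : a ≤ M) (hM : 0 ≤ M)
    {n : ℕ} {b : ℝ} (hMb : M ≤ b)
    (hb : p < n → ((n : ℝ) - p)⁻¹ * HomPoly.bracketBound n w x ≤ b) : w n ≤ b := by
  refine (h.w_le n).trans ?_
  unfold transportFactor
  rcases lt_trichotomy n p with h1 | h1 | h1
  · rw [if_neg h1.ne, if_neg (by omega)]
    simpa using hM.trans hMb
  · rw [if_pos h1, if_neg (by omega)]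
    simpa using haM.trans hMb
  · have h2 : (0 : ℝ) < (n : ℝ) - p := sub_pos.2 (by exact_mod_cast h1)
    rw [if_neg h1.ne', if_pos h1, zero_add, abs_neg, abs_of_pos (inv_pos.2 h2)]
    exact hb h1

/-- Induction on the order, shifted by one because order zero is trivial. A bracket with a generator
costs at most 16(p+1)²M/ν times the convolution of squared factorials, and `D / ν` is chosen to
absorb this. Here the division by n - p is only used as division by a number at least 1. -/
theorem factorial_bounds (h : NormRecursion p r ν a w q x σ) (hν : 0 < ν) (hν1 : ν < 1)
    (haM : a ≤ M) (hM : 1 ≤ M) (hD : D = 64 * (p + 1) ^ 2 * M) (N : ℕ) :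
    w (N + 1) ≤ M * (D / ν) ^ N * (N.factorial : ℝ) ^ 2 ∧
    σ (N + 1) ≤ (p + 1) * M * (D / ν) ^ N * (N.factorial : ℝ) ^ 2 := by
  have hp0 : (0 : ℝ) ≤ p := Nat.cast_nonneg p
  have hM0 : 0 < M := by linarith
  have hD0 : 0 < D := by rw [hD]; positivity
  have hD1 : 1 ≤ D := by
    rw [hD]
    nlinarith [mul_nonneg hp0 hp0]
  have hDν : 1 ≤ D / ν := by
    rw [le_div_iff₀ hν]
    linarith
  have hq' : ∀ N, σ (N + 1) ≤ (p + 1) * M * (D / ν) ^ N * (N.factorial : ℝ) ^ 2 →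
      q (N + 1) ≤ (p + 1) * M * (D / ν) ^ N * (N.factorial : ℝ) ^ 2 := by
    intro N hN
    refine (h.q_le _).trans ?_
    have h1 : (((N + 1 : ℕ) : ℝ))⁻¹ ≤ 1 := inv_le_one_of_one_le₀ (by push_cast; linarith [(Nat.cast_nonneg N : (0 : ℝ) ≤ N)])
    calc (((N + 1 : ℕ) : ℝ))⁻¹ * σ (N + 1) ≤ (((N + 1 : ℕ) : ℝ))⁻¹ *
          ((p + 1) * M * (D / ν) ^ N * (N.factorial : ℝ) ^ 2) := by gcongr
      _ ≤ 1 * ((p + 1) * M * (D / ν) ^ N * (N.factorial : ℝ) ^ 2) := by gcongr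
      _ = _ := one_mul _
  have hx' : ∀ N, σ (N + 1) ≤ (p + 1) * M * (D / ν) ^ N * (N.factorial : ℝ) ^ 2 →
      x (N + 1) ≤ (p + 1) * (M / ν) * (D / ν) ^ N * (N.factorial : ℝ) ^ 2 := by
    intro N hN
    refine (h.x_le _).trans ?_
    split_ifs
    · calc ν⁻¹ * σ (N + 1) ≤ ν⁻¹ * ((p + 1) * M * (D / ν) ^ N * (N.factorial : ℝ) ^ 2) := by gcongr
        _ = _ := by ring
    · rw [zero_mul]
      positivity
  induction N using Nat.strong_induction_on with
  | _ N ih =>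
  have hone : M ≤ M * (D / ν) ^ N * (N.factorial : ℝ) ^ 2 := by
    have h1 : (1 : ℝ) ≤ (D / ν) ^ N := one_le_pow₀ hDν
    have h2 : (1 : ℝ) ≤ (N.factorial : ℝ) ^ 2 :=
      one_le_pow₀ (by exact_mod_cast N.factorial_pos)
    rw [mul_assoc]
    exact le_mul_of_one_le_right hM0.le (one_le_mul_of_one_le_of_one_le h1 h2)
  rcases N with _ | K
  · have hw : w 1 ≤ M := by
      refine h.w_le_of_bracketBound_le haM hM0.le le_rfl fun _ => ?_
      rw [bracketBound_one h.w_zero h.x_zero, mul_zero]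
      exact hM0.le
    have hσ : σ 1 ≤ (p + 1) * M := by
      refine (h.σ_le 1).trans ?_
      rw [bracketBound_one h.q_zero h.x_zero, add_zero]
      nlinarith
    simpa using ⟨hw, hσ⟩
  · have key : ∀ (f : ℕ → ℝ) (A : ℝ), 0 ≤ A → (∀ n, 0 ≤ f n) → f 0 = 0 →
        (∀ i ≤ K, f (i + 1) ≤ A * (D / ν) ^ i * (i.factorial : ℝ) ^ 2) →
        HomPoly.bracketBound (K + 2) f x ≤ 16 * (A * ((p + 1) * (M / ν))) * (D / ν) ^ K *
          ((K + 1).factorial : ℝ) ^ 2 := by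
      intro f A hA hf hf0 hfb
      refine (bracketBound_le_sum hf h.x_nonneg hf0 h.x_zero K).trans ?_
      have hc : 0 ≤ 16 * (A * ((p + 1) * (M / ν))) * (D / ν) ^ K := by positivity
      refine le_trans ?_ (mul_le_mul_of_nonneg_left (sum_antidiagonal_factorial_le K) hc)
      rw [Finset.mul_sum]
      refine Finset.sum_le_sum fun y hy => ?_
      rw [mem_antidiagonal] at hy
      have h1 := hfb y.1 (by omega)
      have h2 := hx' y.2 (ih y.2 (by omega)).2
      have h3 := h.x_nonneg (y.2 + 1)
      calc 16 * (((y.1 : ℝ) + 1) * f (y.1 + 1)) * (((y.2 : ℝ) + 1) * x (y.2 + 1))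
          ≤ 16 * (((y.1 : ℝ) + 1) * (A * (D / ν) ^ y.1 * (y.1.factorial : ℝ) ^ 2)) *
            (((y.2 : ℝ) + 1) * ((p + 1) * (M / ν) * (D / ν) ^ y.2 * (y.2.factorial : ℝ) ^ 2)) := by
            gcongr
        _ = 16 * (A * ((p + 1) * (M / ν))) * ((D / ν) ^ y.1 * (D / ν) ^ y.2) *
            ((((y.1 : ℝ) + 1) * (y.1.factorial : ℝ) ^ 2) *
              (((y.2 : ℝ) + 1) * (y.2.factorial : ℝ) ^ 2)) := by ring
        _ = _ := by rw [← pow_add, hy]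
    have hwb := key w M hM0.le h.w_nonneg h.w_zero fun i hi => (ih i (by omega)).1
    have hqb := key q ((p + 1) * M) (by positivity) h.q_nonneg h.q_zero fun i hi =>
      hq' i (ih i (by omega)).2
    have hw : w (K + 1 + 1) ≤ M * (D / ν) ^ (K + 1) * ((K + 1).factorial : ℝ) ^ 2 := by
      refine h.w_le_of_bracketBound_le haM hM0.le hone fun hpn => ?_
      have h1 : (1 : ℝ) ≤ ((K + 1 + 1 : ℕ) : ℝ) - p := by
        have : (p : ℝ) + 1 ≤ ((K + 1 + 1 : ℕ) : ℝ) := by exact_mod_cast hpn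
        linarith
      have h0 : 0 ≤ HomPoly.bracketBound (K + 2) w x := Finset.sum_nonneg fun y _ => by
        have := h.w_nonneg y.1
        have := h.x_nonneg y.2
        positivity
      calc (((K + 1 + 1 : ℕ) : ℝ) - p)⁻¹ * HomPoly.bracketBound (K + 2) w x
          ≤ 1 * HomPoly.bracketBound (K + 2) w x := by
            gcongr
            exact inv_le_one_of_one_le₀ h1
        _ ≤ 16 * (M * ((p + 1) * (M / ν))) * (D / ν) ^ K * ((K + 1).factorial : ℝ) ^ 2 := by
            rw [one_mul]; exact hwb
        _ ≤ (M * (D / ν)) * (D / ν) ^ K * ((K + 1).factorial : ℝ) ^ 2 := by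
            refine mul_le_mul_of_nonneg_right (mul_le_mul_of_nonneg_right ?_ (by positivity))
              (by positivity)
            rw [hD]
            calc 16 * (M * ((p + 1) * (M / ν))) = M * (16 * (p + 1) * 1 * M / ν) := by ring
              _ ≤ M * (64 * (p + 1) * (p + 1) * M / ν) := by
                gcongr <;> linarith
              _ = _ := by ring
        _ = _ := by ring
    refine ⟨hw, ?_⟩
    calc σ (K + 1 + 1) ≤ p * w (K + 1 + 1) + HomPoly.bracketBound (K + 2) q x := h.σ_le _
      _ ≤ p * (M * (D / ν) ^ (K + 1) * ((K + 1).factorial : ℝ) ^ 2) +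
          16 * ((p + 1) * M * ((p + 1) * (M / ν))) * (D / ν) ^ K *
            ((K + 1).factorial : ℝ) ^ 2 := by gcongr
      _ ≤ p * (M * (D / ν) ^ (K + 1) * ((K + 1).factorial : ℝ) ^ 2) +
          (M * (D / ν)) * (D / ν) ^ K * ((K + 1).factorial : ℝ) ^ 2 := by
            refine add_le_add le_rfl (mul_le_mul_of_nonneg_right (mul_le_mul_of_nonneg_right ?_
              (by positivity)) (by positivity))
            rw [hD]
            calc 16 * ((p + 1) * M * ((p + 1) * (M / ν))) = 16 * (M * ((p + 1) ^ 2 * M / ν)) := by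
                  ring
              _ ≤ 64 * (M * ((p + 1) ^ 2 * M / ν)) := by gcongr; norm_num
              _ = _ := by ring
      _ = _ := by ring

theorem q_le_factorial (h : NormRecursion p r ν a w q x σ) (hν : 0 < ν) (hν1 : ν < 1)
    (haM : a ≤ M) (hM : 1 ≤ M) (hD : D = 64 * (p + 1) ^ 2 * M) (N : ℕ) :
    q (N + 1) ≤ (p + 1) * M * (D / ν) ^ N * (N.factorial : ℝ) ^ 2 := by
  have hN := (h.factorial_bounds hν hν1 haM hM hD N).2
  refine (h.q_le _).trans ?_
  have h1 : (((N + 1 : ℕ) : ℝ))⁻¹ ≤ 1 := inv_le_one_of_one_le₀ (by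
    push_cast
    linarith [(Nat.cast_nonneg N : (0 : ℝ) ≤ N)])
  have hD0 : 0 < D := by rw [hD]; positivity
  calc (((N + 1 : ℕ) : ℝ))⁻¹ * σ (N + 1) ≤ (((N + 1 : ℕ) : ℝ))⁻¹ *
        ((p + 1) * M * (D / ν) ^ N * (N.factorial : ℝ) ^ 2) := by gcongr
    _ ≤ 1 * ((p + 1) * M * (D / ν) ^ N * (N.factorial : ℝ) ^ 2) := by gcongr
    _ = _ := one_mul _

/-- Generators vanish from order r on; for the others N < r, so N! ≤ r^N. Factorial growth thereby
becomes geometric, uniformly in the order. -/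
theorem x_le_pow (h : NormRecursion p r ν a w q x σ) (hν : 0 < ν) (hν1 : ν < 1)
    (haM : a ≤ M) (hM : 1 ≤ M) (hD : D = 64 * (p + 1) ^ 2 * M) (N : ℕ) :
    x (N + 1) ≤ (p + 1) * (M / ν) * (D * r ^ 2 / ν) ^ N := by
  have hD0 : 0 < D := by rw [hD]; positivity
  refine (h.x_le _).trans ?_
  split_ifs with hN
  · have h1 := (h.factorial_bounds hν hν1 haM hM hD N).2
    have h2 : (N.factorial : ℝ) ≤ (r : ℝ) ^ N := by
      exact_mod_cast (Nat.factorial_le_pow N).trans (Nat.pow_le_pow_left (by omega) N)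
    calc ν⁻¹ * σ (N + 1) ≤ ν⁻¹ * ((p + 1) * M * (D / ν) ^ N * (N.factorial : ℝ) ^ 2) := by gcongr
      _ ≤ ν⁻¹ * ((p + 1) * M * (D / ν) ^ N * ((r : ℝ) ^ N) ^ 2) := by gcongr
      _ = (p + 1) * (M / ν) * ((D / ν) ^ N * ((r : ℝ) ^ 2) ^ N) := by ring
      _ = _ := by rw [← mul_pow]; congr 2; ring
  · rw [zero_mul]
    positivity

/-- The rate `B` is twice that of the generators, so relative to B^j the generators decay like
2^(-j) and the convolution in a bracket grows only linearly in the order. This linear factor is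
cancelled by the division by n for `q`, and by n - p for `w`. The result is geometric growth at all
orders, including those beyond r, where factorials would make the series diverge. -/
theorem pow_bounds (h : NormRecursion p r ν a w q x σ) (hν : 0 < ν) (hν1 : ν < 1) (hr : 1 ≤ r)
    (haM : a ≤ M) (hM : 1 ≤ M) (hD : D = 64 * (p + 1) ^ 2 * M) (N : ℕ) :
    w (N + 1) ≤ M * (2 * D * r ^ 2 / ν) ^ N ∧
      q (N + 1) ≤ (p + 1) * M * (2 * D * r ^ 2 / ν) ^ N := by
  have hp0 : (0 : ℝ) ≤ p := Nat.cast_nonneg p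
  have hM0 : 0 < M := by linarith
  have hD0 : 0 < D := by rw [hD]; positivity
  have hr1 : (1 : ℝ) ≤ r := by exact_mod_cast hr
  have hr2 : (1 : ℝ) ≤ (r : ℝ) ^ 2 := one_le_pow₀ hr1
  have hD1 : 1 ≤ D := by
    rw [hD]
    nlinarith [mul_nonneg hp0 hp0]
  set B := 2 * D * r ^ 2 / ν with hB
  have hDB : D / ν ≤ B := by
    rw [hB]
    gcongr
    nlinarith
  have hB1 : 1 ≤ B := by
    refine le_trans ?_ hDB
    rw [le_div_iff₀ hν]
    linarith
  have hx' : ∀ N, x (N + 1) ≤ (p + 1) * (M / ν) * (B ^ N * (1 / 2) ^ N) := by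
    intro N
    refine (h.x_le_pow hν hν1 haM hM hD N).trans (le_of_eq ?_)
    rw [← mul_pow, hB]
    congr 2
    ring
  induction N using Nat.strong_induction_on with
  | _ N ih =>
  have hone : M ≤ M * B ^ N := le_mul_of_one_le_right hM0.le (one_le_pow₀ hB1)
  rcases N with _ | K
  · have hw : w 1 ≤ M := by
      refine h.w_le_of_bracketBound_le haM hM0.le le_rfl fun _ => ?_
      rw [bracketBound_one h.w_zero h.x_zero, mul_zero]
      exact hM0.le
    have hq : q 1 ≤ (p + 1) * M := by
      refine (h.q_le 1).trans ?_
      have := h.σ_le 1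
      rw [bracketBound_one h.q_zero h.x_zero, add_zero] at this
      rw [Nat.cast_one, inv_one, one_mul]
      nlinarith
    simpa using ⟨hw, hq⟩
  · have key : ∀ (f : ℕ → ℝ) (A : ℝ), 0 ≤ A → (∀ n, 0 ≤ f n) → f 0 = 0 →
        (∀ i ≤ K, f (i + 1) ≤ A * B ^ i) →
        HomPoly.bracketBound (K + 2) f x ≤ (K + 2) * (64 * (A * ((p + 1) * (M / ν))) * B ^ K) := by
      intro f A hA hf hf0 hfb
      refine (bracketBound_le_sum hf h.x_nonneg hf0 h.x_zero K).trans ?_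
      have e : (K + 2) * (64 * (A * ((p + 1) * (M / ν))) * B ^ K) =
          (16 * (A * ((p + 1) * (M / ν))) * B ^ K) * (4 * (K + 2)) := by ring
      rw [e]
      have hc : 0 ≤ 16 * (A * ((p + 1) * (M / ν))) * B ^ K := by positivity
      refine le_trans ?_ (mul_le_mul_of_nonneg_left (sum_antidiagonal_half_pow_le K) hc)
      rw [Finset.mul_sum]
      refine Finset.sum_le_sum fun y hy => ?_
      rw [mem_antidiagonal] at hy
      have h1 := hfb y.1 (by omega)
      have h2 := hx' y.2
      have h3 := h.x_nonneg (y.2 + 1)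
      calc 16 * (((y.1 : ℝ) + 1) * f (y.1 + 1)) * (((y.2 : ℝ) + 1) * x (y.2 + 1))
          ≤ 16 * (((y.1 : ℝ) + 1) * (A * B ^ y.1)) *
            (((y.2 : ℝ) + 1) * ((p + 1) * (M / ν) * (B ^ y.2 * (1 / 2) ^ y.2))) := by
            gcongr
        _ = 16 * (A * ((p + 1) * (M / ν))) * (B ^ y.1 * B ^ y.2) *
            (((y.1 : ℝ) + 1) * (((y.2 : ℝ) + 1) * (1 / 2) ^ y.2)) := by ring
        _ = _ := by rw [← pow_add, hy]
    have hwb := key w M hM0.le h.w_nonneg h.w_zero fun i hi => (ih i (by omega)).1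
    have hqb := key q ((p + 1) * M) (by positivity) h.q_nonneg h.q_zero fun i hi =>
      (ih i (by omega)).2
    have hK : (0 : ℝ) < K + 2 := by positivity
    have hw : w (K + 1 + 1) ≤ M * B ^ (K + 1) := by
      refine h.w_le_of_bracketBound_le haM hM0.le hone fun hpn => ?_
      have h1 : (1 : ℝ) ≤ ((K + 1 + 1 : ℕ) : ℝ) - p := by
        have : (p : ℝ) + 1 ≤ ((K + 1 + 1 : ℕ) : ℝ) := by exact_mod_cast hpn
        linarith
      -- With n = K + 2 ≥ p + 1, (p+1)(n-p) - n = p(n-p-1) ≥ 0.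
      have h2 : (((K + 1 + 1 : ℕ) : ℝ) - p)⁻¹ * (K + 2) ≤ p + 1 := by
        rw [inv_mul_le_iff₀ (by linarith)]
        push_cast at h1 ⊢
        nlinarith
      calc (((K + 1 + 1 : ℕ) : ℝ) - p)⁻¹ * HomPoly.bracketBound (K + 2) w x
          ≤ (((K + 1 + 1 : ℕ) : ℝ) - p)⁻¹ *
            ((K + 2) * (64 * (M * ((p + 1) * (M / ν))) * B ^ K)) := by
            gcongr
        _ = ((((K + 1 + 1 : ℕ) : ℝ) - p)⁻¹ * (K + 2)) *
            (64 * (M * ((p + 1) * (M / ν))) * B ^ K) := by ring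
        _ ≤ (p + 1) * (64 * (M * ((p + 1) * (M / ν))) * B ^ K) := by gcongr
        _ = M * (D / ν) * B ^ K := by rw [hD]; ring
        _ ≤ M * B * B ^ K := by gcongr
        _ = _ := by ring
    refine ⟨hw, ?_⟩
    -- The linear factor K + 2 is kept in front because `q` is `σ` divided by the order K + 2.
    have hσ : σ (K + 1 + 1) ≤ (K + 2) * ((p + 1) * M * B ^ (K + 1)) := by
      calc σ (K + 1 + 1) ≤ p * w (K + 1 + 1) + HomPoly.bracketBound (K + 2) q x := h.σ_le _
        _ ≤ p * (M * B ^ (K + 1)) +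
            (K + 2) * (64 * ((p + 1) * M * ((p + 1) * (M / ν))) * B ^ K) := by gcongr
        _ = 1 * (p * (M * B ^ (K + 1))) + (K + 2) * (M * (D / ν) * B ^ K) := by rw [hD]; ring
        _ ≤ (K + 2) * (p * (M * B ^ (K + 1))) + (K + 2) * (M * B * B ^ K) := by
            gcongr
            linarith [(Nat.cast_nonneg K : (0 : ℝ) ≤ K)]
        _ = _ := by ring
    refine (h.q_le _).trans ?_
    have e : ((K + 1 + 1 : ℕ) : ℝ) = K + 2 := by push_cast; ring
    rw [e, inv_mul_le_iff₀ hK]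
    exact hσ

end NormRecursion

end Numerics

section

variable {d p : ℕ} (freq : FreqLattice d → ℝ) {ν : ℝ} (hν : 0 < ν) (r : ℕ)
  (P : HomPoly d (p + 1))

/-- The norms of the terms of the normal form satisfy the recursive inequalities. -/
theorem normRecursion_normalForm (hp : 1 ≤ p) : NormRecursion p r ν P.supNorm
    (fun n => (normalForm freq hν r P n).W.supNorm) (fun n => (normalForm freq hν r P n).Q.supNorm)
    (fun n => (normalForm freq hν r P n).χ.supNorm)
    (fun n => (normalFormRhs freq hν r P n).supNorm) where
  w_nonneg _ := HomPoly.supNorm_nonneg _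
  q_nonneg _ := HomPoly.supNorm_nonneg _
  x_nonneg _ := HomPoly.supNorm_nonneg _
  w_zero := (supNorm_zero_terms freq hν r P hp).1
  q_zero := (supNorm_zero_terms freq hν r P hp).2.1
  x_zero := (supNorm_zero_terms freq hν r P hp).2.2
  w_le n := by
    refine (supNorm_W_le freq hν r hp n).trans (le_of_eq ?_)
    congr 1
    split_ifs with h
    · subst h
      rw [P.component_self]
    · rw [P.component_of_ne h, HomPoly.supNorm_zero]
  σ_le n := supNorm_rhs_le freq hν r hp n
  q_le n := supNorm_Q_le freq hν r P n
  x_le n := supNorm_χ_le freq hν r P n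

end
end

noncomputable section

/-! ### Truncation errors of double series. -/

section Tails

/-- The part of a double sum which is not below the diagonal. -/
theorem abs_sum_sub_sum_antidiagonal_le {e : ℕ → ℕ → ℝ} {A X : ℕ → ℝ} {r : ℕ}
    (hX : ∀ j, 0 ≤ X j) (hA : ∀ i, 0 ≤ A i) (he : ∀ i j, |e i j| ≤ A i * X j)
    (h0 : ∀ i j, r ≤ j → e i j = 0) (N : ℕ) :
    |∑ i ∈ Finset.range N, ∑ j ∈ Finset.range r, e i j -
      ∑ n ∈ Finset.range N, ∑ x ∈ Finset.HasAntidiagonal.antidiagonal n, e x.1 x.2| ≤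
      (∑ i ∈ Finset.range N, A i - ∑ i ∈ Finset.range (N - r), A i) *
        ∑ j ∈ Finset.range r, X j := by
  have h1 : ∑ n ∈ Finset.range N, ∑ x ∈ Finset.HasAntidiagonal.antidiagonal n, e x.1 x.2 =
      ∑ i ∈ Finset.range N, ∑ j ∈ Finset.range (N - i), e i j := by
    rw [← Finset.sum_range_diag_flip]
    exact Finset.sum_congr rfl fun n _ => Finset.Nat.sum_antidiagonal_eq_sum_range_succ e n
  have h2 : ∑ i ∈ Finset.range N, A i - ∑ i ∈ Finset.range (N - r), A i =
      ∑ i ∈ Finset.range N, if N ≤ i + r then A i else 0 := by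
    rw [← Finset.sum_range_add_sum_Ico A (Nat.sub_le N r), add_sub_cancel_left,
      ← Finset.sum_filter]
    refine Finset.sum_congr (Finset.ext fun i => ?_) fun _ _ => rfl
    simp only [Finset.mem_Ico, Finset.mem_filter, Finset.mem_range]
    omega
  rw [h1, ← Finset.sum_sub_distrib, h2, Finset.sum_mul]
  refine (Finset.abs_sum_le_sum_abs _ _).trans (Finset.sum_le_sum fun i hi => ?_)
  have hsplit : ∀ a b : ℕ, a ≤ b → ∑ j ∈ Finset.range b, e i j =
      ∑ j ∈ Finset.range a, e i j + ∑ j ∈ Finset.Ico a b, e i j := fun a b hab =>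
    (Finset.sum_range_add_sum_Ico _ hab).symm
  -- If i + r ≥ N, the row extends beyond the triangle by the indices N - i ≤ j < r, which are
  -- estimated. Otherwise the triangle contains the whole row and its further entries have j ≥ r,
  -- where `e` vanishes.
  split_ifs with h
  · have h3 : N - i ≤ r := by omega
    rw [hsplit _ _ h3, add_sub_cancel_left, Finset.mul_sum]
    refine (Finset.abs_sum_le_sum_abs _ _).trans ?_
    refine (Finset.sum_le_sum fun j _ => he i j).trans ?_
    refine Finset.sum_le_sum_of_subset_of_nonneg (fun j hj => ?_) fun j _ _ =>
      mul_nonneg (hA i) (hX j)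
    rw [Finset.mem_Ico] at hj
    exact Finset.mem_range.2 hj.2
  · have h3 : r ≤ N - i := by omega
    rw [hsplit _ _ h3, Finset.sum_eq_zero fun j hj => h0 i j (Finset.mem_Ico.1 hj).1]
    simp

theorem tendsto_tail {A : ℕ → ℝ} (hA : Summable A) (r : ℕ) (c : ℝ) :
    Filter.Tendsto (fun N => (∑ i ∈ Finset.range N, A i - ∑ i ∈ Finset.range (N - r), A i) * c)
      Filter.atTop (nhds 0) := by
  have h1 := hA.hasSum.tendsto_sum_nat
  have h2 := h1.comp (Filter.tendsto_sub_atTop_nat r)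
  have := (h1.sub h2).mul_const c
  rw [sub_self, zero_mul] at this
  exact this

theorem abs_sub_le_of_hasDerivAt {f f' : ℝ → ℝ} {δ : ℝ} (hc : ContinuousOn f (Set.Icc 0 1))
    (hd : ∀ t ∈ Set.Ioo (0 : ℝ) 1, HasDerivAt f (f' t) t)
    (hb : ∀ t ∈ Set.Ioo (0 : ℝ) 1, |f' t| ≤ δ) : |f 1 - f 0| ≤ δ := by
  obtain ⟨t, ht, h⟩ := exists_hasDerivAt_eq_slope f f' zero_lt_one hc hd
  rw [sub_zero, div_one] at h
  rw [← h]
  exact hb t ht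

end Tails

/-! ### Conservation laws along the flow. -/

section Conservation

variable {d p r : ℕ}

/-- The equations satisfied by the terms of the normal form. -/
structure NormalFormEquations (freq : FreqLattice d → ℝ) (r : ℕ) (P : HomPoly d (p + 1))
    (W Q χ E : ∀ n, HomPoly d (n + 1)) : Prop where
  transport : ∀ (n : ℕ) (u : EllOne d),
    ((n : ℝ) - p) * (W n).eval u + HomPoly.bracketEval n W χ u = 0
  homological : ∀ n : ℕ, 1 ≤ n → ∀ u : EllOne d,
    n * (Q n).eval u + (E n).eval u + HomPoly.bracketEval n Q χ u = p * (W n).eval u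
  removed : ∀ n k l, (E n).coeff k l = -smallDivisor freq k l * (χ n).coeff k l
  W_self : ∀ u : EllOne d, (W p).eval u = P.eval u
  W_lt : ∀ n < p, (W n).supNorm = 0
  Q_zero : (Q 0).supNorm = 0
  χ_zero : (χ 0).supNorm = 0
  χ_le : ∀ n, r ≤ n → (χ n).supNorm = 0

/-- The time dependence `t^(n-1)` of the generators. -/
def powCoeff (n : ℕ) : C(unitInterval, ℝ) := ⟨fun t => (t : ℝ) ^ (n - 1), by fun_prop⟩

theorem norm_powCoeff_le (n : ℕ) : ‖powCoeff n‖ ≤ 1 := by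
  rw [ContinuousMap.norm_le _ zero_le_one]
  intro t
  change ‖(t : ℝ) ^ (n - 1)‖ ≤ 1
  rw [norm_pow]
  exact pow_le_one₀ (norm_nonneg _) (by rw [Real.norm_of_nonneg t.2.1]; exact t.2.2)

/-- The size of the gradient of a polynomial on a ball of radius `ρ`. -/
def gradSize (f : ∀ n, HomPoly d (n + 1)) (ρ : ℝ) (n : ℕ) : ℝ :=
  2 * (n + 1) * (f n).supNorm * ρ ^ (2 * n + 1)

theorem gradSize_nonneg (f : ∀ n, HomPoly d (n + 1)) {ρ : ℝ} (hρ : 0 ≤ ρ) (n : ℕ) :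
    0 ≤ gradSize f ρ n :=
  mul_nonneg (f n).gradBound_nonneg (by positivity)

theorem norm_grad_le_gradSize (f : ∀ n, HomPoly d (n + 1)) {ρ : ℝ} {u : EllOne d} (hu : ‖u‖ ≤ ρ)
    (n : ℕ) : ‖(f n).grad u‖ ≤ gradSize f ρ n := by
  refine ((f n).norm_grad_le u).trans ?_
  have := (f n).gradBound_nonneg
  unfold gradSize
  gcongr

theorem norm_field_le_gradSize (f : ∀ n, HomPoly d (n + 1)) {ρ : ℝ} {u : EllOne d} (hu : ‖u‖ ≤ ρ)
    (n : ℕ) : ‖(f n).field u‖ ≤ gradSize f ρ n := by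
  rw [HomPoly.field, norm_smul, Complex.norm_I, one_mul]
  exact norm_grad_le_gradSize f hu n

namespace NormalFormEquations

variable {freq : FreqLattice d → ℝ} {P : HomPoly d (p + 1)} {W Q χ E : ∀ n, HomPoly d (n + 1)}
  {u : EllOne d} {γ : C(unitInterval, EllOne d)}

theorem hasDerivAt_eval_curve (hγ : IsHamCurve χ (Finset.range r) powCoeff u γ) {n : ℕ}
    (f : HomPoly d (n + 1)) {t : ℝ} (ht : t ∈ Set.Ioo (0 : ℝ) 1) :
    HasDerivAt (fun τ => f.eval (γ (Set.projIcc 0 1 zero_le_one τ)))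
      (∑ m ∈ Finset.range r, t ^ (m - 1) * realPairing
        (f.grad (γ (Set.projIcc 0 1 zero_le_one t)))
        ((χ m).field (γ (Set.projIcc 0 1 zero_le_one t)))) t := by
  have h := (f.hasFDerivAt_eval (γ (Set.projIcc 0 1 zero_le_one t))).comp_hasDerivAt t
    (hγ.hasDerivAt ht)
  refine h.congr_deriv ?_
  rw [timeField_apply, map_sum]
  refine Finset.sum_congr rfl fun m _ => ?_
  rw [map_smul, (χ m).fieldMap_apply, realPairingCLM_apply, smul_eq_mul]
  congr 1
  change ((Set.projIcc 0 1 zero_le_one t : unitInterval) : ℝ) ^ (m - 1) = _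
  rw [Set.projIcc_of_mem zero_le_one ⟨ht.1.le, ht.2.le⟩]

theorem continuous_eval_curve {n : ℕ} (f : HomPoly d (n + 1)) (γ : C(unitInterval, EllOne d)) :
    Continuous fun τ : ℝ => f.eval (γ (Set.projIcc 0 1 zero_le_one τ)) := by
  have h : Continuous fun u : EllOne d => f.eval u :=
    continuous_iff_continuousAt.2 fun u => (f.hasFDerivAt_eval u).continuousAt
  exact h.comp (continuous_comp_projIcc γ)

theorem abs_pairing_le (f g : ∀ n, HomPoly d (n + 1)) {ρ : ℝ} {u : EllOne d} (hu : ‖u‖ ≤ ρ)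
    (i j : ℕ) : |realPairing ((f i).grad u) ((g j).field u)| ≤ gradSize f ρ i * gradSize g ρ j :=
  (abs_realPairing_le _ _).trans (mul_le_mul (norm_grad_le_gradSize f hu i)
    (norm_field_le_gradSize g hu j) (norm_nonneg _)
    (gradSize_nonneg f ((norm_nonneg u).trans hu) i))

/-- The transported perturbation. -/
theorem tendsto_sum_W (h : NormalFormEquations freq r P W Q χ E)
    (hγ : IsHamCurve χ (Finset.range r) powCoeff u γ) (hW : Summable (gradSize W ‖γ‖)) :
    Filter.Tendsto (fun N => ∑ n ∈ Finset.range N, (W n).eval (γ 1)) Filter.atTop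
      (nhds (P.eval u)) := by
  set p' : ℝ → unitInterval := Set.projIcc 0 1 zero_le_one with hp'
  -- Partial sums of the conserved quantity W_t(γ(t)). The subtraction in the exponent is truncated,
  -- which is harmless because W_n = 0 for n < p. The transport equation cancels the derivative
  -- order by order, except for the pairs i < N, j < r with i + j ≥ N, which contribute the tail of
  -- a convergent series.
  set f : ℕ → ℝ → ℝ := fun N t => ∑ n ∈ Finset.range N, t ^ (n - p) * (W n).eval (γ (p' t))
  have p0 : p' 0 = 0 := Set.projIcc_left _
  have p1 : p' 1 = 1 := Set.projIcc_right _
  have hγ1 : ∀ t, ‖γ t‖ ≤ ‖γ‖ := fun t => γ.norm_coe_le_norm t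
  have hb : ∀ N, |f N 1 - f N 0| ≤ (∑ i ∈ Finset.range N, gradSize W ‖γ‖ i -
      ∑ i ∈ Finset.range (N - r), gradSize W ‖γ‖ i) *
        ∑ j ∈ Finset.range r, gradSize χ ‖γ‖ j := by
    intro N
    refine abs_sub_le_of_hasDerivAt (f' := fun t => ∑ n ∈ Finset.range N,
      (((n - p : ℕ) : ℝ) * t ^ (n - p - 1) * (W n).eval (γ (p' t)) + t ^ (n - p) *
        ∑ m ∈ Finset.range r, t ^ (m - 1) * realPairing ((W n).grad (γ (p' t)))
          ((χ m).field (γ (p' t))))) ?_ ?_ ?_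
    · refine (continuous_finsetSum _ fun n _ => ?_).continuousOn
      exact (continuous_pow _).mul (continuous_eval_curve (W n) γ)
    · intro t ht
      exact HasDerivAt.fun_sum fun n _ =>
        (hasDerivAt_pow (n - p) t).mul (hasDerivAt_eval_curve hγ (W n) ht)
    · intro t ht
      set e : ℕ → ℕ → ℝ := fun i j => t ^ (i - p) * (t ^ (j - 1) *
        realPairing ((W i).grad (γ (p' t))) ((χ j).field (γ (p' t)))) with he
      have ht1 : ∀ k : ℕ, |t ^ k| ≤ 1 := fun k => by
        rw [abs_pow, abs_of_pos ht.1]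
        exact pow_le_one₀ ht.1.le ht.2.le
      refine le_trans (le_of_eq ?_) (abs_sum_sub_sum_antidiagonal_le (e := e)
        (gradSize_nonneg χ (norm_nonneg γ)) (gradSize_nonneg W (norm_nonneg γ)) (fun i j => ?_)
        (fun i j hj => ?_) N)
      · congr 1
        rw [← Finset.sum_sub_distrib]
        refine Finset.sum_congr rfl fun n _ => ?_
        rw [add_comm, Finset.mul_sum, sub_eq_add_neg]
        congr 1
        have htr := h.transport n (γ (p' t))
        rcases lt_or_ge n p with hn | hn
        · rw [HomPoly.eval_eq_zero (h.W_lt n hn), mul_zero, eq_comm, neg_eq_zero]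
          refine Finset.sum_eq_zero fun x hx => ?_
          rw [Finset.HasAntidiagonal.mem_antidiagonal] at hx
          simp only [he]
          rw [HomPoly.grad_eq_zero (h.W_lt x.1 (by omega)), realPairing_zero_left]
          ring
        · rw [Nat.cast_sub hn, mul_right_comm, eq_neg_of_add_eq_zero_left htr, neg_mul]
          congr 1
          rw [HomPoly.bracketEval, Finset.sum_mul]
          refine Finset.sum_congr rfl fun x hx => ?_
          rw [Finset.HasAntidiagonal.mem_antidiagonal] at hx
          simp only [he]
          -- The powers of t match, n - p - 1 = (i - p) + (j - 1), only when i ≥ p and j ≥ 1; all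
          -- other pairs contribute zero.
          by_cases hx2 : x.2 = 0
          · rw [hx2, HomPoly.field_eq_zero h.χ_zero, realPairing_zero_right]
            ring
          by_cases hx1 : x.1 < p
          · rw [HomPoly.grad_eq_zero (h.W_lt x.1 hx1), realPairing_zero_left]
            ring
          rw [show n - p - 1 = (x.1 - p) + (x.2 - 1) by omega, pow_add]
          ring
      · simp only [he, abs_mul]
        have h1 := abs_pairing_le W χ (hγ1 (p' t)) i j
        calc |t ^ (i - p)| * (|t ^ (j - 1)| *
            |realPairing ((W i).grad (γ (p' t))) ((χ j).field (γ (p' t)))|)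
            ≤ 1 * (1 * (gradSize W ‖γ‖ i * gradSize χ ‖γ‖ j)) := by
              gcongr
              · exact ht1 _
              · exact ht1 _
          _ = _ := by ring
      · simp only [he]
        rw [HomPoly.field_eq_zero (h.χ_le j hj), realPairing_zero_right]
        ring
  have hlim := squeeze_zero_norm (f := fun N => f N 1 - f N 0) hb (tendsto_tail hW r _)
  -- At t = 0 only the term n = p survives, and it is the original perturbation.
  have hf0 : ∀ N, p < N → f N 0 = P.eval u := by
    intro N hN
    simp only [f]
    rw [Finset.sum_eq_single p, p0, hγ.apply_zero, h.W_self]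
    · simp
    · intro n _ hn
      rcases lt_or_gt_of_ne hn with h1 | h1
      · rw [HomPoly.eval_eq_zero (h.W_lt n h1), mul_zero]
      · rw [zero_pow (by omega), zero_mul]
    · intro hn
      exact absurd (Finset.mem_range.2 hN) hn
  have hlim2 := hlim.add_const (P.eval u)
  rw [zero_add] at hlim2
  refine hlim2.congr' ?_
  filter_upwards [Filter.eventually_gt_atTop p] with N hN
  rw [hf0 N hN, sub_add_cancel]
  simp only [f, p1, one_pow, one_mul]

end NormalFormEquations

end Conservation
end

noncomputable section

/-! ### The quadratic Hamiltonian along the flow. -/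

namespace NormalFormEquations

variable {d p r : ℕ} {freq : FreqLattice d → ℝ} {P : HomPoly d (p + 1)}
  {W Q χ E : ∀ n, HomPoly d (n + 1)} {δ s A : ℝ}

theorem supNorm_E (h : NormalFormEquations freq r P W Q χ E) {n : ℕ} (hn : (χ n).supNorm = 0) :
    (E n).supNorm = 0 := by
  refine le_antisymm (HomPoly.supNorm_le _ fun k l => ?_) (HomPoly.supNorm_nonneg _)
  have : (χ n).coeff k l = 0 := norm_le_zero_iff.1 (hn ▸ (χ n).norm_coeff_le k l)
  rw [h.removed, this, mul_zero, norm_zero]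

theorem hasDerivAt_quadHam_curve (h : NormalFormEquations freq r P W Q χ E) (hδ : 0 ≤ δ)
    (hs : 0 ≤ s) (hA0 : 0 ≤ A) (hA : ∀ k, |freq k| ≤ A * sobWeight d δ s k ^ 2)
    {x : WSpace (sobWeight d δ s)} {η : C(unitInterval, WSpace (sobWeight d δ s))}
    (hη : IsIntegralCurveFrom (Finset.range r) (fun n => (χ n).fieldMapW hδ hs) powCoeff x η)
    {t : ℝ} (ht : t ∈ Set.Ioo (0 : ℝ) 1) :
    HasDerivAt (fun τ => quadHam freq (η (Set.projIcc 0 1 zero_le_one τ)).1.1)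
      (∑ m ∈ Finset.range r, t ^ (m - 1) *
        (E m).eval (η (Set.projIcc 0 1 zero_le_one t)).1.1) t := by
  have hd := (hasFDerivAt_quadHam hA0 (sobWeight_nonneg hδ s) hA
    (η (Set.projIcc 0 1 zero_le_one t))).comp_hasDerivAt t (hη.hasDerivAt ht)
  refine hd.congr_deriv ?_
  rw [timeField_apply, map_sum]
  refine Finset.sum_congr rfl fun m _ => ?_
  have e := (χ m).two_mul_quadForm_field (E m) (h.removed m) (sobWeight_nonneg hδ s) hA
    (Real.rpow_nonneg (Nat.cast_nonneg _) s) (sobWeight_momentum_le hδ hs Sum.isLeft)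
    (η (Set.projIcc 0 1 zero_le_one t))
  rw [map_smul, smul_eq_mul, ← e]
  refine congrArg₂ (· * ·) ?_ ?_
  · change ((Set.projIcc 0 1 zero_le_one t : unitInterval) : ℝ) ^ (m - 1) = _
    rw [Set.projIcc_of_mem zero_le_one ⟨ht.1.le, ht.2.le⟩]
  · rw [two_smul, two_mul, ← (χ m).fieldMap_apply]
    rfl

/-- The conservation law of the normal form transformation. -/
theorem tendsto_quadHam_add_sum (h : NormalFormEquations freq r P W Q χ E) (hδ : 0 ≤ δ)
    (hs : 0 ≤ s) (hA0 : 0 ≤ A) (hA : ∀ k, |freq k| ≤ A * sobWeight d δ s k ^ 2)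
    (hp : 1 ≤ p)
    {x : WSpace (sobWeight d δ s)} {η : C(unitInterval, WSpace (sobWeight d δ s))}
    (hη : IsIntegralCurveFrom (Finset.range r) (fun n => (χ n).fieldMapW hδ hs) powCoeff x η)
    {ρ : ℝ} (hρ : ∀ t, ‖(η t).1.1‖ ≤ ρ)
    (hW : Summable (gradSize W ρ)) (hQ : Summable (gradSize Q ρ)) :
    Filter.Tendsto (fun N => quadHam freq (η 1).1.1 +
      ∑ n ∈ Finset.range N, ((Q n).eval (η 1).1.1 - (W n).eval (η 1).1.1)) Filter.atTop
      (nhds (quadHam freq x.1.1)) := by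
  have hρ0 : 0 ≤ ρ := (norm_nonneg _).trans (hρ 0)
  set γ : C(unitInterval, EllOne d) :=
    (WSpace.fstCLM (sobWeight d δ s) : C(WSpace (sobWeight d δ s), EllOne d)).comp η with hγdef
  have hγ : IsHamCurve χ (Finset.range r) powCoeff x.1.1 γ := hη.fst hδ hs
  have hγη : ∀ t, γ t = (η t).1.1 := fun t => rfl
  set p' : ℝ → unitInterval := Set.projIcc 0 1 zero_le_one with hp'
  -- As t^p W_t(γ(t)) = t^p P(u), the requirement N_t(γ(t)) = Z₂(u) + t^p P(u) amounts to the
  -- conservation of Z₂ + ∑ t^n (Q_n - W_n), whose partial sums these are.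
  set f : ℕ → ℝ → ℝ := fun N t => quadHam freq (η (p' t)).1.1 +
    ∑ n ∈ Finset.range N, t ^ n * ((Q n).eval (γ (p' t)) - (W n).eval (γ (p' t))) with hf
  have p0 : p' 0 = 0 := Set.projIcc_left _
  have p1 : p' 1 = 1 := Set.projIcc_right _
  have hqc : Continuous fun t : ℝ => quadHam freq (η (p' t)).1.1 := by
    have hq : Continuous fun x : WSpace (sobWeight d δ s) => quadHam freq x.1.1 :=
      continuous_iff_continuousAt.2 fun x =>
        (hasFDerivAt_quadHam hA0 (sobWeight_nonneg hδ s) hA x).continuousAt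
    exact hq.comp (continuous_comp_projIcc η)
  have hb : ∀ N, r ≤ N → |f N 1 - f N 0| ≤ (∑ i ∈ Finset.range N, (gradSize Q ρ i + gradSize W ρ i) -
      ∑ i ∈ Finset.range (N - r), (gradSize Q ρ i + gradSize W ρ i)) *
        ∑ j ∈ Finset.range r, gradSize χ ρ j := by
    intro N hN
    refine abs_sub_le_of_hasDerivAt (f' := fun t => ∑ m ∈ Finset.range r, t ^ (m - 1) *
      (E m).eval (η (p' t)).1.1 + ∑ n ∈ Finset.range N,
      (((n : ℕ) : ℝ) * t ^ (n - 1) * ((Q n).eval (γ (p' t)) - (W n).eval (γ (p' t))) + t ^ n *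
        (∑ m ∈ Finset.range r, t ^ (m - 1) * realPairing ((Q n).grad (γ (p' t)))
          ((χ m).field (γ (p' t))) - ∑ m ∈ Finset.range r, t ^ (m - 1) *
            realPairing ((W n).grad (γ (p' t))) ((χ m).field (γ (p' t)))))) ?_ ?_ ?_
    · refine (hqc.add (continuous_finsetSum _ fun n _ => ?_)).continuousOn
      exact (continuous_pow _).mul ((continuous_eval_curve (Q n) γ).sub
        (continuous_eval_curve (W n) γ))
    · intro t ht
      exact (h.hasDerivAt_quadHam_curve hδ hs hA0 hA hη ht).add
        (HasDerivAt.fun_sum fun n _ => (hasDerivAt_pow n t).mul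
          ((hasDerivAt_eval_curve hγ (Q n) ht).sub (hasDerivAt_eval_curve hγ (W n) ht)))
    · intro t ht
      set v := γ (p' t) with hv
      set e : ℕ → ℕ → ℝ := fun i j => t ^ i * (t ^ (j - 1) *
        (realPairing ((Q i).grad v) ((χ j).field v) -
          realPairing ((W i).grad v) ((χ j).field v))) with he
      have ht1 : ∀ k : ℕ, |t ^ k| ≤ 1 := fun k => by
        rw [abs_pow, abs_of_pos ht.1]
        exact pow_le_one₀ ht.1.le ht.2.le
      refine le_trans (le_of_eq ?_) (abs_sum_sub_sum_antidiagonal_le (e := e)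
        (gradSize_nonneg χ hρ0) (fun i => add_nonneg (gradSize_nonneg Q hρ0 i)
          (gradSize_nonneg W hρ0 i)) (fun i j => ?_) (fun i j hj => ?_) N)
      · congr 1
        -- The derivative of Z₂ involves only orders below r, but the bracket with Z₂ vanishes with
        -- the generator beyond, so it can be matched with the other sums up to N.
        have hE : ∑ m ∈ Finset.range r, t ^ (m - 1) * (E m).eval v =
            ∑ m ∈ Finset.range N, t ^ (m - 1) * (E m).eval v := by
          rw [← Finset.sum_range_add_sum_Ico _ hN, left_eq_add]
          refine Finset.sum_eq_zero fun m hm => ?_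
          rw [HomPoly.eval_eq_zero (h.supNorm_E (h.χ_le m (Finset.mem_Ico.1 hm).1)), mul_zero]
        rw [← hγη, ← hv, hE, ← Finset.sum_add_distrib, ← Finset.sum_sub_distrib]
        refine Finset.sum_congr rfl fun n _ => ?_
        have a1 : t ^ n * (∑ m ∈ Finset.range r, t ^ (m - 1) * realPairing ((Q n).grad v)
            ((χ m).field v) - ∑ m ∈ Finset.range r, t ^ (m - 1) * realPairing ((W n).grad v)
              ((χ m).field v)) = ∑ j ∈ Finset.range r, e n j := by
          simp only [he]
          rw [← Finset.sum_sub_distrib, Finset.mul_sum]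
          exact Finset.sum_congr rfl fun m _ => by ring
        -- The homological equation minus the transport equation: the terms p W_n cancel. Order zero
        -- is separate, as n - 1 is then truncated and every term vanishes.
        have a2 : t ^ (n - 1) * (E n).eval v + n * t ^ (n - 1) * ((Q n).eval v - (W n).eval v) =
            -∑ x ∈ Finset.HasAntidiagonal.antidiagonal n, e x.1 x.2 := by
          rcases Nat.eq_zero_or_pos n with hn | hn
          · subst hn
            rw [HomPoly.eval_eq_zero (h.supNorm_E h.χ_zero), Finset.sum_eq_zero fun x hx => ?_]
            · simp
            · rw [Finset.HasAntidiagonal.mem_antidiagonal] at hx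
              simp only [he]
              rw [show x.2 = 0 by omega, HomPoly.field_eq_zero h.χ_zero, realPairing_zero_right,
                realPairing_zero_right]
              ring
          · have h1 := h.homological n hn v
            have h2 := h.transport n v
            have h3 : ∑ x ∈ Finset.HasAntidiagonal.antidiagonal n, e x.1 x.2 =
                t ^ (n - 1) * (HomPoly.bracketEval n Q χ v - HomPoly.bracketEval n W χ v) := by
              rw [HomPoly.bracketEval, HomPoly.bracketEval, ← Finset.sum_sub_distrib,
                Finset.mul_sum]
              refine Finset.sum_congr rfl fun x hx => ?_
              rw [Finset.HasAntidiagonal.mem_antidiagonal] at hx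
              simp only [he]
              by_cases hx2 : x.2 = 0
              · rw [hx2, HomPoly.field_eq_zero h.χ_zero, realPairing_zero_right,
                  realPairing_zero_right]
                ring
              rw [show n - 1 = x.1 + (x.2 - 1) by omega, pow_add]
              ring
            rw [h3]
            linear_combination t ^ (n - 1) * (h1 - h2)
        linear_combination a1 + a2
      · simp only [he, abs_mul]
        have h1 := abs_pairing_le Q χ (hρ (p' t)) i j
        have h2 := abs_pairing_le W χ (hρ (p' t)) i j
        rw [← hγη, ← hv] at h1 h2
        have h3 := (abs_sub _ _).trans (add_le_add h1 h2)
        calc _ ≤ 1 * (1 * (gradSize Q ρ i * gradSize χ ρ j + gradSize W ρ i * gradSize χ ρ j)) := by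
              gcongr
              · exact ht1 _
              · exact ht1 _
          _ = _ := by ring
      · simp only [he]
        rw [HomPoly.field_eq_zero (h.χ_le j hj), realPairing_zero_right, realPairing_zero_right]
        ring
  have hlim := squeeze_zero_norm' (f := fun N => f N 1 - f N 0)
    ((Filter.eventually_ge_atTop r).mono hb) (tendsto_tail (hQ.add hW) r _)
  have hf0 : ∀ N, f N 0 = quadHam freq x.1.1 := by
    intro N
    simp only [hf]
    rw [Finset.sum_eq_zero, p0, hη.apply_zero, add_zero]
    intro n _
    rcases Nat.eq_zero_or_pos n with hn | hn
    · subst hn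
      rw [HomPoly.eval_eq_zero h.Q_zero, HomPoly.eval_eq_zero (h.W_lt 0 hp)]
      ring
    · rw [zero_pow hn.ne', zero_mul]
  have hlim2 := hlim.add_const (quadHam freq x.1.1)
  rw [zero_add] at hlim2
  refine hlim2.congr fun N => ?_
  rw [hf0 N, sub_add_cancel]
  simp only [hf, p1, one_pow, one_mul, hγη]

/-- The Hamiltonian in the new variables. -/
theorem tendsto_sum_Q (h : NormalFormEquations freq r P W Q χ E) (hδ : 0 ≤ δ)
    (hs : 0 ≤ s) (hA0 : 0 ≤ A) (hA : ∀ k, |freq k| ≤ A * sobWeight d δ s k ^ 2) (hp : 1 ≤ p)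
    {x : WSpace (sobWeight d δ s)} {η : C(unitInterval, WSpace (sobWeight d δ s))}
    (hη : IsIntegralCurveFrom (Finset.range r) (fun n => (χ n).fieldMapW hδ hs) powCoeff x η)
    (hW : Summable (gradSize W ‖η‖)) (hQ : Summable (gradSize Q ‖η‖)) :
    Filter.Tendsto (fun N => ∑ n ∈ Finset.range N, (Q n).eval (η 1).1.1) Filter.atTop
      (nhds (hamiltonian freq P x.1.1 - quadHam freq (η 1).1.1)) := by
  have hη1 : ∀ t, ‖(η t).1.1‖ ≤ ‖η‖ := fun t =>
    (WSpace.norm_fst_le _).trans (η.norm_coe_le_norm t)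
  have h1 := h.tendsto_quadHam_add_sum hδ hs hA0 hA hp hη hη1 hW hQ
  have hW' : Summable (gradSize W ‖(WSpace.fstCLM (sobWeight d δ s) :
      C(WSpace (sobWeight d δ s), EllOne d)).comp η‖) := by
    refine Summable.of_nonneg_of_le (gradSize_nonneg W (norm_nonneg _)) (fun n => ?_) hW
    have := (W n).gradBound_nonneg
    unfold gradSize
    gcongr
    exact norm_fst_comp_le η
  have h2 := h.tendsto_sum_W (hη.fst hδ hs) hW'
  have h3 := (h1.add h2).sub_const (quadHam freq (η 1).1.1)
  rw [hamiltonian]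
  refine h3.congr fun N => ?_
  change _ + _ + ∑ n ∈ Finset.range N, (W n).eval (η 1).1.1 - _ = _
  rw [Finset.sum_sub_distrib]
  ring

end NormalFormEquations
end

noncomputable section

/-! ### Series of homogeneous polynomials: smoothness and gradients. -/

section Series

variable {d : ℕ}

theorem norm_form_diag_le {q : ℕ} (P : HomPoly d q) : ‖P.form‖ ≤ P.supNorm :=
  ContinuousMultilinearMap.opNorm_le_bound P.supNorm_nonneg P.norm_form_le

/-- The power series whose terms are homogeneous polynomials. -/
def evalSeries (f : ∀ q, HomPoly d q) : FormalMultilinearSeries ℝ (EllOne d) ℝ := fun m =>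
  if h : m / 2 + m / 2 = m then
    (f (m / 2)).form.domDomCongr (finSumFinEquiv.trans (finCongr h)) else 0

theorem norm_evalSeries_le (f : ∀ q, HomPoly d q) (m : ℕ) :
    ‖evalSeries f m‖ ≤ if m / 2 + m / 2 = m then (f (m / 2)).supNorm else 0 := by
  unfold evalSeries
  split_ifs with h
  · rw [ContinuousMultilinearMap.norm_domDomCongr]
    exact norm_form_diag_le _
  · rw [norm_zero]

theorem evalSeries_diag (f : ∀ q, HomPoly d q) (q : ℕ) (u : EllOne d) :
    (evalSeries f (2 * q) fun _ => u) = (f q).eval u := by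
  have h2 : 2 * q / 2 = q := by omega
  have h : 2 * q / 2 + 2 * q / 2 = 2 * q := by omega
  rw [evalSeries, dif_pos h]
  change (f (2 * q / 2)).form (fun _ => u) = _
  rw [← HomPoly.eval_eq_form, h2]

theorem evalSeries_sum (f : ∀ q, HomPoly d q) (u : EllOne d) :
    (evalSeries f).sum u = ∑' q, (f q).eval u := by
  have hinj : Function.Injective fun q : ℕ => 2 * q := fun a b h => by
    simpa using h
  have hsupp : Function.support (fun m => evalSeries f m fun _ => u) ⊆
      Set.range fun q : ℕ => 2 * q := by
    intro m hm
    refine ⟨m / 2, ?_⟩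
    by_contra h
    refine hm ?_
    have h' : ¬ (m / 2 + m / 2 = m) := fun h1 => h (by change 2 * (m / 2) = m; omega)
    simp only [evalSeries, dif_neg h']
    rfl
  rw [FormalMultilinearSeries.sum, ← hinj.tsum_eq hsupp]
  exact tsum_congr fun q => evalSeries_diag f q u

/-- The sum is that of a power series on ℓ¹ with terms only in even degrees. The coefficient bound
makes its radius of convergence at least ρ, so the sum is analytic there. -/
theorem contDiffOn_tsum_eval (f : ∀ q, HomPoly d q) {ρ B : ℝ} (hρ : 0 < ρ)
    (hB : ∀ q, (f q).supNorm * ρ ^ (2 * q) ≤ B) :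
    ContDiffOn ℝ ∞ (fun u : EllOne d => ∑' q, (f q).eval u) (Metric.ball 0 ρ) := by
  have hB0 : 0 ≤ B := (mul_nonneg (f 0).supNorm_nonneg (by positivity)).trans (hB 0)
  have hrad : ENNReal.ofReal ρ ≤ (evalSeries f).radius := by
    refine (evalSeries f).le_radius_of_bound B fun m => ?_
    rw [Real.coe_toNNReal _ hρ.le]
    refine (mul_le_mul_of_nonneg_right (norm_evalSeries_le f m) (by positivity)).trans ?_
    split_ifs with h
    · have := hB (m / 2)
      rwa [two_mul, h] at this
    · rwa [zero_mul]
  have hpos : 0 < (evalSeries f).radius := (ENNReal.ofReal_pos.2 hρ).trans_le hrad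
  have han := ((evalSeries f).hasFPowerSeriesOnBall hpos).analyticOnNhd
  have hball : Metric.ball (0 : EllOne d) ρ ⊆ Metric.eball 0 (evalSeries f).radius := by
    rw [← Metric.eball_ofReal]
    exact Metric.eball_subset_eball hrad
  refine ((han.contDiffOn (n := ∞) Metric.isOpen_eball.uniqueDiffOn).mono hball).congr fun u _ => ?_
  exact (evalSeries_sum f u).symm

/-- The family of homogeneous polynomials indexed by half of the degree. -/
def shiftFamily (g : ∀ n, HomPoly d (n + 1)) : ∀ q, HomPoly d q
  | 0 => 0
  | n + 1 => g n

theorem tsum_eval_shiftFamily (g : ∀ n, HomPoly d (n + 1)) (u : EllOne d) :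
    ∑' q, (shiftFamily g q).eval u = ∑' n, (g n).eval u := by
  have h0 : (shiftFamily g 0).eval u = 0 := by
    have : |(0 : HomPoly d 0).eval u| ≤ 0 := ((0 : HomPoly d 0).abs_eval_le u).trans
      (le_of_eq (by rw [HomPoly.supNorm_zero, zero_mul]))
    exact abs_nonpos_iff.1 this
  rw [← Nat.succ_injective.tsum_eq]
  · rfl
  · intro q hq
    rcases q with _ | n
    · exact absurd h0 hq
    · exact ⟨n, rfl⟩

theorem contDiffOn_tsum_eval_succ (g : ∀ n, HomPoly d (n + 1)) {ρ B : ℝ} (hρ : 0 < ρ)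
    (hB : ∀ n, (g n).supNorm * ρ ^ (2 * (n + 1)) ≤ B) :
    ContDiffOn ℝ ∞ (fun u : EllOne d => ∑' n, (g n).eval u) (Metric.ball 0 ρ) := by
  simp only [← tsum_eval_shiftFamily]
  have hB0 : 0 ≤ B := (mul_nonneg (g 0).supNorm_nonneg (by positivity)).trans (hB 0)
  refine contDiffOn_tsum_eval _ hρ (B := B) fun q => ?_
  rcases q with _ | n
  · change (0 : HomPoly d 0).supNorm * _ ≤ _
    rwa [HomPoly.supNorm_zero, zero_mul]
  · exact hB n

theorem abs_eval_le_gradSize (g : ∀ n, HomPoly d (n + 1)) {u : EllOne d} {ρ : ℝ} (hu : ‖u‖ ≤ ρ)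
    (n : ℕ) : |(g n).eval u| ≤ ρ * gradSize g ρ n := by
  have hρ : 0 ≤ ρ := (norm_nonneg u).trans hu
  have h0 := (g n).supNorm_nonneg
  have hn : (0 : ℝ) ≤ n := Nat.cast_nonneg n
  calc |(g n).eval u| ≤ (g n).supNorm * ‖u‖ ^ (2 * (n + 1)) := (g n).abs_eval_le u
    _ ≤ (g n).supNorm * ρ ^ (2 * (n + 1)) := by gcongr
    _ ≤ (2 * (n + 1)) * ((g n).supNorm * ρ ^ (2 * (n + 1))) :=
      le_mul_of_one_le_left (by positivity) (by linarith)
    _ = ρ * gradSize g ρ n := by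
      rw [gradSize]
      ring

theorem summable_eval (g : ∀ n, HomPoly d (n + 1)) {u : EllOne d} {ρ : ℝ} (hu : ‖u‖ ≤ ρ)
    (hg : Summable (gradSize g ρ)) : Summable fun n => (g n).eval u :=
  Summable.of_norm_bounded (hg.mul_left ρ) (abs_eval_le_gradSize g hu)

theorem summable_grad (g : ∀ n, HomPoly d (n + 1)) {u : EllOne d} {ρ : ℝ} (hu : ‖u‖ ≤ ρ)
    (hg : Summable (gradSize g ρ)) : Summable fun n => (g n).grad u :=
  Summable.of_norm_bounded hg (norm_grad_le_gradSize g hu)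

theorem norm_realPairingCLM_le (x : EllOne d) : ‖realPairingCLM x‖ ≤ ‖x‖ :=
  ContinuousLinearMap.opNorm_le_bound _ (norm_nonneg x) fun y => abs_realPairing_le x y

/-- Differentiation term by term, with the summable majorant `gradSize` of the derivatives on the
ball. The series of gradients converges in ℓ¹, hence defines a bounded sequence, and the pairing
commutes with the sum. -/
theorem isGradient_tsum_eval (g : ∀ n, HomPoly d (n + 1)) {u : EllOne d} {ρ : ℝ} (hu : ‖u‖ < ρ)
    (hg : Summable (gradSize g ρ)) :
    IsGradient (fun u : EllOne d => ∑' n, (g n).eval u) u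
      ((∑' n, (g n).grad u : EllOne d) : FreqLattice d → ℂ) := by
  have hub : u ∈ Metric.ball (0 : EllOne d) ρ := mem_ball_zero_iff.2 hu
  have hle : ∀ x ∈ Metric.ball (0 : EllOne d) ρ, ‖x‖ ≤ ρ := fun x hx =>
    (mem_ball_zero_iff.1 hx).le
  have hd : HasFDerivAt (fun u : EllOne d => ∑' n, (g n).eval u)
      (∑' n, realPairingCLM ((g n).grad u)) u :=
    hasFDerivAt_tsum_of_isPreconnected hg Metric.isOpen_ball
      (convex_ball (0 : EllOne d) ρ).isPreconnected
      (fun n x _ => (g n).hasFDerivAt_eval x)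
      (fun n x hx => (norm_realPairingCLM_le _).trans (norm_grad_le_gradSize g (hle x hx) n))
      hub (summable_eval g hu.le hg) hub
  refine ⟨hd.differentiableAt, (lp.memℓp _).of_exponent_ge le_top, fun v => ?_⟩
  have hs : Summable fun n => realPairingCLM ((g n).grad u) :=
    Summable.of_norm_bounded hg fun n =>
      (norm_realPairingCLM_le _).trans (norm_grad_le_gradSize g hu.le n)
  rw [hd.fderiv, realPairing_comm, ← realPairingCLM_apply,
    (realPairingCLM v).map_tsum (summable_grad g hu.le hg)]
  have h2 : (∑' n, realPairingCLM ((g n).grad u)) v = ∑' n, realPairingCLM ((g n).grad u) v :=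
    (ContinuousLinearMap.apply ℝ ℝ v).map_tsum hs
  rw [h2]
  exact tsum_congr fun n => realPairing_comm _ _

theorem gradMapW_diag_le {δ s : ℝ} (hδ : 0 ≤ δ) (hs : 0 ≤ s) {n : ℕ} (f : HomPoly d (n + 1))
    (x : WSpace (sobWeight d δ s)) : ‖f.gradMapW hδ hs fun _ => x‖ ≤
      2 * (n + 1) * f.supNorm * (2 * n + 1 : ℝ) ^ (s + 1) * ‖x‖ ^ (2 * n + 1) := by
  refine ((f.gradMapW hδ hs).le_opNorm _).trans ?_
  rw [Finset.prod_const, Finset.card_univ, show Fintype.card (FieldIdx n) = 2 * n + 1 by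
    simp only [Fintype.card_sum, Fintype.card_fin]; omega]
  gcongr
  exact f.norm_gradMapW_le hδ hs

/-- The gradient of a series of homogeneous polynomials in `H^s`. -/
theorem memHs_tsum_grad (g : ∀ n, HomPoly d (n + 1)) {s : ℝ} (hs : 0 ≤ s) {u : EllOne d}
    (hu : MemHs s u) {b : ℕ → ℝ} (hb : Summable b)
    (hg : ∀ n, 2 * (n + 1) * (g n).supNorm * (2 * n + 1 : ℝ) ^ (s + 1) * ‖u‖ ^ (2 * n) ≤ b n) :
    MemHs s (∑' n, (g n).grad u : EllOne d) ∧
      hsNorm s (∑' n, (g n).grad u : EllOne d) ≤ (∑' n, b n) * hsNorm s u := by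
  obtain ⟨x, rfl⟩ := EllOneHs.exists_of_memHs hu
  -- In the balanced norm a term of degree 2n+1 is bounded by ‖u‖_{ℓ¹}^(2n) times δ‖u‖_{H^s};
  -- dividing by δ at the end leaves one H^s factor.
  obtain ⟨δ, hδ, hbal⟩ := EllOneHs.exists_balance x
  set y := EllOneHs.toWeighted d δ s x with hy
  have hyn : ‖y‖ = ‖x.1.1‖ := by
    rw [hy, EllOneHs.norm_toWeighted hδ.le, hbal, max_self]
  have hyx : y.1.1 = x.1.1 := rfl
  have hbd : ∀ n, ‖(g n).gradMapW hδ.le hs fun _ => y‖ ≤ b n * ‖x.1.1‖ := fun n => by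
    refine (gradMapW_diag_le hδ.le hs (g n) y).trans ?_
    rw [hyn, pow_succ, ← mul_assoc]
    exact mul_le_mul_of_nonneg_right (hg n) (norm_nonneg _)
  have hsum := Summable.of_norm_bounded (hb.mul_right ‖x.1.1‖) hbd
  set z := ∑' n, (g n).gradMapW hδ.le hs fun _ => y with hz
  have hzn : ‖z‖ ≤ (∑' n, b n) * ‖x.1.1‖ := by
    rw [← tsum_mul_right]
    exact tsum_of_norm_bounded (hb.mul_right ‖x.1.1‖).hasSum hbd
  have hz1 : z.1.1 = ∑' n, (g n).grad x.1.1 := by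
    have := (WSpace.fstCLM (sobWeight d δ s)).map_tsum hsum
    exact this
  have hz2 : (EllOneHs.ofWeighted d hδ s z).1.1 = ∑' n, (g n).grad x.1.1 := hz1
  rw [← hz2, EllOneHs.hsNorm_eq, EllOneHs.hsNorm_eq]
  refine ⟨EllOneHs.memHs _, ?_⟩
  rw [EllOneHs.ofWeighted_snd, norm_smul, norm_inv, Real.norm_of_nonneg hδ.le,
    inv_mul_le_iff₀ hδ]
  refine (WSpace.norm_snd_le z).trans (hzn.trans (le_of_eq ?_))
  rw [← hbal]
  ring

end Series
end

noncomputable section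

/-! ### Consequences of geometric growth of the coefficients. -/

section Geometric

variable {d : ℕ} {f : ∀ n, HomPoly d (n + 1)} {A B : ℝ}

theorem summable_gradSize (hf : ∀ N, (f (N + 1)).supNorm ≤ A * B ^ N) (hB : 0 ≤ B) {ρ : ℝ}
    (hρ : 0 ≤ ρ) (h : B * ρ ^ 2 < 1) : Summable (gradSize f ρ) := by
  have hn : ‖B * ρ ^ 2‖ < 1 := by rwa [Real.norm_of_nonneg (by positivity)]
  have h1 := summable_pow_mul_geometric_of_norm_lt_one 1 hn
  have h0 := summable_geometric_of_norm_lt_one hn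
  rw [← summable_nat_add_iff 1]
  refine Summable.of_nonneg_of_le (fun n => gradSize_nonneg f hρ _) (fun N => ?_)
    ((h1.add (h0.mul_left 2)).mul_left (2 * A * ρ ^ 3))
  have hN : (0 : ℝ) ≤ N := Nat.cast_nonneg N
  calc gradSize f ρ (N + 1) = 2 * (N + 2) * (f (N + 1)).supNorm * ρ ^ (2 * (N + 1) + 1) := by
        rw [gradSize]
        push_cast
        ring
    _ ≤ 2 * (N + 2) * (A * B ^ N) * ρ ^ (2 * (N + 1) + 1) := by
        gcongr
        exact hf N
    _ = _ := by
        rw [mul_pow, ← pow_mul]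
        ring

/-- The degree factor N + 2 is at most 2·2^N, which doubles the geometric rate. The extra 1/16
demanded of the leading factor accounts for the shift n = N + 1. -/
theorem fieldsSmall_of_geometric (h0 : (f 0).supNorm = 0)
    (hf : ∀ N, (f (N + 1)).supNorm ≤ A * B ^ N) (hB : 0 ≤ B) {R η : ℝ}
    (hη : 0 ≤ η) (h1 : 4 * A * R ^ 2 ≤ η / 16)
    (h2 : 2 * (B * R ^ 2) ≤ 1 / 16) (S : Finset ℕ) : FieldsSmall f S R η := by
  intro n _
  rcases n with _ | N
  · rw [h0]
    simpa using hη
  · have hN : (0 : ℝ) ≤ N := Nat.cast_nonneg N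
    have h3 : (N : ℝ) + 2 ≤ 2 * 2 ^ N := by
      have : N + 1 ≤ 2 ^ N := Nat.lt_two_pow_self
      have h4 : (N : ℝ) + 1 ≤ 2 ^ N := by exact_mod_cast this
      have h5 : (1 : ℝ) ≤ 2 ^ N := one_le_pow₀ (by norm_num)
      linarith
    have hf0 := (f (N + 1)).supNorm_nonneg
    have hR : R ^ (2 * (N + 1)) = R ^ 2 * (R ^ 2) ^ N := by ring
    calc 2 * (((N + 1 : ℕ) : ℝ) + 1) * (f (N + 1)).supNorm * R ^ (2 * (N + 1))
        = 2 * (N + 2) * (f (N + 1)).supNorm * (R ^ 2 * (R ^ 2) ^ N) := by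
          rw [hR]
          push_cast
          ring
      _ ≤ 2 * (2 * 2 ^ N) * (A * B ^ N) * (R ^ 2 * (R ^ 2) ^ N) := by
          gcongr
          exact hf N
      _ = (4 * A * R ^ 2) * (2 * (B * R ^ 2)) ^ N := by
          rw [mul_pow, mul_pow]
          ring
      _ ≤ (η / 16) * (1 / 16) ^ N := by gcongr
      _ = η * (1 / 16) ^ (N + 1) := by ring

/-- The terms of order at least `r`. -/
def tailFamily (f : ∀ n, HomPoly d (n + 1)) (r n : ℕ) : HomPoly d (n + 1) :=
  if r ≤ n then f n else 0

theorem supNorm_tailFamily_le (f : ∀ n, HomPoly d (n + 1)) (r n : ℕ) :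
    (tailFamily f r n).supNorm ≤ (f n).supNorm := by
  unfold tailFamily
  split_ifs
  · exact le_rfl
  · rw [HomPoly.supNorm_zero]
    exact (f n).supNorm_nonneg

theorem tsum_eval_tailFamily {r : ℕ} {u : EllOne d} (h : Summable fun n => (f n).eval u) :
    ∑' n, (tailFamily f r n).eval u = ∑' n, (f n).eval u - ∑ n ∈ Finset.range r, (f n).eval u := by
  rw [← h.sum_add_tsum_nat_add r, add_sub_cancel_left,
    ← (add_left_injective r).tsum_eq (f := fun n => (tailFamily f r n).eval u)]
  · refine tsum_congr fun n => ?_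
    rw [tailFamily, if_pos (Nat.le_add_left r n)]
  · intro n hn
    by_contra h1
    refine hn ?_
    have h2 : ¬ r ≤ n := fun h => h1 ⟨n - r, Nat.sub_add_cancel h⟩
    change (tailFamily f r n).eval u = 0
    rw [tailFamily, if_neg h2, HomPoly.eval_eq_zero HomPoly.supNorm_zero]

theorem rpow_le_tameConst_mul (s : ℝ) (n : ℕ) :
    (2 * n + 1 : ℝ) ^ (s + 2) ≤ tameConst s * 16 ^ n := by
  have h : _ ≤ tameConst s := (summable_tameConst s).le_tsum n fun m _ => by positivity
  rw [one_div, inv_pow, ← div_eq_mul_inv, div_le_iff₀ (by positivity)] at h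
  exact h

/-- The gradient of the terms of order at least `r` of a geometrically bounded series. -/
theorem memHs_tsum_grad_tailFamily (hf : ∀ N, (f (N + 1)).supNorm ≤ A * B ^ N) (hA : 0 ≤ A)
    (hB : 0 ≤ B) {s : ℝ} (hs : 0 ≤ s) {u : EllOne d} (hu : MemHs s u)
    (hy : B * ‖u‖ ^ 2 ≤ 1 / 16) (r : ℕ) :
    MemHs s (∑' n, (tailFamily f (r + 1) n).grad u : EllOne d) ∧
      hsNorm s (∑' n, (tailFamily f (r + 1) n).grad u : EllOne d) ≤
        tameConst s ^ 2 * (2 * A * B ^ r * 16 ^ (r + 1) * ‖u‖ ^ (2 * (r + 1))) * hsNorm s u := by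
  set κ : ℝ := tameConst s * (2 * A * B ^ r * 16 ^ (r + 1) * ‖u‖ ^ (2 * (r + 1))) with hκ
  set a : ℕ → ℝ := fun j => κ * ((2 * j + 1 : ℝ) ^ (s + 2) * (1 / 16) ^ j) with ha
  set b : ℕ → ℝ := fun n => if r + 1 ≤ n then a (n - (r + 1)) else 0 with hb
  have hab : ∀ j, b (j + (r + 1)) = a j := fun j => by
    simp only [hb]
    rw [if_pos (Nat.le_add_left _ _), Nat.add_sub_cancel]
  have hsa : Summable a := (summable_tameConst s).mul_left κ
  have hsb : Summable b := by
    rw [← summable_nat_add_iff (r + 1)]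
    exact hsa.congr fun j => (hab j).symm
  have htb : ∑' n, b n = κ * tameConst s := by
    rw [← (add_left_injective (r + 1)).tsum_eq (f := b), tameConst, ← tsum_mul_left]
    · exact tsum_congr hab
    · intro n hn
      by_contra h1
      refine hn ?_
      simp only [hb]
      exact if_neg fun h => h1 ⟨n - (r + 1), Nat.sub_add_cancel h⟩
  have key := memHs_tsum_grad (tailFamily f (r + 1)) hs hu hsb fun n => ?_
  · refine ⟨key.1, key.2.trans (le_of_eq ?_)⟩
    rw [htb, hκ]
    ring
  simp only [hb, tailFamily]
  split_ifs with hn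
  · obtain ⟨j, rfl⟩ := Nat.exists_eq_add_of_le' hn
    rw [Nat.add_sub_cancel]
    have hj : (0 : ℝ) ≤ j := Nat.cast_nonneg j
    have hr : (0 : ℝ) ≤ r := Nat.cast_nonneg r
    have hq : (f (j + (r + 1))).supNorm ≤ A * B ^ (j + r) := hf (j + r)
    have e1 : ∀ n : ℕ, (2 * (n : ℝ) + 1) ^ (s + 2) = (2 * n + 1) * (2 * n + 1 : ℝ) ^ (s + 1) := by
      intro n
      rw [show s + 2 = (s + 1) + 1 by ring, Real.rpow_add_one (by positivity), mul_comm]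
    -- The degree of a tail term is submultiplicatively split into a part in j and a part in r. The
    -- latter is bounded by `tameConst s * 16 ^ (r + 1)`, the former is summed over j into another
    -- `tameConst s`: hence the square in the conclusion.
    have e2 : (2 * ((j + (r + 1) : ℕ) : ℝ) + 1) ^ (s + 2) ≤
        (2 * j + 1 : ℝ) ^ (s + 2) * (tameConst s * 16 ^ (r + 1)) := by
      calc (2 * ((j + (r + 1) : ℕ) : ℝ) + 1) ^ (s + 2)
          ≤ ((2 * j + 1) * (2 * ((r + 1 : ℕ) : ℝ) + 1)) ^ (s + 2) := by
            gcongr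
            push_cast
            nlinarith [mul_nonneg hj hr]
        _ = (2 * j + 1 : ℝ) ^ (s + 2) * (2 * ((r + 1 : ℕ) : ℝ) + 1) ^ (s + 2) :=
            Real.mul_rpow (by positivity) (by positivity)
        _ ≤ _ := by
            gcongr
            exact rpow_le_tameConst_mul s (r + 1)
    set n := j + (r + 1) with hn'
    have hn0 : (0 : ℝ) ≤ n := Nat.cast_nonneg n
    have hp1 : 0 ≤ (2 * (n : ℝ) + 1) ^ (s + 1) := by positivity
    have ht := tameConst_nonneg s
    have hf0 := (f n).supNorm_nonneg
    calc 2 * ((n : ℝ) + 1) * (f n).supNorm * (2 * n + 1 : ℝ) ^ (s + 1) * ‖u‖ ^ (2 * n)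
        ≤ 2 * (2 * n + 1) * (A * B ^ (j + r)) * (2 * n + 1 : ℝ) ^ (s + 1) * ‖u‖ ^ (2 * n) := by
          gcongr
          linarith
      _ = 2 * (A * B ^ (j + r)) * (2 * (n : ℝ) + 1) ^ (s + 2) * ‖u‖ ^ (2 * n) := by
          rw [e1]
          ring
      _ ≤ 2 * (A * B ^ (j + r)) * ((2 * j + 1 : ℝ) ^ (s + 2) * (tameConst s * 16 ^ (r + 1))) *
          ‖u‖ ^ (2 * n) := by gcongr
      _ = κ * ((2 * j + 1 : ℝ) ^ (s + 2) * (B * ‖u‖ ^ 2) ^ j) := by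
          rw [hκ, hn', mul_pow]
          ring
      _ ≤ a j := by
          have : 0 ≤ κ := by positivity
          simp only [ha]
          gcongr
  · rw [HomPoly.supNorm_zero]
    simp

end Geometric
end

noncomputable section

/-! ### The transformed Hamiltonian. -/

section Conjugation

variable {d p r : ℕ} {freq : FreqLattice d → ℝ} {P : HomPoly d (p + 1)}

theorem normalFormEquations {ν : ℝ} (hν : 0 < ν) (hp : 1 ≤ p) :
    NormalFormEquations freq r P (fun n => (normalForm freq hν r P n).W)
      (fun n => (normalForm freq hν r P n).Q) (fun n => (normalForm freq hν r P n).χ)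
      (normalFormRemoved freq hν r P) where
  transport _ u := transport_eq freq hν r hp _ u
  homological _ hn u := homological_eq freq hν r hp hn u
  removed n k l := coeff_removed freq hν r n k l
  W_self u := eval_W_self freq hν r hp u
  W_lt _ hn := supNorm_W_of_lt freq hν r hp hn
  Q_zero := (supNorm_zero_terms freq hν r P hp).2.1
  χ_zero := (supNorm_zero_terms freq hν r P hp).2.2
  χ_le _ hn := supNorm_χ_of_le freq hν r P hn

theorem reverseCoeff_reverseCoeff (c : ℕ → C(unitInterval, ℝ)) :
    (fun n => (-1 : ℝ) • (reverseCoeff c n).comp timeReversal) = c := by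
  funext n
  ext t
  have h : timeReversal (timeReversal t) = t :=
    Subtype.ext (by simp [timeReversal, affineTime])
  change (-1 : ℝ) * ((-1 : ℝ) * c n (timeReversal (timeReversal t))) = c n t
  rw [h]
  ring

theorem abs_le_mul_sobWeight_sq {A δ : ℝ} (hA : ∀ k, |freq k| ≤ A * bracket k ^ 2) (hδ : 0 < δ)
    (k : FreqLattice d) : |freq k| ≤ |A| / δ ^ 2 * sobWeight d δ 1 k ^ 2 := by
  refine (hA k).trans ?_
  rw [sobWeight, Real.rpow_one, mul_pow, ← mul_assoc, div_mul_cancel₀ _ (by positivity)]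
  gcongr
  exact le_abs_self A

/-- The Hamiltonian in the variables given by the reversed flow. -/
theorem NormalFormEquations.hamiltonian_timeOne {W Q χ E : ∀ n, HomPoly d (n + 1)}
    (h : NormalFormEquations freq r P W Q χ E) (hp : 1 ≤ p) {A R η : ℝ}
    (hA : ∀ k, |freq k| ≤ A * bracket k ^ 2) (hη : 0 ≤ η) (hη1 : η * tameConst 1 ≤ 1 / 8)
    (hsmall : FieldsSmall χ (Finset.range r) R η)
    {Ψ : EllOne d → C(unitInterval, EllOne d)}
    (hΨ : IsHamFlow χ (Finset.range r) (reverseCoeff powCoeff) R Ψ)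
    (hW : ∀ ρ, 0 ≤ ρ → ρ ≤ R → Summable (gradSize W ρ))
    (hQ : ∀ ρ, 0 ≤ ρ → ρ ≤ R → Summable (gradSize Q ρ)) {v : EllOne d} (hv : ‖v‖ < R / 2)
    (hv1 : MemHs 1 v) :
    hamiltonian freq P (Ψ v 1) = quadHam freq v + ∑' n, (Q n).eval v := by
  have hR : 0 < R := by linarith [norm_nonneg v]
  obtain ⟨x, rfl⟩ := EllOneHs.exists_of_memHs hv1
  obtain ⟨δ, hδ, hbal⟩ := EllOneHs.exists_balance x
  set y := EllOneHs.toWeighted d δ 1 x with hy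
  have hyn : ‖y‖ = ‖x.1.1‖ := by
    rw [hy, EllOneHs.norm_toWeighted hδ.le, hbal, max_self]
  have hL := fieldLip_fieldMapW_le hδ.le zero_le_one hR.le hη zero_le_one hsmall
    (norm_reverseCoeff_le fun n _ => norm_powCoeff_le n)
  rw [one_mul] at hL
  have hL1 := hL.trans hη1
  obtain ⟨-, Φ, hΦ, -⟩ := exists_flow (S := Finset.range r)
    (X := fun n => (χ n).fieldMapW hδ.le zero_le_one) (c := reverseCoeff powCoeff)
    (fun n _ => nonempty_fieldIdx n) hR.le (hL1.trans_lt (by norm_num))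
  obtain ⟨h1, h2, -⟩ := hΦ y (by rw [hyn]; nlinarith)
  -- The flow solved in the weighted H¹ space projects to a small ℓ¹ curve, which uniqueness
  -- identifies with `Ψ`.
  have h3 := hΨ.unique x.1.1 _ (by linarith) ((norm_fst_comp_le (Φ y)).trans_lt h1)
    (h2.fst hδ.le zero_le_one)
  have h4 : (Φ y 1).1.1 = Ψ x.1.1 1 := by
    have := congrArg (fun γ : C(unitInterval, EllOne d) => γ 1) h3
    exact this
  -- Running this curve backwards gives a curve of the original field from `Ψ v 1` to `v`. The
  -- conservation law along it therefore expresses the Hamiltonian at `Ψ v 1` in terms of `v`.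
  have h5 := h2.reparam timeReversal 1 (-1) fun t => rfl
  rw [reverseCoeff_reverseCoeff, timeReversal_zero] at h5
  have hθ : ‖(Φ y).comp timeReversal‖ ≤ R := (norm_comp_le _ _).trans h1.le
  have hθ0 : 0 ≤ ‖(Φ y).comp timeReversal‖ := norm_nonneg ((Φ y).comp timeReversal)
  have h6 := h.tendsto_sum_Q hδ.le zero_le_one (A := |A| / δ ^ 2) (by positivity)
    (abs_le_mul_sobWeight_sq hA hδ) hp h5 (hW _ hθ0 hθ) (hQ _ hθ0 hθ)
  have h7 : ((Φ y).comp timeReversal) 1 = y := by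
    rw [ContinuousMap.comp_apply, timeReversal_one, h2.apply_zero]
  rw [h7, h4] at h6
  have h8 := (summable_eval Q (u := x.1.1) (by linarith) (hQ R hR.le le_rfl)).hasSum.tendsto_sum_nat
  have h9 := tendsto_nhds_unique h8 h6
  rw [h9]
  change _ = quadHam freq x.1.1 + (_ - quadHam freq x.1.1)
  ring

end Conjugation

/-! ### The constants of the theorem. -/

section Constants

theorem one_le_tameConst (s : ℝ) : 1 ≤ tameConst s := by
  have h := rpow_le_tameConst_mul s 0
  simpa using h

/-- The rate at which the coefficients of the normal form may grow. -/
def growthRate (p : ℕ) (a : ℝ) : ℝ := 64 * (p + 1) ^ 2 * (1 + a)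

/-- The constant which fixes the radius of the balls. -/
def radiusConst (p : ℕ) (a : ℝ) : ℝ := 2048 * tameConst 1 * growthRate p a

variable {p : ℕ} {a : ℝ}

theorem one_le_growthRate (ha : 0 ≤ a) : 64 * ((p + 1) * (1 + a)) ≤ growthRate p a := by
  have hp : (0 : ℝ) ≤ p := Nat.cast_nonneg p
  have h : (p + 1 : ℝ) ≤ (p + 1) ^ 2 := by nlinarith
  unfold growthRate
  nlinarith [mul_le_mul_of_nonneg_right h (by linarith : (0 : ℝ) ≤ 1 + a)]

theorem growthRate_ge (ha : 0 ≤ a) : 64 ≤ growthRate p a := by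
  have hp : (0 : ℝ) ≤ p := Nat.cast_nonneg p
  have := one_le_growthRate (p := p) ha
  nlinarith [mul_nonneg hp ha]

theorem radiusConst_ge (ha : 0 ≤ a) :
    2048 * growthRate p a ≤ radiusConst p a := by
  have h1 := one_le_tameConst 1
  have h2 := growthRate_ge (p := p) ha
  unfold radiusConst
  nlinarith

end Constants
end

noncomputable section

/-! ### Estimates on the balls of radius proportional to √ν / r. -/

section Estimates

variable {d p r : ℕ} {freq : FreqLattice d → ℝ} {P : HomPoly d (p + 1)} {ν ρ C : ℝ}

/-- This fixes the scaling of the radius: coefficients grow like powers of r²/ν and are measured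
against powers of ρ², and the product does not depend on r or ν. -/
theorem sq_div_mul_sq_radius (hν : 0 < ν) (hr : 1 ≤ r) (hC : 0 < C)
    (hρ : ρ = Real.sqrt ν / (C * r)) : (r : ℝ) ^ 2 / ν * ρ ^ 2 = 1 / C ^ 2 := by
  have hr0 : (0 : ℝ) < r := by exact_mod_cast hr
  rw [hρ, div_pow, Real.sq_sqrt hν.le]
  field_simp

/-- The coefficients of the terms of the normal form. -/
theorem normalForm_growth (hν : 0 < ν) (hν1 : ν < 1) (hp : 1 ≤ p) (hr : 1 ≤ r) (N : ℕ) :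
    (normalForm freq hν r P (N + 1)).W.supNorm ≤
        (1 + P.supNorm) * (2 * growthRate p P.supNorm * r ^ 2 / ν) ^ N ∧
      (normalForm freq hν r P (N + 1)).Q.supNorm ≤
        (p + 1) * (1 + P.supNorm) * (2 * growthRate p P.supNorm * r ^ 2 / ν) ^ N ∧
      (normalForm freq hν r P (N + 1)).Q.supNorm ≤
        (p + 1) * (1 + P.supNorm) * (growthRate p P.supNorm / ν) ^ N * (N.factorial : ℝ) ^ 2 ∧
      (normalForm freq hν r P (N + 1)).χ.supNorm ≤
        (p + 1) * ((1 + P.supNorm) / ν) * (growthRate p P.supNorm * r ^ 2 / ν) ^ N := by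
  have h := normRecursion_normalForm freq hν r P hp
  have h0 := P.supNorm_nonneg
  have h1 := h.pow_bounds hν hν1 hr (by linarith : P.supNorm ≤ 1 + P.supNorm) (by linarith) rfl N
  exact ⟨h1.1, h1.2, h.q_le_factorial hν hν1 (by linarith) (by linarith) rfl N,
    h.x_le_pow hν hν1 (by linarith) (by linarith) rfl N⟩

/-- The radius of the balls, in terms of the growth of the coefficients. -/
theorem growthRate_mul_sq_le {a : ℝ} (ha : 0 ≤ a) (hν : 0 < ν) (hr : 1 ≤ r)
    (hρ : ρ = Real.sqrt ν / (radiusConst p a * r)) :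
    2048 * tameConst 1 * (growthRate p a * (r : ℝ) ^ 2 / ν * ρ ^ 2) ≤ 1 := by
  have hD := growthRate_ge (p := p) ha
  have hC := radiusConst_ge (p := p) ha
  have hC1 : 1 ≤ radiusConst p a := by linarith
  have hC0 : 0 < radiusConst p a := by linarith
  have e := sq_div_mul_sq_radius hν hr hC0 hρ
  have e2 : growthRate p a * (r : ℝ) ^ 2 / ν * ρ ^ 2 = growthRate p a / radiusConst p a ^ 2 := by
    rw [mul_div_assoc, mul_assoc, e, mul_one_div]
  rw [e2, ← mul_div_assoc, div_le_one (by positivity)]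
  change radiusConst p a ≤ radiusConst p a ^ 2
  nlinarith

/-- The generators of the normal form are small. -/
theorem fieldsSmall_normalForm (hν : 0 < ν) (hν1 : ν < 1) (hp : 1 ≤ p) (hr : 1 ≤ r)
    (hρ : ρ = Real.sqrt ν / (radiusConst p P.supNorm * r)) :
    FieldsSmall (fun n => (normalForm freq hν r P n).χ) (Finset.range r) (4 * ρ)
      (1 / (8 * tameConst 1)) := by
  have h0 := P.supNorm_nonneg
  have hT := one_le_tameConst 1
  have hD := growthRate_ge (p := p) h0
  have hD2 := one_le_growthRate (p := p) h0
  have key := growthRate_mul_sq_le h0 hν hr hρ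
  set D := growthRate p P.supNorm with hDdef
  set T := tameConst 1 with hTdef
  have hr1 : (1 : ℝ) ≤ r := by exact_mod_cast hr
  set Y := D * (r : ℝ) ^ 2 / ν * ρ ^ 2 with hY
  have hY0 : 0 ≤ Y := by positivity
  refine fieldsSmall_of_geometric (f := fun n => (normalForm freq hν r P n).χ) (A := (p + 1) * ((1 + P.supNorm) / ν))
    (B := D * (r : ℝ) ^ 2 / ν) (supNorm_zero_terms freq hν r P hp).2.2
    (fun N => (normalForm_growth hν hν1 hp hr N).2.2.2) (by positivity) (by positivity) ?_ ?_ _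
  · have h1 : 64 * ((p + 1) * ((1 + P.supNorm) / ν)) * ρ ^ 2 ≤ Y := by
      calc 64 * ((p + 1) * ((1 + P.supNorm) / ν)) * ρ ^ 2
          = 64 * ((p + 1) * (1 + P.supNorm)) / ν * ρ ^ 2 := by ring
        _ ≤ D * (r : ℝ) ^ 2 / ν * ρ ^ 2 := by
          have h2 : 64 * ((p + 1) * (1 + P.supNorm)) ≤ D * (r : ℝ) ^ 2 :=
            hD2.trans (le_mul_of_one_le_right (by linarith) (one_le_pow₀ hr1))
          exact mul_le_mul_of_nonneg_right (div_le_div_of_nonneg_right h2 hν.le) (sq_nonneg ρ)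
    have h2 : Y ≤ 1 / (8 * T) / 16 := by
      rw [div_div, le_div_iff₀ (by positivity)]
      nlinarith [mul_nonneg (by linarith : (0 : ℝ) ≤ T) hY0]
    calc 4 * ((p + 1) * ((1 + P.supNorm) / ν)) * (4 * ρ) ^ 2
        = 64 * ((p + 1) * ((1 + P.supNorm) / ν)) * ρ ^ 2 := by ring
      _ ≤ _ := h1.trans h2
  · have h1 : 2 * (D * (r : ℝ) ^ 2 / ν * (4 * ρ) ^ 2) = 32 * Y := by
      rw [hY]
      ring
    rw [h1]
    nlinarith

/-- The bound is needed up to 4ρ, the radius in which the flows are constructed. Enlarging the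
radius and doubling the rate cost a factor 32, well within the 2048 of `radiusConst`. -/
theorem growth_mul_sq_le {a x : ℝ} (ha : 0 ≤ a) (hν : 0 < ν) (hr : 1 ≤ r)
    (hρ : ρ = Real.sqrt ν / (radiusConst p a * r)) (hx0 : 0 ≤ x) (hx : x ≤ 4 * ρ) :
    2 * growthRate p a * (r : ℝ) ^ 2 / ν * x ^ 2 ≤ 1 / 16 := by
  have hT := one_le_tameConst 1
  have hD := growthRate_ge (p := p) ha
  have key := growthRate_mul_sq_le ha hν hr hρ
  set Y := growthRate p a * (r : ℝ) ^ 2 / ν * ρ ^ 2 with hY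
  have hY0 : 0 ≤ Y := by positivity
  calc 2 * growthRate p a * (r : ℝ) ^ 2 / ν * x ^ 2
      ≤ 2 * growthRate p a * (r : ℝ) ^ 2 / ν * (4 * ρ) ^ 2 := by gcongr
    _ = 32 * Y := by
      rw [hY]
      ring
    _ ≤ 1 / 16 := by nlinarith

/-- The factorial bound is used here, not the geometric one, because the rate must involve the order
q = N + 2 and not r: N! ≤ (N+2)^N. -/
theorem supNorm_Q_le_radiusConst (hν : 0 < ν) (hν1 : ν < 1) (hp : 1 ≤ p) (hr : 1 ≤ r) (N : ℕ) :
    (normalForm freq hν r P (N + 1)).Q.supNorm ≤ radiusConst p P.supNorm ^ (2 * (N + 2)) *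
      (((N + 2 : ℕ) : ℝ) ^ 2 / ν) ^ N := by
  have h0 := P.supNorm_nonneg
  have hD := growthRate_ge (p := p) h0
  have hD2 := one_le_growthRate (p := p) h0
  have hC := radiusConst_ge (p := p) h0
  refine (normalForm_growth hν hν1 hp hr N).2.2.1.trans ?_
  set D := growthRate p P.supNorm with hDdef
  have hf : (N.factorial : ℝ) ≤ ((N + 2 : ℕ) : ℝ) ^ N := by
    exact_mod_cast (Nat.factorial_le_pow N).trans (Nat.pow_le_pow_left (by omega) N)
  have hp0 : (0 : ℝ) ≤ (p + 1) * (1 + P.supNorm) := by positivity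
  calc (p + 1) * (1 + P.supNorm) * (D / ν) ^ N * (N.factorial : ℝ) ^ 2
      ≤ D * (D / ν) ^ N * (((N + 2 : ℕ) : ℝ) ^ N) ^ 2 := by
        gcongr
        linarith
    _ = D ^ (N + 1) * (((N + 2 : ℕ) : ℝ) ^ 2 / ν) ^ N := by
        rw [div_pow, div_pow]
        ring
    _ ≤ radiusConst p P.supNorm ^ (2 * (N + 2)) * (((N + 2 : ℕ) : ℝ) ^ 2 / ν) ^ N := by
        gcongr
        calc D ^ (N + 1) ≤ radiusConst p P.supNorm ^ (N + 1) := by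
              gcongr
              linarith
          _ ≤ _ := pow_le_pow_right₀ (by linarith) (by omega)

/-- With r = m + 1, the geometric rate r²/ν is weakened to r³/ν, and the factors 2 and 16 per order
are absorbed in the square of `radiusConst`. -/
theorem remainder_coeff_le {a x : ℝ} (ha : 0 ≤ a) (hν : 0 < ν) (m : ℕ) (hx : 0 ≤ x) :
    2 * ((p + 1) * (1 + a)) * (2 * growthRate p a * ((m + 1 : ℕ) : ℝ) ^ 2 / ν) ^ m *
        16 ^ (m + 1) * x ≤
      radiusConst p a ^ (2 * (m + 1)) * (((m + 1 : ℕ) : ℝ) ^ 3 / ν) ^ m * x := by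
  have hD := growthRate_ge (p := p) ha
  have hD2 := one_le_growthRate (p := p) ha
  have hC := radiusConst_ge (p := p) ha
  have hm : (1 : ℝ) ≤ ((m + 1 : ℕ) : ℝ) := by exact_mod_cast Nat.le_add_left 1 m
  set D := growthRate p a with hDdef
  set b : ℝ := ((m + 1 : ℕ) : ℝ) with hb
  have h1 : 32 * D ≤ radiusConst p a ^ 2 := by nlinarith
  refine mul_le_mul_of_nonneg_right ?_ hx
  calc 2 * ((p + 1) * (1 + a)) * (2 * D * b ^ 2 / ν) ^ m * 16 ^ (m + 1)
      ≤ 2 * D * (2 * D * b ^ 2 / ν) ^ m * 16 ^ (m + 1) := by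
        gcongr
        linarith
    _ = (32 * D) ^ (m + 1) * (b ^ 2 / ν) ^ m := by
        rw [show 2 * D * b ^ 2 / ν = 2 * D * (b ^ 2 / ν) by ring, mul_pow (2 * D),
          show (32 : ℝ) * D = 2 * D * 16 by ring, mul_pow (2 * D), pow_succ (2 * D)]
        ring
    _ ≤ (radiusConst p a ^ 2) ^ (m + 1) * (b ^ 3 / ν) ^ m := by
        gcongr
        · norm_num
    _ = _ := by rw [← pow_mul]

/-- Order n corresponds to degree 2q with q = n + 1, so orders below r give q ≤ r; the order zero
term, at q = 1, vanishes. -/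
theorem sum_eval_shiftFamily (g : ∀ n, HomPoly d (n + 1)) (h0 : (g 0).supNorm = 0) (hr : 1 ≤ r)
    (u : EllOne d) : ∑ q ∈ Finset.Icc 2 r, (shiftFamily g q).eval u =
      ∑ n ∈ Finset.range r, (g n).eval u := by
  have h1 : Finset.Icc 2 r = Finset.Ico 2 (r + 1) := by
    ext q
    simp only [Finset.mem_Icc, Finset.mem_Ico]
    omega
  have h2 : ∑ n ∈ Finset.range r, (g n).eval u =
      ∑ q ∈ Finset.Ico 1 (r + 1), (shiftFamily g q).eval u := by
    rw [Finset.sum_Ico_eq_sum_range]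
    refine Finset.sum_congr rfl fun n _ => ?_
    rw [add_comm 1 n]
    rfl
  rw [h1, h2, Finset.sum_eq_sum_Ico_succ_bot (by omega : 1 < r + 1)]
  have h3 : (shiftFamily g 1).eval u = 0 := HomPoly.eval_eq_zero h0 u
  rw [h3, zero_add]

end Estimates
end

/-! ### The Birkhoff normal form theorem. -/

theorem theorem2p1 (d p : ℕ) (hd : 1 ≤ d) (hp : 1 ≤ p) :
    ∃ K : ℝ → ℝ,
    ∀ P : HomPoly d (p + 1),
    ∃ C : ℝ, 1 < C ∧
    ∀ freq : FreqLattice d → ℝ, (∃ A : ℝ, ∀ k, |freq k| ≤ A * bracket k ^ 2) →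
    ∀ ν : ℝ, 0 < ν → ν < 1 →
    ∀ r : ℕ, 2 ≤ r →
    ∀ ρ : ℝ, ρ = Real.sqrt ν / (C * r) →
    ∃ (τ : Fin 2 → EllOne d → EllOne d) (L : (q : ℕ) → HomPoly d q) (R : EllOne d → ℝ),
      -- `τ 0` and `τ 1` are smooth and symplectic on the balls of radii `ρ` and `2ρ`
      (∀ σ : Fin 2,
        ContDiffOn ℝ ∞ (τ σ) (Metric.ball 0 (2 ^ (σ : ℕ) * ρ)) ∧
        IsSymplecticOn (τ σ) (Metric.ball 0 (2 ^ (σ : ℕ) * ρ))) ∧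
      -- the diagram commutes
      (∀ u ∈ Metric.ball (0 : EllOne d) ρ,
        τ 0 u ∈ Metric.ball (0 : EllOne d) (2 * ρ) ∧ τ 1 (τ 0 u) = u) ∧
      -- normal form decomposition, wherever the quadratic part makes sense
      (∀ u ∈ Metric.ball (0 : EllOne d) (2 * ρ), MemHs 1 u →
        hamiltonian freq P (τ 1 u) =
          quadHam freq u + (∑ q ∈ Finset.Icc 2 r, (L q).eval u) + R u) ∧
      -- the resonant terms
      (∀ q ∈ Finset.Icc 2 r,
        (L q).IsResonant freq ν ∧
        (L q).supNorm ≤ C ^ (2 * q) * ((q : ℝ) ^ 2 / ν) ^ (q - 2)) ∧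
      -- the remainder
      ContDiffOn ℝ ∞ R (Metric.ball 0 (2 * ρ)) ∧
      (∀ s : ℝ, 0 ≤ s → ∀ u ∈ Metric.ball (0 : EllOne d) (2 * ρ), MemHs s u →
        ∃ g : FreqLattice d → ℂ, IsGradient R u g ∧ MemHs s g ∧
          hsNorm s g ≤
            K s * (C ^ (2 * r) * ((r : ℝ) ^ 3 / ν) ^ (r - 1) * ‖u‖ ^ (2 * r) * hsNorm s u)) ∧
      -- the `H^s` bounds on `τ 0` and `τ 1`
      (∀ (σ : Fin 2) (s : ℝ), 0 ≤ s →
        ∀ u ∈ Metric.ball (0 : EllOne d) (2 ^ (σ : ℕ) * ρ), MemHs s u →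
          MemHs s (τ σ u) ∧ hsNorm s (τ σ u) ≤ K s * hsNorm s u) ∧
      -- smoothness of `τ 0` and `τ 1` as maps with values in `ℓ¹ ∩ H^s`
      (∀ (σ : Fin 2) (s : ℝ), 0 ≤ s →
        ∃ T : EllOneHs d s → EllOneHs d s,
          (∀ u : EllOneHs d s, ‖EllOneHs.toEllOne u‖ < 2 ^ (σ : ℕ) * ρ →
            EllOneHs.toEllOne (T u) = τ σ (EllOneHs.toEllOne u)) ∧
          ContDiffOn ℝ ∞ T {u | ‖EllOneHs.toEllOne u‖ < 2 ^ (σ : ℕ) * ρ}) := by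
  -- One summand serves the maps τ, the other the gradient of the remainder; neither involves `P` or
  -- the frequencies.
  refine ⟨fun s => flowConst s + tameConst s ^ 2, fun P => ?_⟩
  have h0 := P.supNorm_nonneg
  have hT := one_le_tameConst 1
  have hD := growthRate_ge (p := p) h0
  have hC := radiusConst_ge (p := p) h0
  refine ⟨radiusConst p P.supNorm, by linarith, ?_⟩
  rintro freq ⟨A, hA⟩ ν hν hν1 r hr ρ hρ
  have hr1 : 1 ≤ r := by omega
  have hr0 : (0 : ℝ) < r := by exact_mod_cast hr1
  have hC0 : 0 < radiusConst p P.supNorm := by linarith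
  have hρ0 : 0 < ρ := by
    rw [hρ]
    exact div_pos (Real.sqrt_pos.2 hν) (mul_pos hC0 hr0)
  have hη0 : 0 ≤ 1 / (8 * tameConst 1) := by positivity
  have hη1 : 1 / (8 * tameConst 1) * tameConst 1 ≤ 1 / 8 := by
    rw [div_mul_eq_mul_div, one_mul, div_le_iff₀ (by positivity)]
    linarith
  have hηle : 1 / (8 * tameConst 1) ≤ 1 := by
    rw [div_le_one (by positivity)]
    linarith
  have hη2 : 1 / (8 * tameConst 1) * tameConst 0 ≤ 1 / 8 :=
    (mul_le_mul_of_nonneg_left (tameConst_zero_le zero_le_one) hη0).trans hη1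
  set W : ∀ n, HomPoly d (n + 1) := fun n => (normalForm freq hν r P n).W
  set Q : ∀ n, HomPoly d (n + 1) := fun n => (normalForm freq hν r P n).Q
  set χ : ∀ n, HomPoly d (n + 1) := fun n => (normalForm freq hν r P n).χ
  set B : ℝ := 2 * growthRate p P.supNorm * (r : ℝ) ^ 2 / ν
  have hB0 : 0 ≤ B := by positivity
  have hsmall : FieldsSmall χ (Finset.range r) (4 * ρ) (1 / (8 * tameConst 1)) :=
    fieldsSmall_normalForm hν hν1 hp hr1 hρ
  have hBx : ∀ x, 0 ≤ x → x ≤ 4 * ρ → B * x ^ 2 ≤ 1 / 16 := fun x hx0 hx =>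
    growth_mul_sq_le h0 hν hr1 hρ hx0 hx
  have hWs : ∀ x, 0 ≤ x → x ≤ 4 * ρ → Summable (gradSize W x) := fun x hx0 hx =>
    summable_gradSize (fun N => (normalForm_growth hν hν1 hp hr1 N).1) hB0 hx0
      ((hBx x hx0 hx).trans_lt (by norm_num))
  have hQg : ∀ N, (Q (N + 1)).supNorm ≤ (p + 1) * (1 + P.supNorm) * B ^ N := fun N =>
    (normalForm_growth hν hν1 hp hr1 N).2.1
  have hQs : ∀ x, 0 ≤ x → x ≤ 4 * ρ → Summable (gradSize Q x) := fun x hx0 hx =>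
    summable_gradSize hQg hB0 hx0 ((hBx x hx0 hx).trans_lt (by norm_num))
  have hQ0 : (Q 0).supNorm = 0 := (supNorm_zero_terms freq hν r P hp).2.1
  have hc : ∀ n ∈ Finset.range r, ‖powCoeff n‖ ≤ 1 := fun n _ => norm_powCoeff_le n
  have hc' : ∀ n ∈ Finset.range r, ‖reverseCoeff powCoeff n‖ ≤ 1 := norm_reverseCoeff_le hc
  -- Both flows are built in the ball of radius R = 4ρ, so that ρ = R/4 and 2ρ = R/2 are the radii
  -- for inverting the flow and for its estimates.
  obtain ⟨Φ, hΦ⟩ := exists_isHamFlow (by linarith) hη0 hη2 hsmall hc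
  obtain ⟨Ψ, hΨ⟩ := exists_isHamFlow (by linarith) hη0 hη2 hsmall hc'
  have e0 : (2 : ℝ) ^ ((0 : Fin 2) : ℕ) * ρ ≤ 4 * ρ / 2 := by
    simp only [Fin.val_zero, pow_zero]
    linarith
  have e1 : (2 : ℝ) ^ ((1 : Fin 2) : ℕ) * ρ ≤ 4 * ρ / 2 := by
    simp only [Fin.val_one, pow_one]
    linarith
  have hflow : ∀ s, 0 ≤ tameConst s ^ 2 := fun s => sq_nonneg _
  have hflow1 : ∀ s, 0 ≤ flowConst s := fun s => by
    unfold flowConst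
    positivity
  -- The normal form holds the orders below r and the remainder all orders from r on, that is
  -- degrees at least 2r + 2.
  refine ⟨![fun u => Φ u 1, fun u => Ψ u 1], shiftFamily Q,
    fun u => ∑' n, (tailFamily Q r n).eval u, ?_, ?_, ?_, ?_, ?_, ?_, ?_, ?_⟩
  · rw [Fin.forall_fin_two]
    exact ⟨⟨hΦ.contDiffOn_timeOne e0, hΦ.isSymplecticOn_timeOne e0⟩,
      hΨ.contDiffOn_timeOne e1, hΨ.isSymplecticOn_timeOne e1⟩
  · intro u hu
    rw [mem_ball_zero_iff] at hu
    obtain ⟨h1, h2⟩ := hΦ.leftInverse hΨ (u := u) (by linarith)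
    refine ⟨mem_ball_zero_iff.2 ?_, h2⟩
    change ‖Φ u 1‖ < _
    linarith
  · intro u hu hu1
    rw [mem_ball_zero_iff] at hu
    have h1 := (normalFormEquations (freq := freq) (r := r) (P := P) hν hp).hamiltonian_timeOne hp
      hA hη0 hη1 hsmall hΨ hWs hQs (v := u) (by linarith) hu1
    have h2 : Summable fun n => (Q n).eval u :=
      summable_eval Q (ρ := 4 * ρ) (by linarith) (hQs _ (by linarith) le_rfl)
    have h3 := tsum_eval_tailFamily (r := r) h2
    have h4 := sum_eval_shiftFamily Q hQ0 hr1 u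
    change hamiltonian freq P (Ψ u 1) = _ + _ + ∑' n, (tailFamily Q r n).eval u
    rw [h1, h3, h4]
    ring
  · intro q hq
    rw [Finset.mem_Icc] at hq
    obtain ⟨N, rfl⟩ := Nat.exists_eq_add_of_le' hq.1
    exact ⟨isResonant_Q freq hν r (n := N + 1) (by omega),
      supNorm_Q_le_radiusConst hν hν1 hp hr1 N⟩
  · refine contDiffOn_tsum_eval_succ _ (by linarith)
      (B := (p + 1) * (1 + P.supNorm) * (2 * ρ) ^ 4) fun n => ?_
    refine (mul_le_mul_of_nonneg_right (supNorm_tailFamily_le Q r n) (by positivity)).trans ?_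
    rcases n with _ | N
    · rw [hQ0, zero_mul]
      positivity
    · have h1 := hBx (2 * ρ) (by linarith) (by linarith)
      calc (Q (N + 1)).supNorm * (2 * ρ) ^ (2 * (N + 1 + 1))
          ≤ (p + 1) * (1 + P.supNorm) * B ^ N * (2 * ρ) ^ (2 * (N + 1 + 1)) := by
            gcongr
            exact hQg N
        _ = (p + 1) * (1 + P.supNorm) * (2 * ρ) ^ 4 * (B * (2 * ρ) ^ 2) ^ N := by
            rw [mul_pow B, ← pow_mul (2 * ρ)]
            ring
        _ ≤ (p + 1) * (1 + P.supNorm) * (2 * ρ) ^ 4 * 1 := by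
            gcongr
            exact pow_le_one₀ (by positivity) (h1.trans (by norm_num))
        _ = _ := mul_one _
  · intro s hs u hu hus
    rw [mem_ball_zero_iff] at hu
    have hus0 : 0 ≤ hsNorm s u := Real.sqrt_nonneg _
    -- Writing r = m + 1 matches the shift in the coefficient bounds, where order N + 1 carries the
    -- power N of the rate.
    obtain ⟨m, rfl⟩ := Nat.exists_eq_add_of_le' hr1
    have hsum : Summable (gradSize (tailFamily Q (m + 1)) (2 * ρ)) := by
      refine Summable.of_nonneg_of_le (gradSize_nonneg _ (by linarith)) (fun n => ?_)
        (hQs (2 * ρ) (by linarith) (by linarith))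
      unfold gradSize
      gcongr
      exact supNorm_tailFamily_le Q _ n
    obtain ⟨h1, h2⟩ := memHs_tsum_grad_tailFamily hQg (by positivity) hB0 hs hus
      (hBx _ (norm_nonneg u) (by linarith)) m
    refine ⟨_, isGradient_tsum_eval _ hu hsum, h1, h2.trans ?_⟩
    have h3 := remainder_coeff_le (p := p) h0 hν m (pow_nonneg (norm_nonneg u) (2 * (m + 1)))
    rw [mul_assoc]
    refine mul_le_mul (le_add_of_nonneg_left (hflow1 s)) ?_ (by positivity)
      (add_nonneg (hflow1 s) (hflow s))
    refine mul_le_mul_of_nonneg_right ?_ hus0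
    calc 2 * ((p + 1) * (1 + P.supNorm)) * B ^ m * 16 ^ (m + 1) * ‖u‖ ^ (2 * (m + 1)) ≤ _ := h3
      _ = _ := by rw [Nat.add_sub_cancel]
  · have hK : ∀ (s : ℝ) (u : EllOne d), flowConst s * hsNorm s u ≤
        (flowConst s + tameConst s ^ 2) * hsNorm s u := fun s u =>
      mul_le_mul_of_nonneg_right (le_add_of_nonneg_right (hflow s)) (Real.sqrt_nonneg _)
    rw [Fin.forall_fin_two]
    constructor
    · intro s hs u hu hus
      have h1 := hΦ.memHs_timeOne hη0 hηle hsmall hc e0 hs (mem_ball_zero_iff.1 hu) hus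
      exact ⟨h1.1, h1.2.trans (hK s u)⟩
    · intro s hs u hu hus
      have h1 := hΨ.memHs_timeOne hη0 hηle hsmall hc' e1 hs (mem_ball_zero_iff.1 hu) hus
      exact ⟨h1.1, h1.2.trans (hK s u)⟩
  · rw [Fin.forall_fin_two]
    exact ⟨fun s hs => hΦ.exists_contDiffOn_lift hη0 hηle hsmall hc e0 hs,
      fun s hs => hΨ.exists_contDiffOn_lift hη0 hηle hsmall hc' e1 hs⟩
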